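/- For integers $k\ge 1$ define $f(k)$ by $f(1)=1$, $f(2)=1$, $f(3)=2$, $f(4)=2$ and, for $k>4$, $$f(k)=\min\Bigl(\{f(k-1)+1\}\cup\bigl\{k_1k_2-k_1-k_2+1+\max(f(k_1),k_2)\;:\;k_1k_2=k,\ 1\le k_1<k\bigr\}\Bigr).$$ The $k$-SUM problem on $n$ numbers is: given $k$ lists $S_1,\dots,S_k$ of $n$ integers each and an integer target $t$, find positions of elements $s_i\in S_i$ ($i=1,\dots,k$) with $s_1+\dots+s_k=t$, or report that there are none. The model of computation is a randomized word RAM with words of $w$ bits: a finite program, independent of $w$ and of the input, performs arithmetic (modulo $2^w$), bitwise operations, comparisons, memory accesses and draws of uniformly random words at unit cost. A Las Vegas algorithm never gives a wrong answer, its running time is the expected number of steps (on the worst input), and its space is the number of words in use, input included, in every run. **Corollary.** For every $k\ge 1$ there is a Las Vegas algorithm that solves $k$-SUM on $n$ numbers in $\tilde O(n^{f(k)})$ time and $O(n)$ space. Precisely: for every $k\ge1$ there are a program and constants $C,c$ (depending only on $k$) such that for all $n\ge 1$, all integer inputs $S_1,\dots,S_k,t$, and all word lengths $w$ for which $C$ times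 $n$, $C$ times $|t|$ and $C$ times the absolute value of every input number are less than $2^w$, the program, started on this input, answers correctly whenever it halts, takes at most $C\,n^{f(k)}\,(\lfloor\log_2 n\rfloor+1)^c$ steps in expectation, and uses at most $C\,n$ words of memory in every run. -/

import Mathlib

open MeasureTheory
open scoped ENNReal

namespace KSum

/-! ### The exponent function -/

/-- The exponent `f(k)`: `f(1) = 1`, `f(2) = 1`, `f(3) = 2`, `f(4) = 2` and, for `k > 4`, `f(k)` is
the minimum of `f(k-1) + 1` and of all `k₁k₂ - k₁ - k₂ + 1 + max(f(k₁), k₂)` with `k₁k₂ = k`.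
Here `k₁` ranges over the divisors of `k` with `k₁ < k` and `k₂ = k / k₁`; for `k₁ = k`, `k₂ = 1`
the expression would be `f(k)` itself. The sum is written `(k + 1 - k₁ - k₂) + …`, in which no
natural-number subtraction truncates. The value at `0` is irrelevant. -/
def f : ℕ → ℕ
  | 0 => 0
  | 1 => 1
  | 2 => 1
  | 3 => 2
  | 4 => 2
  | k + 5 =>
    (k + 5).properDivisors.attach.fold min (f (k + 4) + 1)
      (fun d => ((k + 5) + 1 - d.1 - (k + 5) / d.1) + max (f d.1) ((k + 5) / d.1))
  termination_by k => k
  decreasing_by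
    · omega
    · exact (Nat.mem_properDivisors.mp d.2).2

/-! ### A randomized word RAM

The machine works on words of `w` bits. It has registers, and a random access memory whose
cells are addressed by words. Programs are finite, and do not depend on `w` or on the input. -/

/-- The binary operations on words; arithmetic is modulo `2 ^ w`. -/
inductive BinOp
  | add | sub | mul | div | mod | and | or | xor | shl | shr

/-- The meaning of the binary operations (`div`, `mod`, `shr` are unsigned). -/
def BinOp.eval {w : ℕ} : BinOp → BitVec w → BitVec w → BitVec w
  | .add, x, y => x + y
  | .sub, x, y => x - y
  | .mul, x, y => x * y
  | .div, x, y => x / y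
  | .mod, x, y => x % y
  | .and, x, y => x &&& y
  | .or, x, y => x ||| y
  | .xor, x, y => x ^^^ y
  | .shl, x, y => x <<< y
  | .shr, x, y => x >>> y

/-- Elementary instructions; `r`, `s`, `u` are names of registers. -/
inductive Instr
  /-- put the constant `c` (modulo `2 ^ w`) into register `r` -/
  | const (r c : ℕ)
  /-- copy register `s` to register `r` -/
  | move (r s : ℕ)
  /-- put the result of an operation on registers `s` and `u` into register `r` -/
  | bin (o : BinOp) (r s u : ℕ)
  /-- put the content of the memory cell whose address is in register `s` into register `r` -/
  | load (r s : ℕ)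
  /-- write register `s` to the memory cell whose address is in register `r` -/
  | store (r s : ℕ)
  /-- put a fresh uniformly random word into register `r` -/
  | rand (r : ℕ)

/-- Tests that compare two registers: equality, unsigned `<`, and signed `<`. -/
inductive Test
  | eq (r s : ℕ)
  | ult (r s : ℕ)
  | slt (r s : ℕ)

/-- Programs. There are no recursive calls, so that the control state of a running program takes
one of finitely many values, like the program counter of a machine with jumps. -/
inductive Prog
  | skip
  | op (i : Instr)
  | seq (p q : Prog)
  | ite (b : Test) (p q : Prog)
  | loop (b : Test) (p : Prog)

/-- One more than the largest register that an instruction mentions. -/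
def Instr.numRegs : Instr → ℕ
  | .const r _ => r + 1
  | .move r s => max r s + 1
  | .bin _ r s u => max r (max s u) + 1
  | .load r s => max r s + 1
  | .store r s => max r s + 1
  | .rand r => r + 1

/-- One more than the largest register that a test mentions. -/
def Test.numRegs : Test → ℕ
  | .eq r s => max r s + 1
  | .ult r s => max r s + 1
  | .slt r s => max r s + 1

/-- The number of registers of a program. -/
def Prog.numRegs : Prog → ℕ
  | .skip => 0
  | .op i => i.numRegs
  | .seq p q => max p.numRegs q.numRegs
  | .ite b p q => max b.numRegs (max p.numRegs q.numRegs)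
  | .loop b p => max b.numRegs p.numRegs

/-- The data part of a configuration. -/
structure State (w : ℕ) where
  /-- the registers -/
  reg : ℕ → BitVec w
  /-- the memory -/
  mem : BitVec w → BitVec w
  /-- the number of random words drawn so far -/
  drawn : ℕ
  /-- the number of memory cells in use: all cells that hold the input, or that were read or
  written so far, have an address below this number -/
  cells : ℕ

/-- The effect of an instruction. The random source `ω` is a sequence of words that is consumed in
order. -/
def Instr.exec {w : ℕ} (ω : ℕ → Fin (2 ^ w)) : Instr → State w → State w
  | .const r c, σ => { σ with reg := Function.update σ.reg r (BitVec.ofNat w c) }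
  | .move r s, σ => { σ with reg := Function.update σ.reg r (σ.reg s) }
  | .bin o r s u, σ => { σ with reg := Function.update σ.reg r (o.eval (σ.reg s) (σ.reg u)) }
  | .load r s, σ =>
    { σ with
      reg := Function.update σ.reg r (σ.mem (σ.reg s))
      cells := max σ.cells ((σ.reg s).toNat + 1) }
  | .store r s, σ =>
    { σ with
      mem := Function.update σ.mem (σ.reg r) (σ.reg s)
      cells := max σ.cells ((σ.reg r).toNat + 1) }
  | .rand r, σ =>
    { σ with
      reg := Function.update σ.reg r (BitVec.ofFin (ω σ.drawn))
      drawn := σ.drawn + 1 }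

/-- The outcome of a test. -/
def Test.eval {w : ℕ} : Test → State w → Bool
  | .eq r s, σ => σ.reg r == σ.reg s
  | .ult r s, σ => (σ.reg r).ult (σ.reg s)
  | .slt r s, σ => (σ.reg r).slt (σ.reg s)

/-- A configuration: the parts of the program that remain to be executed, in order, and the data. -/
abbrev Config (w : ℕ) := List Prog × State w

/-- One step of the machine. A configuration with nothing left to execute has halted. -/
def step {w : ℕ} (ω : ℕ → Fin (2 ^ w)) : Config w → Config w
  | ([], σ) => ([], σ)
  | (.skip :: K, σ) => (K, σ)
  | (.op i :: K, σ) => (K, i.exec ω σ)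
  | (.seq p q :: K, σ) => (p :: q :: K, σ)
  | (.ite b p q :: K, σ) => (if b.eval σ then p :: K else q :: K, σ)
  | (.loop b p :: K, σ) => (if b.eval σ then p :: .loop b p :: K else K, σ)

/-- The configuration after `m` steps of the program `P` from the data `σ`. -/
def run {w : ℕ} (ω : ℕ → Fin (2 ^ w)) (P : Prog) (σ : State w) (m : ℕ) : Config w :=
  (step ω)^[m] ([P], σ)

/-- A configuration has halted. -/
def Halted {w : ℕ} (c : Config w) : Prop := c.1 = []

/-- The number of steps until the machine halts, `∞` if it never does. -/
noncomputable def runningTime {w : ℕ} (P : Prog) (σ : State w) (ω : ℕ → Fin (2 ^ w)) : ℝ≥0∞ :=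
  ⨅ (m : ℕ) (_ : Halted (run ω P σ m)), (m : ℝ≥0∞)

/-- The first `m` steps depend on the first `m` random words only. -/
theorem run_congr {w : ℕ} (P : Prog) (σ : State w) (h0 : σ.drawn = 0) (m : ℕ)
    (ω ω' : ℕ → Fin (2 ^ w)) (h : ∀ i < m, ω i = ω' i) :
    run ω P σ m = run ω' P σ m ∧ (run ω P σ m).2.drawn ≤ m := by
  induction m with
  | zero => simp [run, h0]
  | succ m ih =>
    obtain ⟨a, b⟩ := ih (fun i hi => h i (by omega))
    simp only [run, Function.iterate_succ_apply'] at a b ⊢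
    rw [← a]
    generalize (step ω)^[m] ([P], σ) = c at b ⊢
    obtain ⟨K, τ⟩ := c
    simp only at b
    have hb := h τ.drawn (by omega)
    rcases K with _ | ⟨p, K⟩
    · simp only [step, true_and]; omega
    · cases p <;> simp only [step, true_and]
      case op i => cases i <;> simp only [Instr.exec, hb, true_and] <;> omega
      all_goals omega

/-- The running time is a measurable function of the random source. -/
theorem measurable_runningTime {w : ℕ} (P : Prog) (σ : State w) (h0 : σ.drawn = 0) :
    Measurable (runningTime P σ) := by
  unfold runningTime
  refine Measurable.iInf fun m => ?_
  have : (fun ω : ℕ → Fin (2 ^ w) => ⨅ (_ : Halted (run ω P σ m)), (m : ℝ≥0∞)) =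
      (fun v : Fin m → Fin (2 ^ w) =>
        ⨅ (_ : Halted (run (fun i => if h : i < m then v ⟨i, h⟩ else 0) P σ m)), (m : ℝ≥0∞)) ∘
      (fun ω i => ω i) := by
    funext ω
    have e := (run_congr P σ h0 m ω (fun i => if h : i < m then ω i else 0)
      (by intro i hi; simp [hi])).1
    show (⨅ (_ : Halted (run ω P σ m)), (m : ℝ≥0∞)) =
      ⨅ (_ : Halted (run (fun i => if h : i < m then ω i else 0) P σ m)), (m : ℝ≥0∞)
    rw [← e]
  rw [this]
  exact (measurable_of_countable _).comp (by fun_prop)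

/-- The law of the random source: independent uniformly distributed words. -/
noncomputable def randomWords (w : ℕ) : Measure (ℕ → Fin (2 ^ w)) :=
  Measure.infinitePi (fun _ => (PMF.uniformOfFintype (Fin (2 ^ w))).toMeasure)

/-- The expected number of steps until the machine halts. -/
noncomputable def expectedTime {w : ℕ} (P : Prog) (σ : State w) : ℝ≥0∞ :=
  ∫⁻ ω, runningTime P σ ω ∂(randomWords w)

/-- The space, in words, in use after `m` steps: memory cells, including those of the input, and
registers. -/
def spaceUsed {w : ℕ} (ω : ℕ → Fin (2 ^ w)) (P : Prog) (σ : State w) (m : ℕ) : ℕ :=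
  (run ω P σ m).2.cells + P.numRegs

/-! ### The problem -/

/-- The initial data on the instance that consists of `k` lists `S 0, …, S (k-1)` of `n` integers
each and of the target `t`: register `0` holds `n`, register `1` holds `t`, the cell `i * n + j`
holds `S i j` (in two's complement), and everything else is `0`. -/
def initial (w : ℕ) {k n : ℕ} (S : Fin k → Fin n → ℤ) (t : ℤ) : State w where
  reg := fun r => if r = 0 then BitVec.ofNat w n else if r = 1 then BitVec.ofInt w t else 0
  mem := fun a =>
    if h : a.toNat < k * n then
      BitVec.ofInt w (S (finProdFinEquiv.symm ⟨a.toNat, h⟩).1 (finProdFinEquiv.symm ⟨a.toNat, h⟩).2)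
    else 0
  drawn := 0
  cells := k * n

/-- `s` selects one element from each list such that the selected elements sum to `t`. -/
def IsSolution {k n : ℕ} (S : Fin k → Fin n → ℤ) (t : ℤ) (s : Fin k → Fin n) : Prop :=
  ∑ i, S i (s i) = t

/-- The final data answers the instance correctly: either register `0` holds `1` and the registers
`1, …, k` hold the positions of the elements of a solution, or register `0` holds `0` and there is
no solution. -/
def CorrectAnswer {w k n : ℕ} (S : Fin k → Fin n → ℤ) (t : ℤ) (σ : State w) : Prop :=
  (σ.reg 0 = 1 ∧ ∃ s, IsSolution S t s ∧ ∀ i : Fin k, (σ.reg (i + 1)).toNat = s i) ∨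
  (σ.reg 0 = 0 ∧ ∀ s, ¬ IsSolution S t s)

/-- Words of `w` bits can hold the numbers of the instance and the number `n`, with room for a
further factor `C`. -/
def Fits (C w : ℕ) {k n : ℕ} (S : Fin k → Fin n → ℤ) (t : ℤ) : Prop :=
  C * n < 2 ^ w ∧ (∀ i j, (C : ℤ) * |S i j| < 2 ^ w) ∧ (C : ℤ) * |t| < 2 ^ w

/-- The program `P` is a Las Vegas algorithm that solves `k`-SUM on `n` numbers in expected time
`T n` and in space `s n`, for all `n ≥ 1`, on all machines whose word length suffices for the
instance up to the factor `C`. The answer is never wrong, and the bound on the space holds in every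
run. -/
def LasVegasSolves (k : ℕ) (P : Prog) (C : ℕ) (T s : ℕ → ℕ) : Prop :=
  ∀ (n : ℕ), 1 ≤ n → ∀ (S : Fin k → Fin n → ℤ) (t : ℤ) (w : ℕ), Fits C w S t →
    (∀ ω m, Halted (run ω P (initial w S t) m) →
      CorrectAnswer S t (run ω P (initial w S t) m).2) ∧
    expectedTime P (initial w S t) ≤ (T n : ℝ≥0∞) ∧
    (∀ ω m, spaceUsed ω P (initial w S t) m ≤ s n)

end KSum

/-! The algorithm is deterministic: it draws no random words, so the expected time is simply the
number of steps.

The `k` lists are divided into groups. The sums of a group of `d + 1` lists are too many to store,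
but they can be produced in increasing order in chunks of at most `n`, with `O(n)` space: for fixed
elements of `d` of the lists, a binary search in the remaining, sorted list finds the least sum
above the previous one, so the next sum takes about `n ^ d` steps (`searchStep_spec`); for two lists
a tournament tree produces it in logarithmic time (`mergeStep_spec`). For each chunk, with least
element `lo` and largest element `hi`, the sums `r` of the other groups are enumerated recursively,
restricted to those in `[u - hi, v - lo]`, where `[u, v]` is the interval of wanted totals; a binary
search in the chunk then completes `r`.

The restriction keeps the number of pairs (chunk, `r`) small. For fixed `r`, a visited chunk either
contains an `l` with `u ≤ l + r ≤ v`, and this hit pays for the visit, or the interval for `l` falls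
into a gap inside the chunk, which happens for one chunk at most (`chunkPotential_step`). So the
other groups contribute `n ^ numLists L` once, and only the base cost of their enumeration is
multiplied by the number of chunks (`chunkLevel_spec`). This yields the recursion `costExponent`.

Call the number of lists minus the exponent the saving. A group of `d + 1` lists, put in front of
groups with saving at most `d` and exponent at least `d + 1`, raises the exponent by `d` only, so
the saving grows by one. Hence about `s ^ 2 / 2` lists suffice for a saving `s`
(`costExponent_savingLevels`). Conversely `f` never saves more than these groups do (`lt_f_add`): a
product `k₁ * k₂` saves at most `min (k₁ - f k₁ + k₂ - 1) (k₁ - 1)`, and the quadratic bounds on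
`savingSize` show that the groups achieve this with `k₁ * k₂` lists (`savingSize_le_mul`).

The enumeration knows sums of groups, not positions; the positions are found in the end by trying
all tuples of one group at a time. Programs are verified on an abstract machine over the integers
with a calculus of total correctness that counts steps (`WP`), and `Eval.simulates` transfers the
result to words. -/

namespace KSum

/-! ### An abstract machine on integers

Registers and memory cells hold integers. Side conditions on tests and on addresses make sure that
the word RAM simulates the abstract machine. -/

/-- The data of the abstract machine. -/
structure AState where
  R : ℕ → ℤ
  M : ℤ → ℤ

namespace AState

/-- Change a register. -/
def set (s : AState) (r : ℕ) (z : ℤ) : AState := ⟨Function.update s.R r z, s.M⟩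

/-- Change a memory cell. -/
def put (s : AState) (a z : ℤ) : AState := ⟨s.R, Function.update s.M a z⟩

@[simp] theorem set_M (s : AState) (r : ℕ) (z : ℤ) : (s.set r z).M = s.M := rfl

@[simp] theorem put_R (s : AState) (a z : ℤ) : (s.put a z).R = s.R := rfl

@[simp] theorem set_R (s : AState) (r r' : ℕ) (z : ℤ) :
    (s.set r z).R r' = if r' = r then z else s.R r' := Function.update_apply ..

@[simp] theorem put_M (s : AState) (a a' : ℤ) (z : ℤ) :
    (s.put a z).M a' = if a' = a then z else s.M a' := Function.update_apply ..

end AState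

variable {I N : ℤ}

/-- The side condition of an instruction of the abstract machine. -/
def Instr.Ok (I N : ℤ) : Instr → AState → Prop
  | .const _ _, _ => True
  | .move _ _, _ => True
  | .bin .add _ _ _, _ => True
  | .bin .sub _ _ _, _ => True
  | .bin .mul _ _ _, _ => True
  | .bin .div _ x y, s =>
    (0 ≤ s.R x ∧ s.R x ≤ 2 * I + 1 ∧ 0 < s.R y ∧ s.R y ≤ 2 * I + 1) ∨ (s.R x = -1 ∧ s.R y = 4)
  | .bin _ _ _ _, _ => False
  | .load _ x, s => 0 ≤ s.R x ∧ s.R x < N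
  | .store x _, s => 0 ≤ s.R x ∧ s.R x < N
  | .rand _, _ => False

/-- The effect of an instruction of the abstract machine. The quotient of the word `-1` by `4` is
`I`. -/
def Instr.aexec (I : ℤ) : Instr → AState → AState
  | .const r c, s => s.set r c
  | .move r x, s => s.set r (s.R x)
  | .bin .add r x y, s => s.set r (s.R x + s.R y)
  | .bin .sub r x y, s => s.set r (s.R x - s.R y)
  | .bin .mul r x y, s => s.set r (s.R x * s.R y)
  | .bin .div r x y, s => s.set r (if s.R x < 0 then I else s.R x / s.R y)
  | .bin _ _ _ _, s => s
  | .load r x, s => s.set r (s.M (s.R x))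
  | .store x y, s => s.put (s.R x) (s.R y)
  | .rand _, s => s

/-- Integers that are represented by words in two's complement. -/
def InRange (I z : ℤ) : Prop := -(2 * I + 2) ≤ z ∧ z ≤ 2 * I + 1

/-- The side condition of a test of the abstract machine. -/
def Test.Ok (I : ℤ) : Test → AState → Prop
  | .eq x y, s => InRange I (s.R x) ∧ InRange I (s.R y)
  | .slt x y, s => InRange I (s.R x) ∧ InRange I (s.R y)
  | .ult _ _, _ => False

/-- The outcome of a test of the abstract machine. -/
def Test.Holds : Test → AState → Prop
  | .eq x y, s => s.R x = s.R y
  | .slt x y, s => s.R x < s.R y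
  | .ult _ _, _ => False

/-- `Eval I N p s s' m`: the program `p` takes the abstract machine from `s` to `s'` in `m`
steps. -/
inductive Eval (I N : ℤ) : Prog → AState → AState → ℕ → Prop
  | skip (s) : Eval I N .skip s s 1
  | op (i s) : i.Ok I N s → Eval I N (.op i) s (i.aexec I s) 1
  | seq {p q s s₁ s₂ m₁ m₂} : Eval I N p s s₁ m₁ → Eval I N q s₁ s₂ m₂ →
      Eval I N (.seq p q) s s₂ (m₁ + m₂ + 1)
  | ite_true {b p q s s' m} : b.Ok I s → b.Holds s → Eval I N p s s' m →
      Eval I N (.ite b p q) s s' (m + 1)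
  | ite_false {b p q s s' m} : b.Ok I s → ¬ b.Holds s → Eval I N q s s' m →
      Eval I N (.ite b p q) s s' (m + 1)
  | loop_false {b p s} : b.Ok I s → ¬ b.Holds s → Eval I N (.loop b p) s s 1
  | loop_true {b p s s₁ s₂ m₁ m₂} : b.Ok I s → b.Holds s → Eval I N p s s₁ m₁ →
      Eval I N (.loop b p) s₁ s₂ m₂ → Eval I N (.loop b p) s s₂ (m₁ + m₂ + 1)

/-! ### The word RAM simulates the abstract machine -/

/-- The words that represent the data of the abstract machine. -/
structure Represents {w : ℕ} (σ : State w) (s : AState) : Prop where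
  reg : ∀ r, σ.reg r = BitVec.ofInt w (s.R r)
  mem : ∀ a : BitVec w, σ.mem a = BitVec.ofInt w (s.M a.toNat)

theorem ofInt_sub (w : ℕ) (x y : ℤ) :
    BitVec.ofInt w (x - y) = BitVec.ofInt w x - BitVec.ofInt w y := by
  rw [sub_eq_add_neg, BitVec.ofInt_add, BitVec.ofInt_neg, BitVec.sub_eq_add_neg]

theorem toInt_ofInt_of_inRange {w : ℕ} (hw : 4 * (I + 1) = 2 ^ w) {z : ℤ} (hz : InRange I z) :
    (BitVec.ofInt w z).toInt = z := by
  rw [BitVec.toInt_ofInt]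
  obtain ⟨h1, h2⟩ := hz
  apply Int.bmod_eq_of_le <;> push_cast <;> rw [← hw] <;> omega

theorem toNat_ofInt_of_lt {w : ℕ} {z : ℤ} (h0 : 0 ≤ z) (h1 : z < 2 ^ w) :
    ((BitVec.ofInt w z).toNat : ℤ) = z := by
  rw [BitVec.toNat_ofInt, Int.toNat_of_nonneg (Int.emod_nonneg _ (by positivity)),
    Int.emod_eq_of_lt h0 (by exact_mod_cast h1)]

theorem Represents.set {w : ℕ} {σ : State w} {s : AState} (h : Represents σ s) (r : ℕ) {z : ℤ}
    {x : BitVec w} (hx : x = BitVec.ofInt w z) (d c : ℕ) :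
    Represents ⟨Function.update σ.reg r x, σ.mem, d, c⟩ (s.set r z) := by
  refine ⟨fun r' => ?_, h.mem⟩
  by_cases hr : r' = r
  · subst hr; simp [hx]
  · simp [hr, h.reg]

/-- Addition, subtraction and multiplication commute with reduction modulo `2 ^ w` for all integers.
Only comparisons, divisions and addresses depend on the representative, and only these carry a side
condition. -/
theorem Test.eval_iff {w : ℕ} (hw : 4 * (I + 1) = 2 ^ w) {σ : State w} {s : AState}
    (h : Represents σ s) (b : Test) (hb : b.Ok I s) : b.eval σ = true ↔ b.Holds s := by
  cases b with
  | eq x y =>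
    simp only [Test.eval, Test.Holds, h.reg, beq_iff_eq]
    constructor
    · intro e
      rw [← toInt_ofInt_of_inRange hw hb.1, ← toInt_ofInt_of_inRange hw hb.2, e]
    · intro e; rw [e]
  | slt x y =>
    simp only [Test.eval, Test.Holds, h.reg, BitVec.slt_eq_decide, decide_eq_true_eq,
      toInt_ofInt_of_inRange hw hb.1, toInt_ofInt_of_inRange hw hb.2]
  | ult x y => exact hb.elim

/-- The second alternative lets a program compute `I` without knowing `w`: as `2 ^ w = 4 * I + 4`,
the word `-1` is the unsigned number `4 * I + 3`, whose quotient by `4` is `I`. -/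
theorem ofInt_div {w : ℕ} (hw : 4 * (I + 1) = 2 ^ w) {x y : ℤ}
    (h : (0 ≤ x ∧ x ≤ 2 * I + 1 ∧ 0 < y ∧ y ≤ 2 * I + 1) ∨ (x = -1 ∧ y = 4)) :
    BitVec.ofInt w x / BitVec.ofInt w y = BitVec.ofInt w (if x < 0 then I else x / y) := by
  apply BitVec.eq_of_toNat_eq
  rw [BitVec.toNat_udiv]
  zify
  rcases h with ⟨h1, h2, h3, h4⟩ | ⟨rfl, rfl⟩
  · have hq : x / y ≤ x := Int.ediv_le_self _ h1
    rw [if_neg (by omega), toNat_ofInt_of_lt h1 (by omega),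
      toNat_ofInt_of_lt (by omega) (by omega),
      toNat_ofInt_of_lt (Int.ediv_nonneg h1 (by omega)) (by omega)]
  · have hI : 0 ≤ I := by
      have : (0 : ℤ) < 2 ^ w := by positivity
      omega
    have e : BitVec.ofInt w (-1) = BitVec.ofInt w (4 * I + 3) := by
      have : (4 * I + 3 : ℤ) = -1 + 2 ^ w := by omega
      rw [this, BitVec.ofInt_add]
      have : BitVec.ofInt w (2 ^ w) = 0#w := by
        apply BitVec.eq_of_toNat_eq
        simp [BitVec.toNat_ofInt]
      rw [this, BitVec.add_zero]
    -- For `I = 0` the word length is `2`, the divisor `4` becomes the zero word, and division by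
    -- zero yields `0`, which happens to be `I`.
    rcases hI.eq_or_lt with h0 | h0
    · subst h0
      have hw2 : w = 2 := by
        have : (2 : ℤ) ^ w = 2 ^ 2 := by omega
        exact Int.pow_right_injective (by norm_num) this
      subst hw2
      simp
    · rw [e, if_pos (by omega), toNat_ofInt_of_lt (by omega) (by omega),
        toNat_ofInt_of_lt (by omega) (by omega), toNat_ofInt_of_lt (by omega) (by omega)]
      omega

/-- `σ'` is chosen before `ω`: the side conditions exclude `rand`, so the random source has no
influence. -/
theorem Instr.exec_represents {w : ℕ} (hw : 4 * (I + 1) = 2 ^ w) (hN : N ≤ 2 ^ w) (i : Instr)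
    {s : AState} (hi : i.Ok I N s) {σ : State w} (h : Represents σ s) (hc : (σ.cells : ℤ) ≤ N) :
    ∃ σ', Represents σ' (i.aexec I s) ∧ (σ'.cells : ℤ) ≤ N ∧ ∀ ω, i.exec ω σ = σ' := by
  cases i with
  | const r c =>
    exact ⟨_, h.set r (BitVec.ofInt_natCast w c).symm _ _, hc, fun ω => rfl⟩
  | move r x => exact ⟨_, h.set r (h.reg x) _ _, hc, fun ω => rfl⟩
  | bin o r x y =>
    refine ⟨_, ?_, ?_, fun ω => rfl⟩
    swap
    · exact hc
    cases o <;> try exact hi.elim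
    · exact h.set r (by simp only [BinOp.eval, h.reg, BitVec.ofInt_add]) _ _
    · exact h.set r (by simp only [BinOp.eval, h.reg, ofInt_sub]) _ _
    · exact h.set r (by simp only [BinOp.eval, h.reg, BitVec.ofInt_mul]) _ _
    · exact h.set r (by simp only [BinOp.eval, h.reg, ofInt_div hw hi]) _ _
  | load r x =>
    obtain ⟨h0, h1⟩ := hi
    refine ⟨_, h.set r ?_ _ _, ?_, fun ω => rfl⟩
    · rw [h.mem, h.reg, toNat_ofInt_of_lt h0 (by omega)]
    · have := toNat_ofInt_of_lt (w := w) h0 (by omega)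
      simp only [h.reg]; push_cast; omega
  | store x y =>
    obtain ⟨h0, h1⟩ := hi
    have e := toNat_ofInt_of_lt (w := w) h0 (by omega)
    refine ⟨(Instr.store x y).exec (fun _ => 0) σ, ⟨h.reg, fun a => ?_⟩, ?_, fun ω => rfl⟩
    · simp only [Instr.exec, Instr.aexec, AState.put_M, Function.update_apply]
      by_cases ha : a = σ.reg x
      · rw [if_pos ha, if_pos (by rw [ha, h.reg, e]), h.reg]
      · rw [if_neg ha, if_neg, h.mem]
        intro h'
        apply ha
        apply BitVec.eq_of_toNat_eq
        rw [h.reg]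
        omega
    · simp only [Instr.exec, h.reg]; push_cast; omega
  | rand r => exact hi.elim

/-- The continuation `K` is arbitrary so that the induction composes: sequences and loops leave
their remainder in the list of programs still to be executed. -/
theorem Eval.simulates {w : ℕ} (hw : 4 * (I + 1) = 2 ^ w) (hN : N ≤ 2 ^ w) {p : Prog}
    {s s' : AState} {m : ℕ} (h : Eval I N p s s' m) :
    ∀ σ : State w, Represents σ s → (σ.cells : ℤ) ≤ N →
      ∃ σ', Represents σ' s' ∧ (σ'.cells : ℤ) ≤ N ∧
        ∀ ω K, (step ω)^[m] (p :: K, σ) = (K, σ') := by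
  induction h with
  | skip s => exact fun σ h hc => ⟨σ, h, hc, fun ω K => rfl⟩
  | op i s hi =>
    intro σ h hc
    obtain ⟨σ', h', hc', e⟩ := i.exec_represents hw hN hi h hc
    exact ⟨σ', h', hc', fun ω K => by simp [step, e ω]⟩
  | @seq _ _ _ _ _ m₁ m₂ _ _ ih₁ ih₂ =>
    intro σ h hc
    obtain ⟨σ₁, h₁, hc₁, e₁⟩ := ih₁ σ h hc
    obtain ⟨σ₂, h₂, hc₂, e₂⟩ := ih₂ σ₁ h₁ hc₁
    refine ⟨σ₂, h₂, hc₂, fun ω K => ?_⟩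
    rw [Function.iterate_succ_apply, add_comm m₁, Function.iterate_add_apply]
    simp only [step]
    rw [e₁, e₂]
  | ite_true hok hb _ ih =>
    intro σ h hc
    obtain ⟨σ₁, h₁, hc₁, e₁⟩ := ih σ h hc
    refine ⟨σ₁, h₁, hc₁, fun ω K => ?_⟩
    rw [Function.iterate_succ_apply]
    simp only [step]
    rw [if_pos ((Test.eval_iff hw h _ hok).2 hb), e₁]
  | ite_false hok hb _ ih =>
    intro σ h hc
    obtain ⟨σ₁, h₁, hc₁, e₁⟩ := ih σ h hc
    refine ⟨σ₁, h₁, hc₁, fun ω K => ?_⟩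
    rw [Function.iterate_succ_apply]
    simp only [step]
    rw [if_neg (fun h' => hb ((Test.eval_iff hw h _ hok).1 h')), e₁]
  | loop_false hok hb =>
    intro σ h hc
    refine ⟨σ, h, hc, fun ω K => ?_⟩
    simp only [Function.iterate_one, step]
    rw [if_neg (fun h' => hb ((Test.eval_iff hw h _ hok).1 h'))]
  | @loop_true _ _ _ _ _ m₁ m₂ hok hb _ _ ih₁ ih₂ =>
    intro σ h hc
    obtain ⟨σ₁, h₁, hc₁, e₁⟩ := ih₁ σ h hc
    obtain ⟨σ₂, h₂, hc₂, e₂⟩ := ih₂ σ₁ h₁ hc₁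
    refine ⟨σ₂, h₂, hc₂, fun ω K => ?_⟩
    rw [Function.iterate_succ_apply, add_comm m₁, Function.iterate_add_apply]
    simp only [step]
    rw [if_pos ((Test.eval_iff hw h _ hok).2 hb), e₁, e₂]

theorem cells_step_le {w : ℕ} (ω : ℕ → Fin (2 ^ w)) (c : Config w) :
    c.2.cells ≤ (step ω c).2.cells := by
  obtain ⟨K, σ⟩ := c
  rcases K with _ | ⟨p, K⟩
  · exact le_rfl
  · cases p <;> simp only [step, le_refl]
    case op i => cases i <;> simp [Instr.exec]

theorem cells_iterate_mono {w : ℕ} (ω : ℕ → Fin (2 ^ w)) (c : Config w) :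
    Monotone fun m => ((step ω)^[m] c).2.cells :=
  monotone_nat_of_le_succ fun m => by
    rw [Function.iterate_succ_apply']; exact cells_step_le ω _

theorem iterate_step_halted {w : ℕ} (ω : ℕ → Fin (2 ^ w)) (m : ℕ) (σ : State w) :
    (step ω)^[m] ([], σ) = ([], σ) := by
  induction m with
  | zero => rfl
  | succ m ih => rw [Function.iterate_succ_apply]; exact ih

theorem run_of_le {w : ℕ} {ω : ℕ → Fin (2 ^ w)} {P : Prog} {σ σ' : State w} {m m' : ℕ}
    (h : run ω P σ m = ([], σ')) (hm : m ≤ m') : run ω P σ m' = ([], σ') := by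
  obtain ⟨d, rfl⟩ := Nat.exists_eq_add_of_le' hm
  rw [run, Function.iterate_add_apply, ← run, h, iterate_step_halted]

instance (w : ℕ) : IsProbabilityMeasure (randomWords w) := by
  unfold randomWords; infer_instance

/-- A run of the abstract machine yields the bounds for the word RAM. -/
theorem Eval.run_bounds {w : ℕ} (hw : 4 * (I + 1) = 2 ^ w) (hN : N ≤ 2 ^ w) {P : Prog}
    {s s' : AState} {m : ℕ} (h : Eval I N P s s' m) {σ : State w} (hσ : Represents σ s)
    (hc : (σ.cells : ℤ) ≤ N) :
    (∀ ω m, Halted (run ω P σ m) → Represents (run ω P σ m).2 s') ∧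
    expectedTime P σ ≤ (m : ℝ≥0∞) ∧
    ∀ ω m, (spaceUsed ω P σ m : ℤ) ≤ N + P.numRegs := by
  obtain ⟨σ', h', hc', e⟩ := h.simulates hw hN σ hσ hc
  have e' : ∀ ω, run ω P σ m = ([], σ') := fun ω => e ω []
  refine ⟨fun ω m₁ hm => ?_, ?_, fun ω m₁ => ?_⟩
  · have h1 : run ω P σ m₁ = ([], (run ω P σ m₁).2) := Prod.ext hm rfl
    have h2 := run_of_le h1 (le_max_left m₁ m)
    rw [run_of_le (e' ω) (le_max_right m₁ m)] at h2
    rw [← (Prod.ext_iff.1 h2).2]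
    exact h'
  · calc expectedTime P σ ≤ ∫⁻ _, (m : ℝ≥0∞) ∂(randomWords w) := by
          refine lintegral_mono fun ω => ?_
          exact iInf₂_le_of_le m (by rw [Halted, e' ω]) le_rfl
      _ = m := by simp
  · have h1 : (run ω P σ m₁).2.cells ≤ (run ω P σ (max m₁ m)).2.cells :=
      cells_iterate_mono ω _ (le_max_left m₁ m)
    rw [run_of_le (e' ω) (le_max_right m₁ m)] at h1
    simp only at h1
    rw [spaceUsed]; push_cast; omega

/-! ### Reasoning about programs of the abstract machine -/

/-- The program `p`, started from `s`, halts, and `Q` holds of the final data and of the number of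
steps. -/
def WP (I N : ℤ) (p : Prog) (s : AState) (Q : AState → ℕ → Prop) : Prop :=
  ∃ s' m, Eval I N p s s' m ∧ Q s' m

theorem WP.mono {p : Prog} {s : AState} {Q Q' : AState → ℕ → Prop} (h : WP I N p s Q)
    (hQ : ∀ s' m, Q s' m → Q' s' m) : WP I N p s Q' := by
  obtain ⟨s', m, h1, h2⟩ := h
  exact ⟨s', m, h1, hQ _ _ h2⟩

theorem WP.skip {s : AState} {Q : AState → ℕ → Prop} (h : Q s 1) : WP I N .skip s Q :=
  ⟨_, _, .skip s, h⟩

theorem WP.seq {p q : Prog} {s : AState} {Q : AState → ℕ → Prop}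
    (h : WP I N p s fun s₁ m₁ => WP I N q s₁ fun s₂ m₂ => Q s₂ (m₁ + m₂ + 1)) :
    WP I N (.seq p q) s Q := by
  obtain ⟨s₁, m₁, h1, s₂, m₂, h2, h3⟩ := h
  exact ⟨_, _, .seq h1 h2, h3⟩

theorem WP.ite {b : Test} {p q : Prog} {s : AState} {Q : AState → ℕ → Prop} (hok : b.Ok I s)
    (ht : b.Holds s → WP I N p s fun s' m => Q s' (m + 1))
    (hf : ¬ b.Holds s → WP I N q s fun s' m => Q s' (m + 1)) : WP I N (.ite b p q) s Q := by
  by_cases hb : b.Holds s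
  · obtain ⟨s', m, h1, h2⟩ := ht hb
    exact ⟨_, _, .ite_true hok hb h1, h2⟩
  · obtain ⟨s', m, h1, h2⟩ := hf hb
    exact ⟨_, _, .ite_false hok hb h1, h2⟩

/-- The rule for loops. The invariant speaks about a decreasing measure, the data, and the number
of steps taken so far. -/
theorem WP.loop {b : Test} {p : Prog} {Q : AState → ℕ → Prop} (J : ℕ → AState → ℕ → Prop)
    (h : ∀ j s m, J j s m → b.Ok I s ∧
      (b.Holds s → WP I N p s fun s' m' => ∃ j' < j, J j' s' (m + m' + 1)) ∧
      (¬ b.Holds s → Q s (m + 1)))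
    {j : ℕ} {s : AState} (h0 : J j s 0) : WP I N (.loop b p) s Q := by
  suffices H : ∀ j s m, J j s m → WP I N (.loop b p) s fun s' m' => Q s' (m + m') by
    simpa using H j s 0 h0
  intro j
  induction j using Nat.strong_induction_on with
  | _ j ih =>
    intro s m hJ
    obtain ⟨hok, ht, hf⟩ := h j s m hJ
    by_cases hb : b.Holds s
    · obtain ⟨s₁, m₁, h1, j', hj', h2⟩ := ht hb
      obtain ⟨s₂, m₂, h3, h4⟩ := ih j' hj' s₁ _ h2
      exact ⟨_, _, .loop_true hok hb h1 h3, by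
        simpa only [show m + (m₁ + m₂ + 1) = m + m₁ + 1 + m₂ by ring] using h4⟩
    · exact ⟨_, _, .loop_false hok hb, hf hb⟩

/-- A sequence of instructions. -/
def block : List Instr → Prog
  | [] => .skip
  | i :: l => .seq (.op i) (block l)

/-- The side conditions of a sequence of instructions. -/
def blockOk (I N : ℤ) : List Instr → AState → Prop
  | [], _ => True
  | i :: l, s => i.Ok I N s ∧ blockOk I N l (i.aexec I s)

/-- The effect of a sequence of instructions. -/
def blockExec (I : ℤ) : List Instr → AState → AState
  | [], s => s
  | i :: l, s => blockExec I l (i.aexec I s)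

theorem WP.block {l : List Instr} {s : AState} {Q : AState → ℕ → Prop} (hok : blockOk I N l s)
    (h : Q (blockExec I l s) (2 * l.length + 1)) : WP I N (block l) s Q := by
  -- Each instruction takes two steps, one to unfold `seq` and one to execute; the final `skip`
  -- takes one more.
  suffices H : Eval I N (KSum.block l) s (blockExec I l s) (2 * l.length + 1) from ⟨_, _, H, h⟩
  clear h
  induction l generalizing s with
  | nil => exact .skip s
  | cons i l ih =>
    have := Eval.seq (Eval.op i s hok.1) (ih hok.2)
    rw [List.length_cons]
    rwa [show 2 * (l.length + 1) + 1 = 1 + (2 * l.length + 1) + 1 by ring]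

/-- The data differ only in the registers from `lo` up to `hi` and in the memory cells from `a` up
to `b`. -/
structure Frame (lo hi : ℕ) (a b : ℤ) (s s' : AState) : Prop where
  reg : ∀ r, r < lo ∨ hi ≤ r → s'.R r = s.R r
  mem : ∀ x, x < a ∨ b ≤ x → s'.M x = s.M x

theorem Frame.refl {lo hi : ℕ} {a b : ℤ} (s : AState) : Frame lo hi a b s s :=
  ⟨fun _ _ => rfl, fun _ _ => rfl⟩

theorem Frame.trans {lo hi : ℕ} {a b : ℤ} {s s' s'' : AState} (h : Frame lo hi a b s s')
    (h' : Frame lo hi a b s' s'') : Frame lo hi a b s s'' :=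
  ⟨fun r hr => (h'.reg r hr).trans (h.reg r hr), fun x hx => (h'.mem x hx).trans (h.mem x hx)⟩

theorem Frame.mono {lo hi lo' hi' : ℕ} {a b a' b' : ℤ} {s s' : AState} (h : Frame lo hi a b s s')
    (h1 : lo' ≤ lo) (h2 : hi ≤ hi') (h3 : a' ≤ a) (h4 : b ≤ b') : Frame lo' hi' a' b' s s' :=
  ⟨fun r hr => h.reg r (by omega), fun x hx => h.mem x (by omega)⟩

/-- The instruction changes registers from `lo` up to `hi` only, and no memory. -/
def Instr.Within (lo hi : ℕ) : Instr → Prop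
  | .const r _ | .move r _ | .bin _ r _ _ | .load r _ | .rand r => lo ≤ r ∧ r < hi
  | .store _ _ => False

theorem blockExec_frame {l : List Instr} {lo hi : ℕ} (h : ∀ i ∈ l, i.Within lo hi) (a b : ℤ)
    (s : AState) : Frame lo hi a b s (blockExec I l s) := by
  induction l generalizing s with
  | nil => exact .refl s
  | cons i l ih =>
    refine Frame.trans ?_ (ih (fun i hi => h i (List.mem_cons_of_mem _ hi)) (i.aexec I s))
    have hw := h i List.mem_cons_self
    have key : ∀ r z, lo ≤ r ∧ r < hi → Frame lo hi a b s (s.set r z) := fun r z hr =>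
      ⟨fun r' hr' => by rw [AState.set_R, if_neg (by omega)], fun _ _ => rfl⟩
    cases i with
    | bin o r x y => cases o <;> first | exact key _ _ hw | exact .refl s
    | store => exact hw.elim
    | rand => exact .refl s
    | _ => exact key _ _ hw

theorem Frame.put {lo hi : ℕ} {a b x z : ℤ} (s : AState) (h : a ≤ x ∧ x < b) :
    Frame lo hi a b s (s.put x z) :=
  ⟨fun _ _ => rfl, fun y hy => by rw [AState.put_M, if_neg (by omega)]⟩

theorem Frame.set {lo hi r : ℕ} {a b z : ℤ} (s : AState) (h : lo ≤ r ∧ r < hi) :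
    Frame lo hi a b s (s.set r z) :=
  ⟨fun r' hr' => by rw [AState.set_R, if_neg (by omega)], fun _ _ => rfl⟩

/-- The rule for sequences of instructions without stores. -/
theorem WP.block_frame {l : List Instr} {s : AState} {Q : AState → ℕ → Prop} (lo hi : ℕ)
    (hok : blockOk I N l s) (hl : ∀ i ∈ l, i.Within lo hi)
    (h : ∀ s', blockExec I l s = s' → s'.M = s.M → (∀ a b, Frame lo hi a b s s') →
      Q s' (2 * l.length + 1)) : WP I N (KSum.block l) s Q :=
  WP.block hok (h _ rfl (funext fun x => (blockExec_frame hl (x + 1) x s).mem x (by omega))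
    (fun a b => blockExec_frame hl a b s))

end KSum

/-! ### Counting loops and binary search. -/

namespace KSum

variable {I N : ℤ}

/-- The constants that the programs keep in registers. -/
structure Consts (I : ℤ) (n : ℕ) (s : AState) : Prop where
  r0 : s.R 0 = n
  r2 : s.R 2 = 0
  r3 : s.R 3 = 1
  r4 : s.R 4 = 2
  r5 : s.R 5 = I
  r6 : s.R 6 = -I

theorem Consts.frame {n : ℕ} {s s' : AState} (h : Consts I n s) {lo hi : ℕ} {a b : ℤ}
    (hf : Frame lo hi a b s s') (hlo : 7 ≤ lo) : Consts I n s' := by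
  constructor <;> rw [hf.reg _ (by omega)]
  exacts [h.r0, h.r2, h.r3, h.r4, h.r5, h.r6]

/-- The loop in which register `r` runs from `0` up to the content of register `0`. -/
def forLoop (r : ℕ) (p : Prog) : Prog :=
  .seq (block [.const r 0]) (.loop (.slt r 0) (.seq p (block [.bin .add r r 3])))

/-- An iteration adds five steps to the body: the test, the unfolding of `seq`, and three for the
increment. The bound `c i` depends on the iteration because the cost of an inner enumeration varies
with the element chosen by the loop. -/
theorem WP.forLoop {n r : ℕ} {p : Prog} {s : AState} {Q : AState → ℕ → Prop} (hn : (n : ℤ) ≤ I)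
    (J : ℕ → AState → Prop) (c : ℕ → ℕ) (hr0 : r ≠ 0) (hr3 : r ≠ 3) (h0 : s.R 0 = n)
    (h3 : s.R 3 = 1) (hJ : J 0 (s.set r 0))
    (hbody : ∀ i < n, ∀ s, J i s → s.R r = i → s.R 0 = n → s.R 3 = 1 →
      WP I N p s fun s' m => m ≤ c i ∧ s'.R r = i ∧ s'.R 0 = n ∧ s'.R 3 = 1 ∧
        J (i + 1) (s'.set r (i + 1)))
    (hQ : ∀ s' m, J n s' → s'.R r = n → s'.R 0 = n → s'.R 3 = 1 →
      m ≤ ∑ i ∈ Finset.range n, (c i + 5) + 5 → Q s' m) :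
    WP I N (forLoop r p) s Q := by
  apply WP.seq
  apply WP.block (by simp [blockOk, Instr.Ok])
  simp only [blockExec, Instr.aexec]
  refine WP.loop (fun j s m => ∃ i ≤ n, j = n - i ∧ J i s ∧ s.R r = i ∧ s.R 0 = n ∧ s.R 3 = 1 ∧
    m ≤ ∑ i ∈ Finset.range i, (c i + 5)) ?_ (j := n)
    ⟨0, by omega, by omega, by simpa using hJ, by simp, by simp [hr0.symm, h0],
      by simp [hr3.symm, h3], by simp⟩
  rintro j s m ⟨i, hi, rfl, hJi, hr, h0, h3, hm⟩
  refine ⟨by simp only [Test.Ok, InRange, hr, h0]; omega, fun hb => ?_, fun hb => ?_⟩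
  · have hb : i < n := by simpa [Test.Holds, hr, h0] using hb
    apply WP.seq
    refine (hbody i hb s hJi hr h0 h3).mono ?_
    rintro s' m' ⟨hm', hr', h0', h3', hJ'⟩
    apply WP.block (by simp [blockOk, Instr.Ok])
    simp only [blockExec, Instr.aexec, hr', h3']
    refine ⟨n - (i + 1), by omega, i + 1, hb, rfl, hJ', by simp, by simp [hr0.symm, h0'],
      by simp [hr3.symm, h3'], ?_⟩
    rw [Finset.sum_range_succ]
    simp only [List.length_cons, List.length_nil]
    omega
  · have hb : ¬ i < n := by simpa [Test.Holds, hr, h0] using hb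
    obtain rfl : i = n := by omega
    refine hQ _ _ hJi hr h0 h3 ?_
    simp only [List.length_cons, List.length_nil]
    omega

/-- Binary search in the array at address `R 50` of length `R 51`: register `53` receives the
first position of an element larger than `R 52`. -/
def binarySearch : Prog :=
  .seq (block [.const 53 0, .move 54 51])
    (.loop (.slt 53 54)
      (.seq (block [.bin .add 55 53 54, .bin .div 55 55 4, .bin .add 56 50 55, .load 57 56])
        (.ite (.slt 52 57) (block [.move 54 55]) (block [.bin .add 53 55 3]))))

theorem binarySearch_spec {n len : ℕ} {base : ℤ} {b : ℕ → ℤ} {s : AState} (hc : Consts I n s)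
    (h50 : s.R 50 = base) (h51 : s.R 51 = len) (hkey : InRange I (s.R 52))
    (hlen : (len : ℤ) ≤ I) (hbase : 0 ≤ base) (hN : base + len ≤ N)
    (hM : ∀ i < len, s.M (base + i) = b i) (hb : ∀ i < len, InRange I (b i))
    (hs : ∀ i j, i ≤ j → j < len → b i ≤ b j) :
    WP I N binarySearch s fun s' m => m ≤ 15 * (Nat.log 2 len + 1) + 7 ∧ Frame 53 58 0 0 s s' ∧
      ∃ p ≤ len, s'.R 53 = p ∧ (∀ i < p, b i ≤ s.R 52) ∧ (∀ i < len, p ≤ i → s.R 52 < b i) := by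
  apply WP.seq
  apply WP.block (by simp [blockOk, Instr.Ok])
  simp only [blockExec, Instr.aexec]
  -- `j` bounds the halvings that remain, since the current range has fewer than `2 ^ j` cells; each
  -- halving takes at most 15 steps.
  refine WP.loop (fun j s' m => Frame 53 58 0 0 s s' ∧ m + 15 * j ≤ 15 * (Nat.log 2 len + 1) ∧
    ∃ lo hi : ℕ, s'.R 53 = lo ∧ s'.R 54 = hi ∧ lo ≤ hi ∧ hi ≤ len ∧ hi - lo < 2 ^ j ∧
    (∀ i < lo, b i ≤ s.R 52) ∧ (∀ i < len, hi ≤ i → s.R 52 < b i)) ?_ (j := Nat.log 2 len + 1)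
    ⟨⟨fun r hr => ?_, fun x _ => rfl⟩, by omega, 0, len, by simp, by simp [h51], by omega, by omega,
      Nat.lt_pow_succ_log_self (by norm_num) _, by simp, by omega⟩
  swap
  · simp only [AState.set_R]; rw [if_neg (by omega), if_neg (by omega)]
  rintro j s' m ⟨hf, hm, lo, hi, hlo, hhi, hle, hhl, hj, hp1, hp2⟩
  have hc' := hc.frame hf (by norm_num)
  refine ⟨by simp only [Test.Ok, InRange, hlo, hhi]; omega, fun ht => ?_, fun ht => ?_⟩
  · have ht : lo < hi := by simpa [Test.Holds, hlo, hhi] using ht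
    obtain ⟨j, rfl⟩ : ∃ j', j = j' + 1 := by
      cases j with
      | zero => simp at hj; omega
      | succ j => exact ⟨j, rfl⟩
    obtain ⟨mid, hmid⟩ : ∃ mid : ℕ, mid = (lo + hi) / 2 := ⟨_, rfl⟩
    have hmid' : ((lo : ℤ) + hi) / 2 = mid := by omega
    have e50 : s'.R 50 = base := by rw [hf.reg _ (by omega), h50]
    have e52 : s'.R 52 = s.R 52 := hf.reg _ (by omega)
    have eM : s'.M (base + mid) = b mid := by rw [hf.mem _ (by omega), hM _ (by omega)]
    have hnn : ¬ (lo : ℤ) + hi < 0 := by omega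
    rw [pow_succ] at hj
    apply WP.seq
    apply WP.block_frame 53 58
    · simp [blockOk, Instr.Ok, Instr.aexec, hlo, hhi, hc'.r4, hnn, hmid', e50]
      omega
    · simp [Instr.Within]
    intro s₁ hs₁ hsM hsf
    have e57 : s₁.R 57 = b mid := by
      simp [← hs₁, blockExec, Instr.aexec, hlo, hhi, hc'.r4, hnn, hmid', e50, eM]
    have e55 : s₁.R 55 = mid := by
      simp [← hs₁, blockExec, Instr.aexec, hlo, hhi, hc'.r4, hnn, hmid']
    have e53 : s₁.R 53 = lo := by simp [← hs₁, blockExec, Instr.aexec, hlo]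
    have e54 : s₁.R 54 = hi := by simp [← hs₁, blockExec, Instr.aexec, hhi]
    have e52' : s₁.R 52 = s.R 52 := by rw [(hsf 0 0).reg _ (by omega), e52]
    have e3 : s₁.R 3 = 1 := by rw [(hsf 0 0).reg _ (by omega), hc'.r3]
    apply WP.ite
    · simpa [Test.Ok, e52', hkey, e57] using hb mid (by omega)
    · intro h
      simp only [Test.Holds, e52', e57] at h
      apply WP.block_frame 53 58 (by simp [blockOk, Instr.Ok]) (by simp [Instr.Within])
      intro s₂ hs₂ _ hsf₂
      refine ⟨j, by omega, hf.trans ((hsf 0 0).trans (hsf₂ 0 0)), ?_, lo, mid, ?_, ?_, by omega,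
        by omega, by omega, hp1, fun i hi1 hi2 => h.trans_le (hs _ _ hi2 hi1)⟩
      · simp; omega
      · simp [← hs₂, blockExec, Instr.aexec, e53]
      · simp [← hs₂, blockExec, Instr.aexec, e55]
    · intro h
      simp only [Test.Holds, e52', e57, not_lt] at h
      apply WP.block_frame 53 58 (by simp [blockOk, Instr.Ok]) (by simp [Instr.Within])
      intro s₂ hs₂ _ hsf₂
      refine ⟨j, by omega, hf.trans ((hsf 0 0).trans (hsf₂ 0 0)), ?_, mid + 1, hi, ?_, ?_,
        by omega, by omega, by omega, fun i hi => (hs i mid (by omega) (by omega)).trans h, hp2⟩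
      · simp; omega
      · simp [← hs₂, blockExec, Instr.aexec, e3, e55]
      · simp [← hs₂, blockExec, Instr.aexec, e54]
  · have ht : ¬ lo < hi := by simpa [Test.Holds, hlo, hhi] using ht
    refine ⟨?_, hf, lo, by omega, hlo, hp1, fun i h1 h2 => hp2 i h1 (by omega)⟩
    simp; omega

end KSum

namespace KSum

variable {I N : ℤ}

/-! ### Enumeration of the sums of two lists in increasing order

The rows `a i + b 0 ≤ a i + b 1 ≤ …` are merged by means of a tournament tree. -/

/-- The parameters of a merge: a list `a` of length `n` at address `ab`, a sorted list `b` of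
length `m` at address `bb`, and work space for `3 * n` words at address `tb`. -/
structure MergeParams (I N : ℤ) (n m : ℕ) (ab bb tb : ℤ) (a b : ℕ → ℤ) : Prop where
  n_pos : 1 ≤ n
  m_pos : 1 ≤ m
  n_le : (n : ℤ) ≤ I
  m_le : (m : ℤ) ≤ I
  ab_nonneg : 0 ≤ ab
  ab_le : ab + n ≤ tb
  bb_nonneg : 0 ≤ bb
  bb_le : bb + m ≤ tb
  tb_le : tb + 3 * n ≤ N
  bound : ∀ i < n, ∀ j < m, -I < a i + b j ∧ a i + b j < I
  sorted : ∀ i j, i ≤ j → j < m → b i ≤ b j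

/-- The parameters of a merge are in their registers, and the lists are in memory. -/
structure MergeRegs (I : ℤ) (n m : ℕ) (ab bb tb : ℤ) (a b : ℕ → ℤ) (s : AState) : Prop where
  consts : Consts I n s
  r43 : s.R 43 = m
  r44 : s.R 44 = tb
  r45 : s.R 45 = tb + 2 * n
  r46 : s.R 46 = ab
  r47 : s.R 47 = bb
  a_mem : ∀ i < n, s.M (ab + i) = a i
  b_mem : ∀ j < m, s.M (bb + j) = b j

variable {n m : ℕ} {ab bb tb : ℤ} {a b : ℕ → ℤ}

theorem MergeRegs.frame (hp : MergeParams I N n m ab bb tb a b) {s s' : AState}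
    (h : MergeRegs I n m ab bb tb a b s) {lo hi : ℕ} {y : ℤ} (hf : Frame lo hi tb y s s')
    (hlo : 48 ≤ lo ∨ 7 ≤ lo ∧ hi ≤ 43) : MergeRegs I n m ab bb tb a b s' := by
  have h1 := hp.ab_le
  have h2 := hp.bb_le
  constructor
  case consts => exact h.consts.frame hf (by omega)
  case a_mem => intro i hi; rw [hf.mem _ (by omega), h.a_mem i hi]
  case b_mem => intro j hj; rw [hf.mem _ (by omega), h.b_mem j hj]
  all_goals rw [hf.reg _ (by omega)]
  exacts [h.r43, h.r44, h.r45, h.r46, h.r47]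

/-- Recompute the node `R 48` of the tree at address `R 44`. -/
def recomputeNode : Prog :=
  .seq (block [.bin .add 49 48 48, .bin .add 49 44 49, .load 50 49, .bin .add 49 49 3,
      .load 51 49, .bin .add 52 44 48])
    (.ite (.slt 51 50) (block [.store 52 51]) (block [.store 52 50]))

theorem recomputeNode_spec {s : AState} {i : ℕ} (h3 : s.R 3 = 1) (h44 : s.R 44 = tb)
    (h48 : s.R 48 = i) (htb : 0 ≤ tb) (hN : tb + 2 * i + 1 < N)
    (h1 : InRange I (s.M (tb + 2 * i))) (h2 : InRange I (s.M (tb + 2 * i + 1))) :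
    WP I N recomputeNode s fun s' m => m ≤ 18 ∧ Frame 49 53 (tb + i) (tb + i + 1) s s' ∧
      s'.M (tb + i) = min (s.M (tb + 2 * i)) (s.M (tb + 2 * i + 1)) := by
  have e1 : tb + ((i : ℤ) + i) = tb + 2 * i := by ring
  apply WP.seq
  apply WP.block_frame 49 53
  · simp [blockOk, Instr.Ok, Instr.aexec, h3, h44, h48]; omega
  · simp [Instr.Within]
  intro s₁ hs₁ hsM hsf
  have e50 : s₁.R 50 = s.M (tb + 2 * i) := by
    simp [← hs₁, blockExec, Instr.aexec, h44, h48, e1]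
  have e51 : s₁.R 51 = s.M (tb + 2 * i + 1) := by
    simp [← hs₁, blockExec, Instr.aexec, h44, h48, h3, e1]
  have e52 : s₁.R 52 = tb + i := by simp [← hs₁, blockExec, Instr.aexec, h44, h48]
  apply WP.ite (by simp [Test.Ok, e50, e51, h1, h2])
  · intro h
    simp only [Test.Holds, e50, e51] at h
    apply WP.block (by simp [blockOk, Instr.Ok, e52]; omega)
    refine ⟨by simp, (hsf _ _).trans (Frame.put _ (by omega)), ?_⟩
    simp [blockExec, Instr.aexec, e52, e51, min_eq_right h.le]
  · intro h
    simp only [Test.Holds, e50, e51, not_lt] at h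
    apply WP.block (by simp [blockOk, Instr.Ok, e52]; omega)
    refine ⟨by simp, (hsf _ _).trans (Frame.put _ (by omega)), ?_⟩
    simp [blockExec, Instr.aexec, e52, e50, min_eq_left h]

/-- The value at a node of the tree is the minimum of those at its children. -/
def NodeOk (M : ℤ → ℤ) (tb : ℤ) (x : ℕ) : Prop :=
  M (tb + x) = min (M (tb + 2 * x)) (M (tb + 2 * x + 1))

/-- Passing to the parent `x / 2` never increases the value. With inner nodes `1, …, n - 1` and
leaves `n, …, 2 * n - 1` this works for every `n`, not only for powers of two. -/
theorem root_le {M : ℤ → ℤ} (h : ∀ x, 1 ≤ x → x < n → NodeOk M tb x) (x : ℕ) (h1 : 1 ≤ x)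
    (h2 : x < 2 * n) : M (tb + 1) ≤ M (tb + x) := by
  induction x using Nat.strong_induction_on with
  | _ x ih =>
    rcases h1.eq_or_lt with rfl | h1
    · simp
    · refine (ih (x / 2) (by omega) (by omega) (by omega)).trans ?_
      have := h (x / 2) (by omega) (by omega)
      rw [NodeOk] at this
      rw [this]
      rcases Nat.even_or_odd' x with ⟨c, rfl | rfl⟩
      · rw [show 2 * c / 2 = c by omega]
        push_cast
        exact min_le_left _ _
      · rw [show (2 * c + 1) / 2 = c by omega]
        push_cast
        rw [← add_assoc]
        exact min_le_right _ _

/-- The value at the leaf of row `i`, whose first `p` elements have been used. -/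
def rowKey (I : ℤ) (m : ℕ) (a b : ℕ → ℤ) (i p : ℕ) : ℤ := if p < m then a i + b p else I

theorem rowKey_inRange (hp : MergeParams I N n m ab bb tb a b) {i : ℕ} (hi : i < n) (p : ℕ) :
    -I < rowKey I m a b i p ∧ rowKey I m a b i p ≤ I := by
  rw [rowKey]
  split_ifs with h
  · have := hp.bound i hi p h; omega
  · have := hp.n_le; have := hp.n_pos; omega

/-- The positions in the rows and the leaves of the tree are in memory, and the nodes in `S` are up
to date. -/
structure MergeTree (I : ℤ) (n m : ℕ) (tb : ℤ) (a b : ℕ → ℤ) (q : ℕ → ℕ) (S : ℕ → Prop)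
    (M : ℤ → ℤ) : Prop where
  pos_le : ∀ i < n, q i ≤ m
  pos_mem : ∀ i < n, M (tb + 2 * n + i) = q i
  leaf_mem : ∀ i < n, M (tb + n + i) = rowKey I m a b i (q i)
  node : ∀ x, 1 ≤ x → x < n → S x → NodeOk M tb x ∧ InRange I (M (tb + x))

variable {q : ℕ → ℕ} {S S' : ℕ → Prop} {M M' : ℤ → ℤ}

theorem MergeTree.inRange (hp : MergeParams I N n m ab bb tb a b)
    (h : MergeTree I n m tb a b q S M) {x : ℕ} (h1 : 1 ≤ x) (h2 : x < 2 * n) (hS : x < n → S x) :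
    InRange I (M (tb + x)) := by
  by_cases hx : x < n
  · exact (h.node x h1 hx (hS hx)).2
  · have h3 := h.leaf_mem (x - n) (by omega)
    rw [show tb + n + ((x - n : ℕ) : ℤ) = tb + x by omega] at h3
    have := rowKey_inRange hp (i := x - n) (by omega) (q (x - n))
    rw [h3, InRange]
    omega

/-- A change at node `i` can only invalidate its parent `i / 2`, so `S'` may contain `i` and
everything in `S` but the parent. The children of `i` have to be up to date for the new minimum to
be in range. -/
theorem MergeTree.update (hp : MergeParams I N n m ab bb tb a b)
    (h : MergeTree I n m tb a b q S M) {i : ℕ} (h1 : 1 ≤ i) (h2 : i < n)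
    (hc : ∀ c, i < c → c < n → c / 2 = i → S c)
    (hM : ∀ x, x < tb + i ∨ tb + i + 1 ≤ x → M' x = M x)
    (hi : M' (tb + i) = min (M (tb + 2 * i)) (M (tb + 2 * i + 1)))
    (hS : ∀ x, S' x → x = i ∨ S x ∧ x ≠ i / 2) : MergeTree I n m tb a b q S' M' := by
  refine ⟨h.pos_le, fun j hj => ?_, fun j hj => ?_, fun x hx1 hx2 hx3 => ?_⟩
  · rw [hM _ (by omega), h.pos_mem j hj]
  · rw [hM _ (by omega), h.leaf_mem j hj]
  · rcases hS x hx3 with rfl | ⟨hx, hxi⟩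
    · refine ⟨?_, ?_⟩
      · rw [NodeOk, hi, hM _ (by omega), hM _ (by omega)]
      · have e1 := h.inRange hp (x := 2 * x) (by omega) (by omega) (fun h => hc _ (by omega) h
          (by omega))
        have e2 := h.inRange hp (x := 2 * x + 1) (by omega) (by omega) (fun h => hc _ (by omega) h
          (by omega))
        push_cast at e1 e2
        rw [← add_assoc] at e2
        rw [hi]
        rcases min_choice (M (tb + 2 * x)) (M (tb + 2 * x + 1)) with e | e <;> rw [e] <;>
          assumption
    · obtain ⟨e1, e2⟩ := h.node x hx1 hx2 hx
      by_cases hxe : x = i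
      · subst hxe
        refine ⟨?_, ?_⟩
        · rw [NodeOk, hi, hM _ (by omega), hM _ (by omega)]
        · rw [hi, ← e1]; exact e2
      · rw [NodeOk, hM _ (by omega), hM _ (by omega), hM _ (by omega)]
        exact ⟨e1, e2⟩

/-- Initialize the tree for the merge of the lists at addresses `R 46` and `R 47`. -/
def mergeInit : Prog :=
  .seq (forLoop 48 (.seq (block [.bin .add 49 45 48, .store 49 2])
      (.seq (block [.bin .add 49 46 48, .load 50 49, .load 51 47, .bin .add 50 50 51,
        .bin .add 49 44 0, .bin .add 49 49 48]) (block [.store 49 50]))))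
    (.seq (block [.bin .sub 48 0 3])
      (.seq (.loop (.slt 2 48) (.seq recomputeNode (block [.bin .sub 48 48 3])))
        (block [.move 40 6, .const 41 0])))

/-- The enumerated sums are those up to `R 40`, and `Φ` is a bound on the number of steps left. -/
def MergeInv (I : ℤ) (n m : ℕ) (ab bb tb : ℤ) (a b : ℕ → ℤ) (s : AState) (Φ : ℕ) : Prop :=
  MergeRegs I n m ab bb tb a b s ∧ ∃ q, MergeTree I n m tb a b q (fun _ => True) s.M ∧
    (∀ i < n, ∀ j < q i, a i + b j ≤ s.R 40) ∧ Φ = ∑ i ∈ Finset.range n, (m - q i)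

theorem mergeInit_spec (hp : MergeParams I N n m ab bb tb a b) {s : AState}
    (h : MergeRegs I n m ab bb tb a b s) :
    WP I N mergeInit s fun s' t => t ≤ 100 * n + 100 ∧ Frame 40 53 tb (tb + 3 * n) s s' ∧
      MergeInv I n m ab bb tb a b s' (n * m) ∧ s'.R 40 = -I ∧ s'.R 41 = 0 := by
  have hn1 := hp.n_pos
  have hn2 := hp.n_le
  have hm1 := hp.m_pos
  have h1 := hp.ab_nonneg
  have h2 := hp.ab_le
  have h3 := hp.bb_nonneg
  have h4 := hp.bb_le
  have h5 := hp.tb_le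
  apply WP.seq
  refine WP.forLoop hn2 (fun i s' => Frame 48 53 tb (tb + 3 * n) s s' ∧
    ∀ r < i, s'.M (tb + 2 * n + r) = 0 ∧ s'.M (tb + n + r) = a r + b 0) (fun _ => 23)
    (by norm_num) (by norm_num) h.consts.r0 h.consts.r3 ⟨.set _ (by norm_num), by simp⟩ ?_ ?_
  · rintro i hi s' ⟨hf, hr⟩ h48 h0 h3
    have hm := h.frame hp hf (by norm_num)
    apply WP.seq
    apply WP.block (by simp [blockOk, Instr.Ok, Instr.aexec, hm.r45, h48]; omega)
    simp only [blockExec, Instr.aexec]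
    generalize hs₁ : (s'.set 49 (s'.R 45 + s'.R 48)).put _ _ = s₁
    have hf₁ : Frame 48 53 tb (tb + 3 * n) s' s₁ := by
      rw [← hs₁]
      refine (Frame.set _ (by norm_num)).trans (Frame.put _ ?_)
      simp [hm.r45, h48]; omega
    have hm₁ := hm.frame hp hf₁ (by norm_num)
    have e48 : s₁.R 48 = i := by simp [← hs₁, h48]
    have eM : ∀ x, s₁.M x = if x = tb + 2 * n + i then 0 else s'.M x := by
      intro x; simp [← hs₁, hm.r45, h48, hm.consts.r2]
    apply WP.seq
    have ea := hm₁.a_mem i hi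
    have eb := hm₁.b_mem 0 (by omega)
    simp only [Nat.cast_zero, add_zero] at eb
    apply WP.block_frame 48 53
    · simp [blockOk, Instr.Ok, Instr.aexec, hm₁.r46, hm₁.r47, e48]; omega
    · simp [Instr.Within]
    intro s₂ hs₂ hsM hsf
    have e49 : s₂.R 49 = tb + n + i := by
      simp [← hs₂, blockExec, Instr.aexec, hm₁.r44, hm₁.consts.r0, e48]
    have e50 : s₂.R 50 = a i + b 0 := by
      simp [← hs₂, blockExec, Instr.aexec, hm₁.r46, hm₁.r47, e48, ea, eb]
    apply WP.block (by simp [blockOk, Instr.Ok, e49]; omega)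
    simp only [blockExec, Instr.aexec]
    have hf₂ : Frame 48 53 tb (tb + 3 * n) s' (s₂.put (s₂.R 49) (s₂.R 50)) :=
      (hf₁.trans (hsf _ _)).trans (Frame.put _ (by rw [e49]; omega))
    refine ⟨by simp, ?_, by rw [hf₂.reg _ (by omega), h0], by rw [hf₂.reg _ (by omega), h3],
      (hf.trans hf₂).trans (.set _ (by norm_num)), ?_⟩
    · rw [AState.put_R, ← hs₂]; simp [blockExec, Instr.aexec, e48]
    · intro r hr'
      simp only [AState.set_M, AState.put_M, e49, e50, hsM, eM]
      rw [if_neg (by omega : tb + 2 * (n : ℤ) + r ≠ tb + n + i)]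
      rcases Nat.lt_succ_iff_lt_or_eq.1 hr' with hlt | rfl
      · rw [if_neg (by omega), if_neg (by omega), if_neg (by omega)]
        exact hr r hlt
      · simp
  intro s₁ t₁ hJ h48 h0 h3 ht₁
  obtain ⟨hf₁, hr₁⟩ := hJ
  have hm₁ := h.frame hp hf₁ (by norm_num)
  apply WP.seq
  apply WP.block_frame 48 53 (by simp [blockOk, Instr.Ok]) (by simp [Instr.Within])
  intro s₂ hs₂ hsM₂ hsf₂
  have e48 : s₂.R 48 = n - 1 := by simp [← hs₂, blockExec, Instr.aexec, h0, h3]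
  apply WP.seq
  -- The nodes are computed from `n - 1` down to `1`, children before parents; the nodes above the
  -- current index are correct, and at the start there are no such inner nodes.
  refine WP.loop (fun j s' t => ∃ i : ℕ, j = i ∧ i < n ∧ s'.R 48 = i ∧
    Frame 48 53 tb (tb + 3 * n) s s' ∧ MergeTree I n m tb a b (fun _ => 0) (fun x => i < x) s'.M ∧
    t + 23 * j ≤ 23 * n) ?_ (j := n - 1) ⟨n - 1, rfl, by omega, by omega, hf₁.trans (hsf₂ _ _), ?_,
      by omega⟩
  swap
  · refine ⟨fun i _ => Nat.zero_le _, fun i hi => ?_, fun i hi => ?_, fun x _ hx hx' => by omega⟩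
    · rw [hsM₂, (hr₁ i hi).1]; rfl
    · rw [hsM₂, (hr₁ i hi).2, rowKey, if_pos (by omega)]
  rintro j s' t ⟨i, rfl, hi, h48, hf, hT, ht⟩
  have hm := h.frame hp hf (by norm_num)
  refine ⟨?_, fun hb => ?_, fun hb => ?_⟩
  · simp only [Test.Ok, InRange, h48, hm.consts.r2]; omega
  · have hb : 1 ≤ j := by
      have := hb; simp only [Test.Holds, h48, hm.consts.r2] at this; omega
    apply WP.seq
    have r1 := hT.inRange hp (x := 2 * j) (by omega) (by omega) (by omega)
    have r2 := hT.inRange hp (x := 2 * j + 1) (by omega) (by omega) (by omega)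
    push_cast at r1 r2
    rw [← add_assoc] at r2
    refine (recomputeNode_spec hm.consts.r3 hm.r44 h48 (by omega) (by omega) r1 r2).mono ?_
    rintro s₃ t₃ ⟨ht₃, hf₃, hM₃⟩
    apply WP.block_frame 48 53 (by simp [blockOk, Instr.Ok]) (by simp [Instr.Within])
    intro s₄ hs₄ hsM₄ hsf₄
    have hf₃' : Frame 48 53 tb (tb + 3 * n) s' s₃ := hf₃.mono (by omega) le_rfl (by omega) (by omega)
    refine ⟨j - 1, by omega, j - 1, rfl, by omega, ?_, (hf.trans hf₃').trans (hsf₄ _ _), ?_, ?_⟩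
    · simp [← hs₄, blockExec, Instr.aexec, hf₃.reg 48 (by omega), hf₃.reg 3 (by omega), h48,
        hm.consts.r3]
      omega
    · rw [hsM₄]
      exact hT.update hp hb hi (fun c hc _ _ => hc) hf₃.mem hM₃ (fun x hx => by omega)
    · simp; omega
  · have hb : j = 0 := by
      have := hb; simp only [Test.Holds, h48, hm.consts.r2] at this; omega
    subst hb
    apply WP.block_frame 40 53 (by simp [blockOk, Instr.Ok]) (by simp [Instr.Within])
    intro s₃ hs₃ hsM₃ hsf₃
    have hf₃ : Frame 40 53 tb (tb + 3 * n) s s₃ :=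
      (hf.mono (by omega) le_rfl le_rfl le_rfl).trans (hsf₃ _ _)
    have hf₃' : Frame 40 43 tb tb s' s₃ := by
      rw [← hs₃]; exact blockExec_frame (by simp [Instr.Within]) _ _ _
    have e40 : s₃.R 40 = -I := by simp [← hs₃, blockExec, Instr.aexec, hm.consts.r6]
    refine ⟨?_, hf₃, ⟨hm.frame hp hf₃' (by norm_num), fun _ => 0, ?_, by simp, by simp⟩, e40, ?_⟩
    · simp at ht₁ ⊢; omega
    · rw [hsM₃]
      exact ⟨hT.pos_le, hT.pos_mem, hT.leaf_mem, fun x h1 h2 _ => hT.node x h1 h2 (by omega)⟩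
    · simp [← hs₃, blockExec, Instr.aexec]

end KSum

/-! ### One step of the merge. -/

namespace KSum

variable {I N : ℤ}

/-- What one step of an enumeration of `A` in increasing order achieves. The enumerated elements are
those up to `R 40`. Either register `42` holds `1` and `R 40` has become the next element of `A`,
or register `42` holds `0`; when all elements have been enumerated, register `41` is set to `1`.
The data satisfies an invariant `J`, which includes a bound on the number of steps left. -/
structure EnumStep (A : Finset ℤ) (J : AState → ℕ → Prop) (hi : ℕ) (x y : ℤ) (c : ℕ) (s : AState)
    (Φ : ℕ) (s' : AState) (t : ℕ) : Prop where
  time : t ≤ c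
  frame : Frame 40 hi x y s s'
  prog : ∃ Φ', J s' Φ' ∧
    ((s'.R 42 = 0 ∧ s'.R 40 = s.R 40 ∧ s'.R 41 = s.R 41 ∧ Φ' < Φ) ∨
     (s'.R 42 = 1 ∧ s.R 40 < s'.R 40 ∧ s'.R 40 ∈ A ∧ (∀ l ∈ A, l < s'.R 40 → l ≤ s.R 40) ∧
        s'.R 41 = s.R 41 ∧ Φ' < Φ) ∨
     (s'.R 42 = 0 ∧ s'.R 40 = s.R 40 ∧ s'.R 41 = 1 ∧ ∀ l ∈ A, l ≤ s.R 40))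

variable {n m : ℕ} {ab bb tb : ℤ} {a b : ℕ → ℤ}

/-- Go from the root of the tree to a leaf with the same value `R 52`. -/
def findLeaf : Prog :=
  .seq (block [.const 48 1])
    (.loop (.slt 48 0) (.seq (block [.bin .add 48 48 48, .bin .add 49 44 48, .load 50 49])
      (.ite (.eq 50 52) .skip (block [.bin .add 48 48 3]))))

/-- A node is the minimum of its children, so one of them has the same value. Descending along equal
values finds a row that attains the root, although the tree stores no names of rows. -/
theorem findLeaf_spec (hp : MergeParams I N n m ab bb tb a b) {q : ℕ → ℕ} {s : AState}
    (h : MergeRegs I n m ab bb tb a b s) (hT : MergeTree I n m tb a b q (fun _ => True) s.M)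
    (h52 : s.R 52 = s.M (tb + 1)) :
    WP I N findLeaf s fun s' t => t ≤ 13 * (Nat.log 2 n + 1) + 5 ∧ Frame 48 51 tb tb s s' ∧
      ∃ i < n, s'.R 48 = n + i ∧ s.M (tb + n + i) = s.M (tb + 1) := by
  have hn1 := hp.n_pos
  have hn2 := hp.n_le
  have h1 := hp.ab_nonneg
  have h2 := hp.ab_le
  have h5 := hp.tb_le
  apply WP.seq
  apply WP.block_frame 48 51 (by simp [blockOk, Instr.Ok]) (by simp [Instr.Within])
  intro s₁ hs₁ hsM₁ hsf₁
  -- `n ≤ i * 2 ^ j` bounds the rest of the descent: `i` at least doubles each time, and `n ≤ i`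
  -- means that a leaf is reached.
  refine WP.loop (fun j s' t => Frame 48 51 tb tb s s' ∧ ∃ i : ℕ, 1 ≤ i ∧ i < 2 * n ∧ s'.R 48 = i ∧
    s.M (tb + i) = s.M (tb + 1) ∧ n ≤ i * 2 ^ j ∧ t + 13 * j ≤ 13 * (Nat.log 2 n + 1)) ?_
    (j := Nat.log 2 n + 1) ⟨hsf₁ _ _, 1, le_rfl, by omega, ?_, by simp, ?_, by omega⟩
  rotate_left
  · simp [← hs₁, blockExec, Instr.aexec]
  · rw [one_mul]; exact (Nat.lt_pow_succ_log_self (by norm_num) _).le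
  rintro j s' t ⟨hf, i, hi1, hi2, h48, hi, hj, ht⟩
  have hm := h.frame hp hf (by norm_num)
  have hMM : s'.M = s.M := funext fun x => hf.mem x (by omega)
  refine ⟨by simp only [Test.Ok, InRange, h48, hm.consts.r0]; omega, fun hb => ?_, fun hb => ?_⟩
  · have hb : i < n := by simpa [Test.Holds, h48, hm.consts.r0] using hb
    obtain ⟨j, rfl⟩ : ∃ j', j = j' + 1 := by
      cases j with
      | zero => simp at hj; omega
      | succ j => exact ⟨j, rfl⟩
    have e1 : tb + ((i : ℤ) + i) = tb + 2 * i := by ring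
    apply WP.seq
    apply WP.block_frame 48 51
    · simp [blockOk, Instr.Ok, Instr.aexec, hm.r44, h48]; omega
    · simp [Instr.Within]
    intro s₂ hs₂ hsM₂ hsf₂
    have e48 : s₂.R 48 = i + i := by simp [← hs₂, blockExec, Instr.aexec, h48]
    have e50 : s₂.R 50 = s.M (tb + 2 * i) := by
      simp [← hs₂, blockExec, Instr.aexec, h48, hm.r44, e1, hMM]
    have e52 : s₂.R 52 = s.M (tb + 1) := by
      rw [(hsf₂ 0 0).reg _ (by omega), hf.reg _ (by omega), h52]
    have e3 : s₂.R 3 = 1 := by rw [(hsf₂ 0 0).reg _ (by omega), hm.consts.r3]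
    have r1 := hT.inRange hp (x := 2 * i) (by omega) (by omega) (fun _ => trivial)
    have r2 := hT.inRange hp (x := 1) (by omega) (by omega) (fun _ => trivial)
    push_cast at r1 r2
    have hnode := (hT.node i hi1 hb trivial).1
    rw [pow_succ] at hj
    refine WP.ite (by exact ⟨by rwa [e50], by rwa [e52]⟩) ?_ ?_
    · intro hh
      simp only [Test.Holds, e50, e52] at hh
      apply WP.skip
      refine ⟨j, by omega, hf.trans (hsf₂ _ _), 2 * i, by omega, by omega, by rw [e48]; omega,
        by push_cast; exact hh, by nlinarith, ?_⟩
      simp; omega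
    · intro hh
      simp only [Test.Holds, e50, e52] at hh
      apply WP.block_frame 48 51 (by simp [blockOk, Instr.Ok]) (by simp [Instr.Within])
      intro s₃ hs₃ hsM₃ hsf₃
      have : s.M (tb + 2 * i + 1) = s.M (tb + 1) := by
        rw [NodeOk] at hnode
        rcases min_choice (s.M (tb + 2 * i)) (s.M (tb + 2 * i + 1)) with e | e
        · rw [e, hi] at hnode; exact absurd hnode.symm hh
        · rw [e, hi] at hnode; exact hnode.symm
      refine ⟨j, by omega, (hf.trans (hsf₂ _ _)).trans (hsf₃ _ _), 2 * i + 1, by omega, by omega,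
        ?_, by push_cast; rw [← add_assoc]; exact this, by nlinarith, ?_⟩
      · simp [← hs₃, blockExec, Instr.aexec, e48, e3]; ring
      · simp; omega
  · have hb : ¬ i < n := by simpa [Test.Holds, h48, hm.consts.r0] using hb
    refine ⟨?_, hf, i - n, by omega, by omega, ?_⟩
    · simp; omega
    · rw [show tb + (n : ℤ) + ((i - n : ℕ) : ℤ) = tb + i by omega, hi]

/-- Recompute the tree on the path from the node `R 48` to the root. -/
def repairPath : Prog :=
  .loop (.slt 3 48) (.seq (block [.bin .div 48 48 4]) recomputeNode)

/-- Only the parent of the current node can be wrong. Recomputing it moves the defect one level up,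
and above the root `1` there is no node left to be wrong. -/
theorem repairPath_spec (hp : MergeParams I N n m ab bb tb a b) {q : ℕ → ℕ} {s : AState} {i : ℕ}
    (h : MergeRegs I n m ab bb tb a b s) (h1 : 1 ≤ i) (h2 : i < 2 * n) (h48 : s.R 48 = i)
    (hT : MergeTree I n m tb a b q (fun x => x ≠ i / 2) s.M) :
    WP I N repairPath s fun s' t => t ≤ 23 * (Nat.log 2 n + 2) + 1 ∧
      Frame 48 53 tb (tb + 3 * n) s s' ∧ MergeTree I n m tb a b q (fun _ => True) s'.M := by
  have hn1 := hp.n_pos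
  have hn2 := hp.n_le
  have h1 := hp.ab_nonneg
  have h2 := hp.ab_le
  have h5 := hp.tb_le
  refine WP.loop (fun j s' t => Frame 48 53 tb (tb + 3 * n) s s' ∧ ∃ i : ℕ, 1 ≤ i ∧ i < 2 * n ∧
    s'.R 48 = i ∧ MergeTree I n m tb a b q (fun x => x ≠ i / 2) s'.M ∧ i < 2 ^ j ∧
    t + 23 * j ≤ 23 * (Nat.log 2 n + 2)) ?_
    (j := Nat.log 2 n + 2) ⟨.refl _, i, by omega, by omega, h48, hT, ?_, by omega⟩
  swap
  · have := Nat.lt_pow_succ_log_self (b := 2) (by norm_num) n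
    rw [pow_succ]; omega
  rintro j s' t ⟨hf, i, hi1, hi2, h48, hT, hj, ht⟩
  have hm := h.frame hp hf (by norm_num)
  refine ⟨by simp only [Test.Ok, InRange, h48, hm.consts.r3]; omega, fun hb => ?_, fun hb => ?_⟩
  · have hb : 1 < i := by simpa [Test.Holds, h48, hm.consts.r3] using hb
    obtain ⟨j, rfl⟩ : ∃ j', j = j' + 1 := by
      cases j with
      | zero => simp at hj; omega
      | succ j => exact ⟨j, rfl⟩
    apply WP.seq
    have hnn : ¬ (i : ℤ) < 0 := by omega
    apply WP.block_frame 48 53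
    · simp [blockOk, Instr.Ok, hm.consts.r4, h48]; omega
    · simp [Instr.Within]
    intro s₁ hs₁ hsM₁ hsf₁
    have e48 : s₁.R 48 = (i / 2 : ℕ) := by
      simp [← hs₁, blockExec, Instr.aexec, h48, hm.consts.r4, hnn]
    have hm₁ := hm.frame hp (hsf₁ tb tb) (by norm_num)
    rw [← hsM₁] at hT
    have r1 := hT.inRange hp (x := 2 * (i / 2)) (by omega) (by omega) (fun _ => by omega)
    have r2 := hT.inRange hp (x := 2 * (i / 2) + 1) (by omega) (by omega) (fun _ => by omega)
    push_cast at r1 r2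
    rw [← add_assoc] at r2
    refine (recomputeNode_spec hm₁.consts.r3 hm₁.r44 e48 (by omega) (by omega) (by exact_mod_cast r1)
      (by exact_mod_cast r2)).mono ?_
    rintro s₂ t₂ ⟨ht₂, hf₂, hM₂⟩
    have hf₂' : Frame 48 53 tb (tb + 3 * n) s₁ s₂ := hf₂.mono (by omega) le_rfl (by omega) (by omega)
    rw [pow_succ] at hj
    refine ⟨j, by omega, (hf.trans (hsf₁ _ _)).trans hf₂', i / 2, by omega, by omega,
      by rw [hf₂.reg _ (by omega), e48], ?_, by omega, ?_⟩
    · exact hT.update hp (by omega) (by omega) (fun c _ _ _ => by omega) hf₂.mem hM₂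
        (fun x hx => by omega)
    · simp; omega
  · have hb : ¬ 1 < i := by simpa [Test.Holds, h48, hm.consts.r3] using hb
    refine ⟨by omega, hf, hT.pos_le, hT.pos_mem, hT.leaf_mem, fun x hx1 hx2 _ =>
      hT.node x hx1 hx2 (by omega)⟩

/-- One step of the merge. -/
def mergeStep : Prog :=
  .seq (block [.const 42 0, .bin .add 49 44 3, .load 52 49])
    (.ite (.slt 52 5)
      (.seq (.ite (.slt 40 52) (block [.move 40 52, .const 42 1]) .skip)
        (.seq findLeaf
          (.seq (block [.bin .sub 53 48 0, .bin .add 49 45 53, .load 50 49, .bin .add 50 50 3])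
            (.seq (block [.store 49 50])
              (.seq (.ite (.slt 50 43)
                (block [.bin .add 49 46 53, .load 51 49, .bin .add 49 47 50, .load 50 49,
                  .bin .add 51 51 50])
                (block [.move 51 5]))
              (.seq (block [.bin .add 49 44 48]) (.seq (block [.store 49 51]) repairPath)))))))
      (block [.const 41 1]))

/-- A bound on the number of steps of `mergeStep`. -/
def mergeStepTime (n : ℕ) : ℕ := 36 * Nat.log 2 n + 150

/-- A step consumes the least unused pair, which need not give a new sum: if its value does not
exceed `R 40`, only the number `Φ` of unused pairs drops. Duplicates thus cost steps but are not
listed. -/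
theorem mergeStep_spec (hp : MergeParams I N n m ab bb tb a b) {A : Finset ℤ}
    (hA : ∀ l, l ∈ A ↔ ∃ i < n, ∃ j < m, l = a i + b j) {s : AState} {Φ : ℕ}
    (h : MergeInv I n m ab bb tb a b s Φ) (hthr : InRange I (s.R 40)) :
    WP I N mergeStep s (EnumStep A (MergeInv I n m ab bb tb a b) 54 tb (tb + 3 * n)
      (mergeStepTime n) s Φ) := by
  obtain ⟨hr, q, hT, hq, hΦ⟩ := h
  have hn1 := hp.n_pos
  have hn2 := hp.n_le
  have hm1 := hp.m_pos
  have hm2 := hp.m_le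
  have h1 := hp.ab_nonneg
  have h2 := hp.ab_le
  have h3 := hp.bb_nonneg
  have h4 := hp.bb_le
  have h5 := hp.tb_le
  have hleaf : ∀ i < n, s.M (tb + 1) ≤ rowKey I m a b i (q i) := by
    intro i hi
    have := root_le (tb := tb) (fun x h1 h2 => (hT.node x h1 h2 trivial).1) (n + i) (by omega)
      (by omega)
    push_cast at this
    rwa [← add_assoc, hT.leaf_mem i hi] at this
  have r1 := hT.inRange hp (x := 1) (by omega) (by omega) (fun _ => trivial)
  simp only [Nat.cast_one] at r1
  apply WP.seq
  apply WP.block_frame 42 54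
  · simp [blockOk, Instr.Ok, Instr.aexec, hr.r44, hr.consts.r3]; omega
  · simp [Instr.Within]
  intro s₁ hs₁ hsM₁ hsf₁
  have e52 : s₁.R 52 = s.M (tb + 1) := by
    simp [← hs₁, blockExec, Instr.aexec, hr.r44, hr.consts.r3]
  have e42 : s₁.R 42 = 0 := by simp [← hs₁, blockExec, Instr.aexec]
  have e43 : s₁.R 43 = m := by simp [← hs₁, blockExec, Instr.aexec, hr.r43]
  have e44 : s₁.R 44 = tb := by simp [← hs₁, blockExec, Instr.aexec, hr.r44]
  have e45 : s₁.R 45 = tb + 2 * n := by simp [← hs₁, blockExec, Instr.aexec, hr.r45]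
  have e46 : s₁.R 46 = ab := by simp [← hs₁, blockExec, Instr.aexec, hr.r46]
  have e47 : s₁.R 47 = bb := by simp [← hs₁, blockExec, Instr.aexec, hr.r47]
  have hm₁ : MergeRegs I n m ab bb tb a b s₁ :=
    ⟨hr.consts.frame (hsf₁ 0 0) (by norm_num), e43, e44, e45, e46, e47,
      by rw [hsM₁]; exact hr.a_mem, by rw [hsM₁]; exact hr.b_mem⟩
  refine WP.ite (by exact ⟨by rwa [e52], by rw [hm₁.consts.r5, InRange]; omega⟩) ?_ ?_
  · intro hb
    simp only [Test.Holds, e52, hm₁.consts.r5] at hb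
    -- the next sum
    obtain ⟨hs₂, hs₂'⟩ : ∃ P : AState → ℕ → Prop, P = fun s₂ t₂ => t₂ ≤ 6 ∧ s₂.M = s.M ∧
        Frame 40 43 tb tb s₁ s₂ ∧ s₂.R 41 = s₁.R 41 ∧
        ((s₂.R 42 = 0 ∧ s₂.R 40 = s.R 40 ∧ s.M (tb + 1) ≤ s.R 40) ∨
          (s₂.R 42 = 1 ∧ s₂.R 40 = s.M (tb + 1) ∧ s.R 40 < s.M (tb + 1))) := ⟨_, rfl⟩
    have e40 : s₁.R 40 = s.R 40 := (hsf₁ 0 0).reg _ (by omega)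
    apply WP.seq
    refine WP.mono (Q := hs₂) ?_ ?_
    · subst hs₂'
      refine WP.ite (by exact ⟨by rwa [e40], by rwa [e52]⟩) ?_ ?_
      · intro hc
        simp only [Test.Holds, e52, e40] at hc
        apply WP.block_frame 40 43 (by simp [blockOk, Instr.Ok]) (by simp [Instr.Within])
        intro s₂ hs₂ hsM₂ hsf₂
        refine ⟨by simp, by rw [hsM₂, hsM₁], hsf₂ _ _, ?_, Or.inr ⟨?_, ?_, hc⟩⟩
        · simp [← hs₂, blockExec, Instr.aexec]
        · simp [← hs₂, blockExec, Instr.aexec]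
        · simp [← hs₂, blockExec, Instr.aexec, e52]
      · intro hc
        simp only [Test.Holds, e52, e40, not_lt] at hc
        exact WP.skip ⟨by norm_num, hsM₁, .refl _, rfl, Or.inl ⟨e42, e40, hc⟩⟩
    intro s₂ t₂ hP
    subst hs₂'
    obtain ⟨ht₂, hsM₂, hf₂, h41₂, hcase⟩ := hP
    have hm₂ := hm₁.frame hp hf₂ (by norm_num)
    rw [← hsM₂] at hT hcase
    have hroot : s₂.M (tb + 1) ≤ s₂.R 40 := by
      rcases hcase with h | h
      · rw [h.2.1]; exact h.2.2
      · rw [h.2.1]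
    -- its row
    apply WP.seq
    refine (findLeaf_spec hp hm₂ hT (by rw [hf₂.reg _ (by omega), e52, hsM₂])).mono ?_
    rintro s₃ t₃ ⟨ht₃, hf₃, i, hi, h48, hroot'⟩
    have hm₃ := hm₂.frame hp hf₃ (by norm_num)
    have hsM₃ : s₃.M = s₂.M := funext fun x => hf₃.mem x (by omega)
    rw [← hsM₃] at hT hroot'
    -- An exhausted row has the key `I`, but the leaf found has the value of the root, which is
    -- below `I`.
    have hqi : q i < m := by
      by_contra hq'
      have e := hT.leaf_mem i hi
      rw [rowKey, if_neg hq', hroot', hsM₃, hsM₂] at e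
      omega
    have hkey : a i + b (q i) ≤ s₂.R 40 := by
      have e := hT.leaf_mem i hi
      rw [rowKey, if_pos hqi, hroot', hsM₃] at e
      rw [← e]; exact hroot
    have hpm := hT.pos_mem i hi
    apply WP.seq
    apply WP.block_frame 48 54
    · simp [blockOk, Instr.Ok, Instr.aexec, hm₃.r45, h48, hm₃.consts.r0]; omega
    · simp [Instr.Within]
    intro s₄ hs₄ hsM₄ hsf₄
    have hm₄ := hm₃.frame hp (hsf₄ tb tb) (by norm_num)
    have f48 : s₄.R 48 = n + i := by simp [← hs₄, blockExec, Instr.aexec, h48]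
    have f53 : s₄.R 53 = i := by simp [← hs₄, blockExec, Instr.aexec, h48, hm₃.consts.r0]
    have f49 : s₄.R 49 = tb + 2 * n + i := by
      simp [← hs₄, blockExec, Instr.aexec, h48, hm₃.consts.r0, hm₃.r45]
    have f50 : s₄.R 50 = q i + 1 := by
      simp [← hs₄, blockExec, Instr.aexec, h48, hm₃.consts.r0, hm₃.r45, hm₃.consts.r3, hpm]
    apply WP.seq
    apply WP.block (by simp [blockOk, Instr.Ok, f49]; omega)
    simp only [blockExec, Instr.aexec, f49, f50]
    generalize hs₅ : s₄.put _ _ = s₅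
    have hf₅ : Frame 48 54 tb (tb + 3 * n) s₄ s₅ := by
      rw [← hs₅]; exact .put _ (by omega)
    have hm₅ := hm₄.frame hp hf₅ (by norm_num)
    have g48 : s₅.R 48 = n + i := by rw [← hs₅]; exact f48
    have g50 : s₅.R 50 = q i + 1 := by rw [← hs₅]; exact f50
    have g53 : s₅.R 53 = i := by rw [← hs₅]; exact f53
    -- the key of the next element of the row
    apply WP.seq
    refine WP.mono (Q := fun s₆ t₆ => t₆ ≤ 12 ∧ s₆.M = s₅.M ∧ Frame 49 54 tb tb s₅ s₆ ∧
      s₆.R 51 = rowKey I m a b i (q i + 1)) ?_ ?_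
    · apply WP.ite
      · simp only [Test.Ok, InRange, g50, hm₅.r43]; omega
      · intro hc
        simp only [Test.Holds, g50, hm₅.r43] at hc
        have ea := hm₅.a_mem i hi
        have eb := hm₅.b_mem (q i + 1) (by omega)
        push_cast at eb
        apply WP.block_frame 49 54
        · simp [blockOk, Instr.Ok, Instr.aexec, hm₅.r46, hm₅.r47, g53, g50]; omega
        · simp [Instr.Within]
        intro s₆ hs₆ hsM₆ hsf₆
        refine ⟨by simp, hsM₆, hsf₆ _ _, ?_⟩
        rw [rowKey, if_pos (by omega)]
        simp [← hs₆, blockExec, Instr.aexec, hm₅.r46, hm₅.r47, g53, g50, ea, eb]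
      · intro hc
        simp only [Test.Holds, g50, hm₅.r43] at hc
        apply WP.block_frame 49 54 (by simp [blockOk, Instr.Ok]) (by simp [Instr.Within])
        intro s₆ hs₆ hsM₆ hsf₆
        refine ⟨by simp, hsM₆, hsf₆ _ _, ?_⟩
        rw [rowKey, if_neg (by omega)]
        simp [← hs₆, blockExec, Instr.aexec, hm₅.consts.r5]
    rintro s₆ t₆ ⟨ht₆, hsM₆, hf₆, h51⟩
    have hm₆ := hm₅.frame hp hf₆ (by norm_num)
    have k48 : s₆.R 48 = n + i := by rw [hf₆.reg _ (by omega), g48]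
    apply WP.seq
    apply WP.block_frame 49 54 (by simp [blockOk, Instr.Ok]) (by simp [Instr.Within])
    intro s₇ hs₇ hsM₇ hsf₇
    have hm₇ := hm₆.frame hp (hsf₇ tb tb) (by norm_num)
    have l49 : s₇.R 49 = tb + n + i := by
      simp [← hs₇, blockExec, Instr.aexec, hm₆.r44, k48]; ring
    have l51 : s₇.R 51 = rowKey I m a b i (q i + 1) := by
      rw [← h51]; simp [← hs₇, blockExec, Instr.aexec]
    have l48 : s₇.R 48 = n + i := by rw [← k48]; simp [← hs₇, blockExec, Instr.aexec]
    apply WP.seq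
    apply WP.block (by simp [blockOk, Instr.Ok, l49]; omega)
    simp only [blockExec, Instr.aexec, l49, l51]
    generalize hs₈ : s₇.put _ _ = s₈
    have hf₈ : Frame 48 54 tb (tb + 3 * n) s₇ s₈ := by
      rw [← hs₈]; exact .put _ (by omega)
    have hm₈ := hm₇.frame hp hf₈ (by norm_num)
    have m48 : s₈.R 48 = (n + i : ℕ) := by rw [← hs₈]; push_cast; exact l48
    have eM : ∀ x, s₈.M x = if x = tb + n + i then rowKey I m a b i (q i + 1) else
        if x = tb + 2 * n + i then (q i : ℤ) + 1 else s₃.M x := by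
      intro x
      rw [← hs₈, AState.put_M, hsM₇, hsM₆, ← hs₅, AState.put_M, hsM₄]
    have hT₈ : MergeTree I n m tb a b (Function.update q i (q i + 1))
        (fun x => x ≠ (n + i) / 2) s₈.M := by
      refine ⟨fun j hj => ?_, fun j hj => ?_, fun j hj => ?_, fun x hx1 hx2 hx3 => ?_⟩
      · rw [Function.update_apply]
        split_ifs
        · omega
        · exact hT.pos_le j hj
      · rw [eM, if_neg (by omega), Function.update_apply]
        by_cases hji : j = i
        · subst hji; simp
        · rw [if_neg (by omega), if_neg hji, hT.pos_mem j hj]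
      · rw [eM, Function.update_apply]
        by_cases hji : j = i
        · subst hji; simp
        · rw [if_neg (by omega), if_neg (by omega), if_neg hji, hT.leaf_mem j hj]
      · obtain ⟨e1, e2⟩ := hT.node x hx1 hx2 trivial
        rw [NodeOk, eM, eM, eM, if_neg (by omega), if_neg (by omega), if_neg (by omega),
          if_neg (by omega), if_neg (by omega), if_neg (by omega)]
        exact ⟨e1, e2⟩
    refine (repairPath_spec hp hm₈ (by omega) (by omega) m48 hT₈).mono ?_
    rintro s₉ t₉ ⟨ht₉, hf₉, hT₉⟩
    have hm₉ := hm₈.frame hp hf₉ (by norm_num)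
    have hft : Frame 43 54 tb (tb + 3 * n) s₂ s₉ :=
      ((((((hf₃.mono (by omega) (by omega) le_rfl (by omega)).trans
        ((hsf₄ tb tb).mono (by omega) (by omega) le_rfl (by omega))).trans
        (hf₅.mono (by omega) le_rfl le_rfl le_rfl)).trans
        (hf₆.mono (by omega) le_rfl le_rfl (by omega))).trans
        ((hsf₇ tb tb).mono (by omega) le_rfl le_rfl (by omega))).trans
        (hf₈.mono (by omega) le_rfl le_rfl le_rfl)).trans
        (hf₉.mono (by omega) (by omega) le_rfl le_rfl)
    have h40 : s₉.R 40 = s₂.R 40 := hft.reg _ (by omega)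
    have h41 : s₉.R 41 = s₂.R 41 := hft.reg _ (by omega)
    have h42 : s₉.R 42 = s₂.R 42 := hft.reg _ (by omega)
    have h41' : s₂.R 41 = s.R 41 := by
      rw [h41₂, (hsf₁ 0 0).reg _ (by omega)]
    have hge : s.R 40 ≤ s₂.R 40 := by rcases hcase with h | h <;> omega
    have hq' : ∀ i' < n, ∀ j < Function.update q i (q i + 1) i', a i' + b j ≤ s₂.R 40 := by
      intro i' hi' j hj
      rw [Function.update_apply] at hj
      split_ifs at hj with hii
      · subst hii
        rcases Nat.lt_succ_iff_lt_or_eq.1 hj with hj | rfl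
        · exact (hq i' hi' j hj).trans hge
        · exact hkey
      · exact (hq i' hi' j hj).trans hge
    have hΦ' : ∑ i' ∈ Finset.range n, (m - Function.update q i (q i + 1) i') < Φ := by
      rw [hΦ]
      refine Finset.sum_lt_sum (fun i' _ => ?_) ⟨i, Finset.mem_range.2 hi, ?_⟩
      · rw [Function.update_apply]
        split_ifs with hii
        · subst hii; omega
        · exact le_rfl
      · rw [Function.update_self]; omega
    refine ⟨?_, ?_, _, ⟨hm₉, _, hT₉, ?_, rfl⟩, ?_⟩
    · simp only [mergeStepTime, List.length_cons, List.length_nil]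
      omega
    · exact (((hsf₁ tb (tb + 3 * n)).mono (by omega) le_rfl le_rfl le_rfl).trans
        (hf₂.mono le_rfl (by omega) le_rfl (by omega))).trans
        (hft.mono (by omega) le_rfl le_rfl le_rfl)
    · rw [h40]; exact hq'
    · rcases hcase with ⟨c1, c2, c3⟩ | ⟨c1, c2, c3⟩
      · exact Or.inl ⟨by rw [h42, c1], by rw [h40, c2], by rw [h41, h41'], hΦ'⟩
      · refine Or.inr (Or.inl ⟨by rw [h42, c1], by rw [h40, c2]; exact c3, ?_, ?_,
          by rw [h41, h41'], hΦ'⟩)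
        · rw [h40, c2, hA]
          refine ⟨i, hi, q i, hqi, ?_⟩
          have e := hT.leaf_mem i hi
          rwa [rowKey, if_pos hqi, hroot', hsM₃] at e
        -- A sum above the old `R 40` comes from an unused pair, so it is at least the key of its
        -- row and hence at least the root.
        · intro l hl hlt
          obtain ⟨i', hi'', j, hj, rfl⟩ := (hA l).1 hl
          by_contra hgt
          have hjq : q i' ≤ j := by
            by_contra hjq
            exact hgt (hq i' hi'' j (by omega))
          have e := hleaf i' hi''
          rw [rowKey, if_pos (by omega)] at e
          have := hp.sorted _ _ hjq hj
          rw [h40, c2, hsM₂] at hlt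
          omega
  · intro hb
    simp only [Test.Holds, e52, hm₁.consts.r5, not_lt] at hb
    apply WP.block_frame 40 43 (by simp [blockOk, Instr.Ok]) (by simp [Instr.Within])
    intro s₂ hs₂ hsM₂ hsf₂
    have hf₂ := hsf₂ tb tb
    have e40 : s₂.R 40 = s.R 40 := by
      rw [← (hsf₁ 0 0).reg 40 (by omega)]; simp [← hs₂, blockExec, Instr.aexec]
    -- The root, and with it every leaf, is at least `I`, while all sums are below `I`.
    have hall : ∀ i < n, q i = m := by
      intro i hi
      have e := (hb.trans (hleaf i hi))
      rw [rowKey] at e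
      by_contra hne
      have hlt : q i < m := lt_of_le_of_ne (hT.pos_le i hi) hne
      rw [if_pos hlt] at e
      have := hp.bound i hi _ hlt
      omega
    refine ⟨?_, ?_, Φ, ⟨hm₁.frame hp hf₂ (by norm_num), q, by rw [hsM₂, hsM₁]; exact hT,
      by rw [e40]; exact hq, hΦ⟩, Or.inr (Or.inr ⟨?_, e40, ?_, ?_⟩)⟩
    · simp [mergeStepTime]
    · exact ((hsf₁ _ _).mono (by omega) le_rfl le_rfl le_rfl).trans
        ((hsf₂ _ _).mono le_rfl (by omega) le_rfl le_rfl)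
    · rw [← e42]; simp [← hs₂, blockExec, Instr.aexec]
    · simp [← hs₂, blockExec, Instr.aexec]
    · intro l hl
      obtain ⟨i, hi, j, hj, rfl⟩ := (hA l).1 hl
      exact hq i hi j (by rw [hall i hi]; exact hj)

end KSum

namespace KSum

variable {I N : ℤ}

/-! ### Arrays of enumerated elements -/

/-- The range of the partial sums. -/
def Small (I z : ℤ) : Prop := -I ≤ z ∧ z ≤ I

/-- Execute `R 0` steps of an enumeration and store the elements in an array at address `R 30`; the
number of elements goes to register `31`. -/
def fillArray (step : Prog) : Prog :=
  .seq (block [.const 31 0])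
    (forLoop 32 (.seq step
      (.ite (.eq 42 3) (block [.bin .add 33 30 31, .store 33 40, .bin .add 31 31 3]) .skip)))

/-- The array at address `dst` of length `cnt` lists in increasing order the elements of `A` that
are larger than `u` and not larger than `v`. -/
structure ListsChunk (A : Finset ℤ) (dst : ℤ) (cnt : ℕ) (u v : ℤ) (M : ℤ → ℤ) : Prop where
  strict : ∀ i j, i < j → j < cnt → M (dst + i) < M (dst + j)
  mem_iff : ∀ l, (∃ i < cnt, M (dst + i) = l) ↔ l ∈ A ∧ u < l ∧ l ≤ v
  last : ∀ c, cnt = c + 1 → M (dst + c) = v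
  le : u ≤ v

/-- The state of the enumeration after the steps that filled an array. -/
structure Filled (I : ℤ) (A : Finset ℤ) (J : AState → ℕ → Prop) (n : ℕ) (hi : ℕ) (dst y : ℤ) (c : ℕ)
    (s : AState) (Φ : ℕ) (s' : AState) (t : ℕ) : Prop where
  time : t ≤ n * (c + 18) + 9
  frame : Frame 30 hi dst y s s'
  small : Small I (s'.R 40)
  chunk : ∃ cnt ≤ n, s'.R 31 = cnt ∧ ListsChunk A dst cnt (s.R 40) (s'.R 40) s'.M
  prog : ∃ Φ', J s' Φ' ∧ ((s'.R 41 = 1 ∧ ∀ l ∈ A, l ≤ s'.R 40) ∨ (s'.R 41 = 0 ∧ Φ' + n ≤ Φ))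

/-- The loop makes `n` steps instead of collecting `n` elements, so a chunk may be short or empty.
What counts is that the potential falls by `n` unless the enumeration is complete; this bounds the
number of chunks. -/
theorem fillArray_spec {A : Finset ℤ} {J : AState → ℕ → Prop} {n hi : ℕ} {dst x y : ℤ} {c : ℕ}
    {step : Prog} (hA : ∀ l ∈ A, -I < l ∧ l < I) (hn : (n : ℤ) ≤ I) (hhi : 43 ≤ hi)
    (hx : dst + n ≤ x) (hy : x ≤ y) (hdst : 0 ≤ dst) (hdN : dst + n ≤ N)
    (hJ : ∀ s s' Φ, Frame 30 34 dst (dst + n) s s' → J s Φ → J s' Φ)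
    (hc : ∀ s Φ, J s Φ → s.R 0 = n ∧ s.R 3 = 1)
    (hstep : ∀ s Φ, J s Φ → Small I (s.R 40) → WP I N step s (EnumStep A J hi x y c s Φ))
    {s : AState} {Φ : ℕ} (hs : J s Φ) (h30 : s.R 30 = dst) (h40 : Small I (s.R 40))
    (h41 : s.R 41 = 0) :
    WP I N (fillArray step) s (Filled I A J n hi dst y c s Φ) := by
  have hI : 0 ≤ I := by omega
  apply WP.seq
  apply WP.block_frame 30 34 (by simp [blockOk, Instr.Ok]) (by simp [Instr.Within])
  intro s₁ hs₁ hsM₁ hsf₁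
  have hJ₁ := hJ _ _ _ (hsf₁ _ _) hs
  have g40 : s₁.R 40 = s.R 40 := (hsf₁ 0 0).reg _ (by omega)
  refine WP.forLoop hn (fun i s' => Frame 30 hi dst y s s' ∧ s'.R 30 = dst ∧ Small I (s'.R 40) ∧
    (∃ cnt ≤ i, s'.R 31 = cnt ∧ ListsChunk A dst cnt (s.R 40) (s'.R 40) s'.M) ∧
    ∃ Φ', J s' Φ' ∧ ((s'.R 41 = 1 ∧ ∀ l ∈ A, l ≤ s'.R 40) ∨ (s'.R 41 = 0 ∧ Φ' + i ≤ Φ)))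
    (fun _ => c + 10) (by norm_num) (by norm_num) (hc _ _ hJ₁).1 (hc _ _ hJ₁).2 ?_ ?_ ?_
  · have hf : Frame 30 34 dst (dst + n) s (s₁.set 32 0) :=
      (hsf₁ _ _).trans (.set _ (by norm_num))
    refine ⟨hf.mono le_rfl (by omega) le_rfl (by omega), ?_, by simpa [g40] using h40,
      ⟨0, le_rfl, ?_, ?_⟩, Φ, hJ _ _ _ hf hs, Or.inr ⟨?_, by omega⟩⟩
    · simp [← hs₁, blockExec, Instr.aexec, h30]
    · simp [← hs₁, blockExec, Instr.aexec]
    · simp only [AState.set_R, g40]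
      exact ⟨by omega, fun l => by simp, by omega, le_rfl⟩
    · rw [hf.reg _ (by omega), h41]
  · rintro i hi' s₂ ⟨hf, h30, h40, ⟨cnt, hcnt, h31, hch⟩, Φ', hJ', hdone⟩ h32 h0 h3
    apply WP.seq
    refine (hstep _ _ hJ' h40).mono ?_
    rintro s₃ t₃ ⟨ht₃, hf₃, Φ₃, hJ₃, hcase⟩
    have hM₃ : ∀ j < cnt, s₃.M (dst + j) = s₂.M (dst + j) := fun j hj => hf₃.mem _ (by omega)
    have hf' : Frame 30 hi dst y s s₃ := hf.trans (hf₃.mono (by omega) le_rfl (by omega) le_rfl)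
    have k0 := hc _ _ hJ₃
    have k30 : s₃.R 30 = dst := by rw [hf₃.reg _ (by omega), h30]
    have k31 : s₃.R 31 = cnt := by rw [hf₃.reg _ (by omega), h31]
    have k32 : s₃.R 32 = i := by rw [hf₃.reg _ (by omega), h32]
    -- a step without a new element
    have key0 : s₃.R 42 = 0 → s₃.R 40 = s₂.R 40 →
        ((s₃.R 41 = 1 ∧ ∀ l ∈ A, l ≤ s₃.R 40) ∨ (s₃.R 41 = 0 ∧ Φ₃ + (i + 1) ≤ Φ)) →
        WP I N (.ite (.eq 42 3) (block [.bin .add 33 30 31, .store 33 40, .bin .add 31 31 3]) .skip)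
        s₃ fun s₂ m₂ => t₃ + m₂ + 1 ≤ c + 10 ∧ s₂.R 32 = i ∧ s₂.R 0 = n ∧ s₂.R 3 = 1 ∧
          Frame 30 hi dst y s (s₂.set 32 (i + 1)) ∧ (s₂.set 32 (i + 1)).R 30 = dst ∧
          Small I ((s₂.set 32 (i + 1)).R 40) ∧
          (∃ cnt ≤ i + 1, (s₂.set 32 (i + 1)).R 31 = cnt ∧
            ListsChunk A dst cnt (s.R 40) ((s₂.set 32 (i + 1)).R 40) (s₂.set 32 (i + 1)).M) ∧
          ∃ Φ', J (s₂.set 32 (i + 1)) Φ' ∧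
            (((s₂.set 32 (i + 1)).R 41 = 1 ∧ ∀ l ∈ A, l ≤ (s₂.set 32 (i + 1)).R 40) ∨
            ((s₂.set 32 (i + 1)).R 41 = 0 ∧ Φ' + (i + 1) ≤ Φ)) := by
      intro h42 h40' hd
      refine WP.ite (by simp only [Test.Ok, InRange, h42, k0.2]; omega) ?_ ?_
      · intro hb; simp [Test.Holds, h42, k0.2] at hb
      · intro _
        refine WP.skip ⟨by omega, k32, k0.1, k0.2, hf'.trans (.set _ (by omega)), by simp [k30],
          by simpa [h40'] using h40, ⟨cnt, by omega, by simp [k31], ?_⟩, Φ₃,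
          hJ _ _ _ (.set _ (by norm_num)) hJ₃, by simpa using hd⟩
        have e40 : (s₃.set 32 (i + 1)).R 40 = s₂.R 40 := by simp [h40']
        rw [e40, AState.set_M]
        refine ⟨fun j k hjk hk => ?_, fun l => ?_, fun d hd => ?_, hch.le⟩
        · rw [hM₃ _ (by omega), hM₃ _ hk]; exact hch.strict j k hjk hk
        · rw [← hch.mem_iff]
          exact ⟨fun ⟨j, hj, e⟩ => ⟨j, hj, by rw [← hM₃ j hj, e]⟩,
            fun ⟨j, hj, e⟩ => ⟨j, hj, by rw [hM₃ j hj, e]⟩⟩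
        · rw [hM₃ _ (by omega)]; exact hch.last d hd
    rcases hcase with ⟨h42, h40', h41', hΦ⟩ | ⟨h42, hlt, hmem, hnext, h41', hΦ⟩ |
      ⟨h42, h40', h41', hall⟩
    · refine key0 h42 h40' ?_
      rw [h41', h40']
      rcases hdone with h | h
      · exact Or.inl h
      · exact Or.inr ⟨h.1, by omega⟩
    -- The appearance of an element above `R 40` shows that the enumeration was not complete before.
    · have hd : s₂.R 41 = 0 ∧ Φ' + i ≤ Φ := by
        rcases hdone with h | h
        · exact absurd (h.2 _ hmem) (by omega)
        · exact h
      have hb := hA _ hmem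
      refine WP.ite (by simp only [Test.Ok, InRange, h42, k0.2]; omega) ?_ ?_
      swap
      · intro hb; simp [Test.Holds, h42, k0.2] at hb
      intro _
      apply WP.block (by simp [blockOk, Instr.Ok, Instr.aexec, k30, k31]; omega)
      simp only [blockExec, Instr.aexec, k30, k31]
      generalize hs₄ : AState.set _ _ _ = s₄
      have hf₄ : Frame 30 34 dst (dst + n) s₃ s₄ := by
        rw [← hs₄]
        exact ((Frame.set _ (by norm_num)).trans (Frame.put _ (by simp; omega))).trans
          (Frame.set _ (by norm_num))
      have hf₄' : Frame 30 34 dst (dst + n) s₃ (s₄.set 32 (i + 1)) :=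
        hf₄.trans (.set _ (by norm_num))
      have k31' : s₄.R 31 = cnt + 1 := by simp [← hs₄, k31, k0.2]
      have k40' : s₄.R 40 = s₃.R 40 := hf₄.reg _ (by omega)
      have eM : ∀ z, s₄.M z = if z = dst + cnt then s₃.R 40 else s₃.M z := by
        intro z; simp [← hs₄]
      have eM' : ∀ j < cnt, s₄.M (dst + j) = s₂.M (dst + j) := fun j hj => by
        rw [eM, if_neg (by omega), hM₃ j hj]
      have eMc : s₄.M (dst + cnt) = s₃.R 40 := by rw [eM, if_pos rfl]
      refine ⟨by simp; omega, by rw [← hs₄]; simpa using k32, by rw [hf₄.reg _ (by omega), k0.1],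
        by rw [hf₄.reg _ (by omega), k0.2],
        hf'.trans (hf₄'.mono le_rfl (by omega) le_rfl (by omega)), ?_, ?_, ⟨cnt + 1, by omega, ?_,
        ?_⟩, Φ₃, hJ _ _ _ hf₄' hJ₃, Or.inr ⟨?_, by omega⟩⟩
      · simp [← hs₄, k30]
      · simp [k40', Small]; omega
      · simp [k31']
      · have e40 : (s₄.set 32 (i + 1)).R 40 = s₃.R 40 := by simp [k40']
        rw [e40, AState.set_M]
        have hle : ∀ j < cnt, s₂.M (dst + j) ≤ s₂.R 40 := fun j hj =>
          ((hch.mem_iff _).1 ⟨j, hj, rfl⟩).2.2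
        refine ⟨fun j k hjk hk => ?_, fun l => ⟨?_, ?_⟩, fun d hd => ?_, hch.le.trans hlt.le⟩
        · rcases Nat.lt_succ_iff_lt_or_eq.1 hk with hk | rfl
          · rw [eM' _ (by omega), eM' _ hk]; exact hch.strict j k hjk hk
          · rw [eM' _ hjk, eMc]; exact (hle j hjk).trans_lt hlt
        · rintro ⟨j, hj, rfl⟩
          rcases Nat.lt_succ_iff_lt_or_eq.1 hj with hj | rfl
          · rw [eM' _ hj]
            have := (hch.mem_iff _).1 ⟨j, hj, rfl⟩
            exact ⟨this.1, this.2.1, this.2.2.trans hlt.le⟩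
          · rw [eMc]; exact ⟨hmem, hch.le.trans_lt hlt, le_rfl⟩
        · rintro ⟨h1, h2, h3⟩
          rcases h3.lt_or_eq with h3 | rfl
          · obtain ⟨j, hj, e⟩ := (hch.mem_iff l).2 ⟨h1, h2, hnext l h1 h3⟩
            exact ⟨j, by omega, by rw [eM' j hj, e]⟩
          · exact ⟨cnt, by omega, eMc⟩
        · obtain rfl : d = cnt := by omega
          exact eMc
      · rw [hf₄'.reg _ (by omega), h41', hd.1]
    · refine key0 h42 h40' (Or.inl ⟨h41', ?_⟩)
      rw [h40']; exact hall
  · rintro s' t ⟨hf, _, hsm, hch, hpr⟩ _ _ _ ht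
    refine ⟨?_, hf, hsm, hch, hpr⟩
    simp only [Finset.sum_const, Finset.card_range, smul_eq_mul] at ht
    simp only [List.length_cons, List.length_nil]
    nlinarith

end KSum

namespace KSum

variable {I N : ℤ}

/-! ### Nested loops over the elements of several lists -/

/-- The set of the elements of list `o`. -/
def values (S : ℕ → ℕ → ℤ) (n o : ℕ) : Finset ℤ := (Finset.range n).image (S o)

/-- The set of sums of `d` elements, one from each of the lists `o, …, o + d - 1`. -/
def sumset (S : ℕ → ℕ → ℤ) (n : ℕ) : ℕ → ℕ → Finset ℤ
  | _, 0 => {0}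
  | o, d + 1 => Finset.image₂ (· + ·) (values S n o) (sumset S n (o + 1) d)

variable {S : ℕ → ℕ → ℤ} {n : ℕ}

theorem mem_values {o : ℕ} {l : ℤ} : l ∈ values S n o ↔ ∃ j < n, S o j = l := by
  simp [values]

theorem mem_sumset_succ {o d : ℕ} {l : ℤ} :
    l ∈ sumset S n o (d + 1) ↔ ∃ j < n, ∃ x ∈ sumset S n (o + 1) d, S o j + x = l := by
  simp [sumset, Finset.mem_image₂, values]

theorem mem_sumset {o d : ℕ} {l : ℤ} :
    l ∈ sumset S n o d ↔ ∃ js : ℕ → ℕ, (∀ r < d, js r < n) ∧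
      l = ∑ r ∈ Finset.range d, S (o + r) (js r) := by
  induction d generalizing o l with
  | zero => simp [sumset]
  | succ d ih =>
    rw [mem_sumset_succ]
    constructor
    · rintro ⟨j, hj, x, hx, rfl⟩
      obtain ⟨js, hjs, rfl⟩ := ih.1 hx
      refine ⟨fun r => if r = 0 then j else js (r - 1), fun r hr => ?_, ?_⟩
      · dsimp only; split_ifs
        · exact hj
        · exact hjs _ (by omega)
      · rw [Finset.sum_range_succ', add_comm]
        simp [add_assoc, add_comm 1]
    · rintro ⟨js, hjs, rfl⟩
      refine ⟨js 0, hjs 0 (by omega), _, ih.2 ⟨fun r => js (r + 1), fun r hr => hjs _ (by omega),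
        rfl⟩, ?_⟩
      rw [Finset.sum_range_succ', add_comm]
      simp [add_assoc, add_comm 1]

theorem card_sumset_le (o d : ℕ) : (sumset S n o d).card ≤ n ^ d := by
  induction d generalizing o with
  | zero => simp [sumset]
  | succ d ih =>
    rw [sumset, pow_succ']
    refine (Finset.card_image₂_le _ _ _).trans (Nat.mul_le_mul ?_ (ih _))
    exact Finset.card_image_le.trans (by simp)

theorem abs_sumset_le {k : ℕ} {V : ℤ} (hV : ∀ i < k, ∀ j < n, |S i j| ≤ V) {o d : ℕ}
    (h : o + d ≤ k) {l : ℤ} (hl : l ∈ sumset S n o d) : |l| ≤ d * V := by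
  induction d generalizing o l with
  | zero => simp [sumset] at hl; simp [hl]
  | succ d ih =>
    obtain ⟨j, hj, x, hx, rfl⟩ := mem_sumset_succ.1 hl
    have h1 := ih (by omega) hx
    have h2 := hV o (by omega) j hj
    push_cast
    calc |S o j + x| ≤ |S o j| + |x| := abs_add_le _ _
      _ ≤ (d + 1) * V := by linarith

/-- Loops over all tuples of elements of the lists `o, …, o + d - 1`. At depth `i`, the position in
the list is in register `65 + 4 * i`, and the sum of the elements of the previous lists is in
register `64 + 4 * i`. -/
def nest : ℕ → ℕ → ℕ → Prog → Prog
  | _, _, 0, p => p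
  | o, i, d + 1, p => forLoop (65 + 4 * i)
      (.seq (block [.const (66 + 4 * i) o, .bin .mul (66 + 4 * i) (66 + 4 * i) 0,
        .bin .add (66 + 4 * i) (66 + 4 * i) (65 + 4 * i), .load (66 + 4 * i) (66 + 4 * i),
        .bin .add (68 + 4 * i) (64 + 4 * i) (66 + 4 * i)])
      (nest (o + 1) (i + 1) d p))

/-- A bound on the number of steps of nested loops. -/
def nestTime (n c : ℕ) : ℕ → ℕ
  | 0 => c
  | d + 1 => n * (nestTime n c d + 17) + 5

/-- The memory, the constants and the registers from `64` up to `lim` are not changed. -/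
structure Keeps (lim : ℕ) (s s' : AState) : Prop where
  reg : ∀ r, r < 7 ∨ 64 ≤ r ∧ r < lim → s'.R r = s.R r
  mem : s'.M = s.M

theorem Keeps.trans {lim : ℕ} {s s' s'' : AState} (h : Keeps lim s s') (h' : Keeps lim s' s'') :
    Keeps lim s s'' :=
  ⟨fun r hr => (h'.reg r hr).trans (h.reg r hr), h'.mem.trans h.mem⟩

/-- `Seen x` stands for what the body achieves at the sum `x`. It must survive all later executions
of the body, so that in the end it holds for all sums at once. The fixed depth `e = i + d`
determines the register in which the body finds the complete sum. -/
theorem nest_spec {M : ℤ → ℤ} {Seen : ℤ → AState → Prop} {c e : ℕ} {p : Prog} (hn : (n : ℤ) ≤ I)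
    (d : ℕ) : ∀ (o i : ℕ) (a : ℤ) (Inv : AState → Prop), i + d = e →
    (∀ r < d, ∀ j < n, M ((o + r : ℕ) * n + j) = S (o + r) j) → ((o + d : ℕ) * n : ℤ) ≤ N →
    (∀ s s', Frame (65 + 4 * i) (65 + 4 * e) 0 0 s s' → s'.M = s.M → Inv s → Inv s') →
    (∀ s s' x, Frame (65 + 4 * i) (65 + 4 * e) 0 0 s s' → s'.M = s.M → Seen x s → Seen x s') →
    (∀ s x (js : ℕ → ℕ), Inv s → s.R 0 = n → s.R 3 = 1 → s.M = M → s.R (64 + 4 * e) = x →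
      (∀ r < d, js r < n ∧ s.R (65 + 4 * (i + r)) = js r) →
      x = a + ∑ r ∈ Finset.range d, S (o + r) (js r) →
      WP I N p s fun s' t => t ≤ c ∧ Inv s' ∧ Seen x s' ∧ (∀ y, Seen y s → Seen y s') ∧
        Keeps (65 + 4 * e) s s') →
    ∀ s, Inv s → s.R 0 = n → s.R 3 = 1 → s.M = M → s.R (64 + 4 * i) = a →
    WP I N (nest o i d p) s fun s' t => t ≤ nestTime n c d ∧ Inv s' ∧
      (∀ x ∈ sumset S n o d, Seen (a + x) s') ∧ (∀ y, Seen y s → Seen y s') ∧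
      Keeps (65 + 4 * i) s s' := by
  induction d with
  | zero =>
    intro o i a Inv hie _ _ _ _ hp s hs h0 h3 hM ha
    subst hie
    refine (hp s a (fun _ => 0) hs h0 h3 hM ha (by simp) (by simp)).mono ?_
    rintro s' t ⟨h1, h2, h4, h5, h6⟩
    exact ⟨h1, h2, by simpa [sumset] using h4, h5, h6⟩
  | succ d ih =>
    intro o i a Inv hie hMS hN hInv hSeen hp s hs h0 h3 hM ha
    have hset : ∀ z, Frame (65 + 4 * i) (65 + 4 * e) 0 0 s (s.set (65 + 4 * i) z) :=
      fun z => .set _ (by omega)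
    refine WP.forLoop hn (fun j s' => Inv s' ∧ (∀ j' < j, ∀ x ∈ sumset S n (o + 1) d,
        Seen (a + (S o j' + x)) s') ∧ (∀ y, Seen y s → Seen y s') ∧ Keeps (65 + 4 * i) s s')
      (fun _ => nestTime n c d + 12) (by omega) (by omega) h0 h3 ?_ ?_ ?_
    · exact ⟨hInv _ _ (hset 0) rfl hs, by simp, fun y hy => hSeen _ _ _ (hset 0) rfl hy,
        ⟨fun r hr => (hset 0).reg r (by omega), rfl⟩⟩
    · rintro j hj s₁ ⟨hs₁, hseen, hsm, hk⟩ hj' h0' h3'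
      have hM₁ : s₁.M = M := hk.mem.trans hM
      have hae : s₁.R (64 + 4 * i) = a := by rw [hk.reg _ (by omega), ha]
      have hMo := hMS 0 (by omega) j hj
      simp only [add_zero] at hMo
      have hno : (0 : ℤ) ≤ (o : ℤ) * n := by positivity
      have hno' : ((o : ℤ) + (d + 1)) * n = o * n + d * n + n := by ring
      have hdn : (0 : ℤ) ≤ (d : ℤ) * n := by positivity
      push_cast at hN
      rw [hno'] at hN
      have h66 : ¬ 0 = 66 + 4 * i := by omega
      apply WP.seq
      apply WP.block_frame (65 + 4 * i + 1) (65 + 4 * e)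
      · simp [blockOk, Instr.Ok, Instr.aexec, hj', h0', h66]
        omega
      · simp [Instr.Within]; omega
      intro s₂ hs₂ hsM₂ hsf₂
      have hs2 : Inv s₂ :=
        hInv _ _ ((hsf₂ 0 0).mono (by omega) le_rfl le_rfl le_rfl) hsM₂ hs₁
      have e68 : s₂.R (64 + 4 * (i + 1)) = a + S o j := by
        have : 64 + 4 * (i + 1) = 68 + 4 * i := by ring
        rw [this]
        simp [← hs₂, blockExec, Instr.aexec, hj', h0', hM₁, hMo, hae, h66]
      have e65 : s₂.R (65 + 4 * i) = j := by rw [(hsf₂ 0 0).reg _ (by omega), hj']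
      have e64 : s₂.R (64 + 4 * i) = a := by rw [(hsf₂ 0 0).reg _ (by omega), hae]
      -- The index of the current loop joins the invariant of the inner loops, so that the body sees
      -- the whole tuple of positions.
      refine (ih (o + 1) (i + 1) (a + S o j) (fun s' => Inv s' ∧ s'.R (65 + 4 * i) = j) (by omega)
        (fun r hr j hj => ?_) ?_ ?_ ?_ ?_ s₂ ⟨hs2, e65⟩
        (by rw [(hsf₂ 0 0).reg _ (by omega), h0']) (by rw [(hsf₂ 0 0).reg _ (by omega), h3'])
        (by rw [hsM₂, hM₁]) e68).mono ?_
      · have := hMS (r + 1) (by omega) j hj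
        rw [show o + 1 + r = o + (r + 1) by ring]
        exact this
      · push_cast; linarith
      · rintro t t' hf hm ⟨h1, h2⟩
        exact ⟨hInv _ _ (hf.mono (by omega) le_rfl le_rfl le_rfl) hm h1,
          by rw [hf.reg _ (by omega), h2]⟩
      · intro t t' x hf hm h
        exact hSeen _ _ _ (hf.mono (by omega) le_rfl le_rfl le_rfl) hm h
      · rintro t x js ⟨ht, htj⟩ ht0 ht3 htM htx hjs hx
        refine (hp t x (fun r => if r = 0 then j else js (r - 1)) ht ht0 ht3 htM htx ?_ ?_).mono ?_
        · intro r hr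
          rcases r with _ | r
          · simpa using ⟨hj, htj⟩
          · have := hjs r (by omega)
            simpa [show i + 1 + r = i + (r + 1) by ring] using this
        · rw [hx, Finset.sum_range_succ']
          simp [add_assoc, add_comm 1, add_comm (S o j)]
        · rintro s' t' ⟨h1, h2, h4, h5, h6⟩
          exact ⟨h1, ⟨h2, by rw [h6.reg _ (by omega), htj]⟩, h4, h5, h6⟩
      · rintro s₃ t₃ ⟨ht₃, ⟨hs₃, hj₃⟩, hseen₃, hsm₃, hk₃⟩
        have hf₃ : ∀ z, Frame (65 + 4 * i) (65 + 4 * e) 0 0 s₃ (s₃.set (65 + 4 * i) z) :=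
          fun z => .set _ (by omega)
        have hf₂ : Frame (65 + 4 * i) (65 + 4 * e) 0 0 s₁ s₂ :=
          (hsf₂ 0 0).mono (by omega) le_rfl le_rfl le_rfl
        refine ⟨?_, hj₃, ?_, ?_, hInv _ _ (hf₃ _) rfl hs₃, ?_, ?_, ?_⟩
        · simp only [List.length_cons, List.length_nil]; omega
        · rw [hk₃.reg _ (by omega), (hsf₂ 0 0).reg _ (by omega), h0']
        · rw [hk₃.reg _ (by omega), (hsf₂ 0 0).reg _ (by omega), h3']
        · intro j' hj'' x hx
          refine hSeen _ _ _ (hf₃ _) rfl ?_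
          rcases Nat.lt_succ_iff_lt_or_eq.1 hj'' with h | rfl
          · exact hsm₃ _ (hSeen _ _ _ hf₂ hsM₂ (hseen j' h x hx))
          · rw [← add_assoc]; exact hseen₃ x hx
        · exact fun y hy => hSeen _ _ _ (hf₃ _) rfl (hsm₃ _ (hSeen _ _ _ hf₂ hsM₂ (hsm y hy)))
        · refine hk.trans ⟨fun r hr => ?_, ?_⟩
          · rw [(hf₃ _).reg _ (by omega), hk₃.reg _ (by omega), (hsf₂ 0 0).reg _ (by omega)]
          · rw [AState.set_M, hk₃.mem, hsM₂]
    · rintro s' t ⟨h1, h2, h4, h5⟩ _ _ _ ht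
      refine ⟨?_, h1, fun x hx => ?_, h4, h5⟩
      · simpa [nestTime, add_assoc] using ht
      · obtain ⟨j, hj, x, hx', rfl⟩ := mem_sumset_succ.1 hx
        exact h2 j hj x hx'

end KSum

namespace KSum

variable {I N : ℤ}

/-! ### Enumeration of the sums of several lists in increasing order

Each step searches for the smallest sum that is larger than the previous one. -/

/-- The numbers of the instance are small, and there is enough memory. -/
structure Instance (I N : ℤ) (k n : ℕ) (S : ℕ → ℕ → ℤ) (V : ℤ) : Prop where
  n_pos : 1 ≤ n
  n_le : (n : ℤ) ≤ I
  V_nonneg : 0 ≤ V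
  bound : ∀ i < k, ∀ j < n, |S i j| ≤ V
  sum_lt : k * V < I
  mem_le : (k * n : ℤ) < N

/-- The lists are in memory, followed by a cell that contains `0`. -/
structure InputMem (k n : ℕ) (S : ℕ → ℕ → ℤ) (M : ℤ → ℤ) : Prop where
  list : ∀ i < k, ∀ j < n, M (i * n + j) = S i j
  zero : M (k * n) = 0

/-- The array at address `bb` of length `m` lists the elements of list `o` in increasing order. -/
structure SortedValues (S : ℕ → ℕ → ℤ) (n o : ℕ) (bb : ℤ) (m : ℕ) (M : ℤ → ℤ) : Prop where
  strict : ∀ i j, i < j → j < m → M (bb + i) < M (bb + j)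
  mem_iff : ∀ l, (∃ i < m, M (bb + i) = l) ↔ l ∈ values S n o

variable {k n : ℕ} {S : ℕ → ℕ → ℤ} {V : ℤ}

theorem Instance.abs_sumset_lt (h : Instance I N k n S V) {o d : ℕ} (hod : o + d ≤ k) {l : ℤ}
    (hl : l ∈ sumset S n o d) : -I < l ∧ l < I := by
  have h1 := abs_sumset_le h.bound hod hl
  have h2 : (d : ℤ) * V ≤ k * V := by
    have : (d : ℤ) ≤ k := by omega
    exact mul_le_mul_of_nonneg_right this h.V_nonneg
  have := h.sum_lt
  exact abs_lt.1 (by omega)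

theorem SortedValues.pos {o : ℕ} {bb : ℤ} {m : ℕ} {M : ℤ → ℤ} (h : SortedValues S n o bb m M)
    (hn : 1 ≤ n) : 1 ≤ m := by
  obtain ⟨i, hi, _⟩ := (h.mem_iff (S o 0)).2 (mem_values.2 ⟨0, by omega, rfl⟩)
  omega

theorem SortedValues.mono {o : ℕ} {bb : ℤ} {m : ℕ} {M : ℤ → ℤ} (h : SortedValues S n o bb m M)
    (i j : ℕ) (hij : i ≤ j) (hj : j < m) : M (bb + i) ≤ M (bb + j) := by
  rcases hij.lt_or_eq with h' | rfl
  · exact (h.strict i j h' hj).le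
  · exact le_rfl

/-- The body of the nested loops: complete the sum in register `64 + 4 * d` by an element of the
sorted list, and update the smallest sum `R 44` found so far. -/
def completeSum (d : ℕ) : Prog :=
  .seq (block [.bin .sub 52 40 (64 + 4 * d)])
    (.seq binarySearch
      (.ite (.slt 53 43)
        (.seq (block [.bin .add 54 47 53, .load 55 54, .bin .add 55 55 (64 + 4 * d)])
          (.ite (.slt 55 44) (block [.move 44 55]) .skip))
        .skip))

/-- One step of the enumeration of the sums of the lists `o, …, o + d`. -/
def searchStep (o d : ℕ) : Prog :=
  .seq (block [.const 42 0, .move 44 5, .const 64 0, .move 50 47, .move 51 43])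
    (.seq (nest (o + 1) 0 d (completeSum d))
      (.ite (.slt 44 5) (block [.move 40 44, .const 42 1]) (block [.const 41 1])))

/-- A bound on the number of steps of `searchStep`. -/
def searchStepTime (n d : ℕ) : ℕ := nestTime n (15 * Nat.log 2 n + 60) d + 40

/-- The invariant of the enumeration by search. -/
structure SearchInv (I : ℤ) (k n : ℕ) (S : ℕ → ℕ → ℤ) (o d : ℕ) (bb : ℤ) (m : ℕ) (s : AState)
    (Φ : ℕ) : Prop where
  consts : Consts I n s
  r43 : s.R 43 = m
  r47 : s.R 47 = bb
  input : InputMem k n S s.M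
  sorted : SortedValues S n o bb m s.M
  left : Φ = ((sumset S n o (d + 1)).filter (s.R 40 < ·)).card

/-- For fixed `x`, the least sum above `R 40` uses the first element of the sorted list that is
larger than `R 40 - x`. One binary search thus replaces a loop over a list. -/
theorem completeSum_spec (hI : Instance I N k n S V) {o d : ℕ} (hod : o + (d + 1) ≤ k) {bb : ℤ}
    {m : ℕ} (hbb : 0 ≤ bb) (hbN : bb + m ≤ N) (hmn : m ≤ n) {s : AState} {x : ℤ}
    (hc : Consts I n s) (h43 : s.R 43 = m) (h47 : s.R 47 = bb) (h50 : s.R 50 = bb)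
    (h51 : s.R 51 = m) (hB : SortedValues S n o bb m s.M) (h40 : Small I (s.R 40))
    (h44 : Small I (s.R 44)) (hx : s.R (64 + 4 * d) = x) (hxm : x ∈ sumset S n (o + 1) d) :
    WP I N (completeSum d) s fun s' t => t ≤ 15 * Nat.log 2 n + 60 ∧
      (∀ y, Frame 44 58 y y s s') ∧ s'.R 47 = bb ∧ s'.R 50 = bb ∧ s'.R 51 = m ∧
      s'.R 44 ≤ s.R 44 ∧
      (s'.R 44 = s.R 44 ∨ s'.R 44 ∈ sumset S n o (d + 1) ∧ s.R 40 < s'.R 44) ∧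
      ∀ l ∈ values S n o, s.R 40 < l + x → s'.R 44 ≤ l + x := by
  have hn := hI.n_le
  have hxb := hI.abs_sumset_lt (by omega) hxm
  have hsum : ∀ i < m, s.M (bb + i) + x ∈ sumset S n o (d + 1) := by
    intro i hi
    obtain ⟨j, hj, e⟩ := mem_values.1 ((hB.mem_iff _).1 ⟨i, hi, rfl⟩)
    exact mem_sumset_succ.2 ⟨j, hj, x, hxm, by rw [e]⟩
  have hsb := fun i hi => hI.abs_sumset_lt hod (hsum i hi)
  have hval : ∀ i < m, InRange I (s.M (bb + i)) := by
    intro i hi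
    have := hsb i hi
    rw [InRange]; omega
  obtain ⟨h40a, h40b⟩ := h40
  obtain ⟨h44a, h44b⟩ := h44
  apply WP.seq
  apply WP.block_frame 52 53 (by simp [blockOk, Instr.Ok]) (by simp [Instr.Within])
  intro s₁ hs₁ hsM₁ hsf₁
  have e52 : s₁.R 52 = s.R 40 - x := by simp [← hs₁, blockExec, Instr.aexec, hx]
  have r₁ := (hsf₁ 0 0).reg
  apply WP.seq
  refine (binarySearch_spec (b := fun i => s.M (bb + i)) (hc.frame (hsf₁ 0 0) (by norm_num))
    (by rw [r₁ _ (by omega), h50]) (by rw [r₁ _ (by omega), h51]) (by rw [e52, InRange]; omega)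
    (by omega) hbb (by omega) (by rw [hsM₁]; exact fun _ _ => rfl) hval hB.mono).mono ?_
  rintro s₂ t₂ ⟨ht₂, hf₂, p, hpm, h53, hp1, hp2⟩
  rw [e52] at hp1 hp2
  have hsM₂ : s₂.M = s.M := by rw [← hsM₁]; exact funext fun x => hf₂.mem x (by omega)
  have hf₂' : ∀ y, Frame 44 58 y y s s₂ := fun y =>
    ⟨fun r hr => by rw [hf₂.reg _ (by omega), r₁ _ (by omega)], fun x _ => by rw [hsM₂]⟩
  have r₂ : ∀ r, r < 52 ∨ 58 ≤ r → s₂.R r = s.R r :=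
    fun r hr => by rw [hf₂.reg _ (by omega), r₁ _ (by omega)]
  have hlog : Nat.log 2 m ≤ Nat.log 2 n := Nat.log_mono_right hmn
  refine WP.ite (by simp only [Test.Ok, InRange, h53, r₂ 43 (by omega), h43]; omega) ?_ ?_
  · intro hb
    simp only [Test.Holds, h53, r₂ 43 (by omega), h43, Nat.cast_lt] at hb
    have hpos := hp2 p hb le_rfl
    apply WP.seq
    apply WP.block_frame 54 56
    · simp [blockOk, Instr.Ok, Instr.aexec, h53, r₂ 47 (by omega), h47]; omega
    · simp [Instr.Within]
    intro s₃ hs₃ hsM₃ hsf₃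
    have e55 : s₃.R 55 = s.M (bb + p) + x := by
      have h64 : s₂.R (64 + 4 * d) = x := by rw [r₂ _ (by omega), hx]
      have : ¬ 64 + 4 * d = 55 := by omega
      have : ¬ 64 + 4 * d = 54 := by omega
      simp [← hs₃, blockExec, Instr.aexec, r₂ 47 (by omega), *]
    have r₃ : ∀ r, r < 52 ∨ 58 ≤ r → s₃.R r = s.R r :=
      fun r hr => by rw [(hsf₃ 0 0).reg _ (by omega), r₂ _ (by omega)]
    have hb' := hsb p hb
    have hle : ∀ l ∈ values S n o, s.R 40 < l + x → s.M (bb + p) + x ≤ l + x := by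
      intro l hl hlt
      obtain ⟨i, hi, rfl⟩ := (hB.mem_iff l).2 hl
      by_contra hlt'
      have hip : i < p := by
        by_contra h
        have := hB.mono p i (by omega) hi
        omega
      have := hp1 i hip
      omega
    have hf₃ : ∀ y, Frame 44 58 y y s s₃ := fun y =>
      (hf₂' y).trans ((hsf₃ y y).mono (by omega) (by omega) le_rfl le_rfl)
    refine WP.ite ?_ ?_ ?_
    · simp only [Test.Ok, InRange, e55, r₃ 44 (by omega)]; omega
    · intro h
      simp only [Test.Holds, e55, r₃ 44 (by omega)] at h
      apply WP.block_frame 44 45 (by simp [blockOk, Instr.Ok]) (by simp [Instr.Within])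
      intro s₄ hs₄ hsM₄ hsf₄
      have e44 : s₄.R 44 = s.M (bb + p) + x := by simp [← hs₄, blockExec, Instr.aexec, e55]
      have r₄ : ∀ r, r < 44 ∨ 44 < r → s₄.R r = s₃.R r :=
        fun r hr => (hsf₄ 0 0).reg _ (by omega)
      refine ⟨?_, fun y => (hf₃ y).trans ((hsf₄ y y).mono (by omega) (by omega) le_rfl le_rfl),
        by rw [r₄ _ (by omega), r₃ _ (by omega), h47],
        by rw [r₄ _ (by omega), r₃ _ (by omega), h50],
        by rw [r₄ _ (by omega), r₃ _ (by omega), h51], by omega, Or.inr ⟨?_, by omega⟩, ?_⟩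
      · simp only [List.length_cons, List.length_nil]; omega
      · rw [e44]; exact hsum p hb
      · rw [e44]; exact hle
    · intro h
      simp only [Test.Holds, e55, r₃ 44 (by omega), not_lt] at h
      refine WP.skip ⟨?_, hf₃, by rw [r₃ _ (by omega), h47],
        by rw [r₃ _ (by omega), h50], by rw [r₃ _ (by omega), h51], by rw [r₃ _ (by omega)],
        Or.inl (r₃ _ (by omega)), fun l hl hlt => ?_⟩
      · simp only [List.length_cons, List.length_nil]; omega
      · rw [r₃ _ (by omega)]; exact h.trans (hle l hl hlt)
  · intro hb
    simp only [Test.Holds, h53, r₂ 43 (by omega), h43, Nat.cast_lt] at hb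
    refine WP.skip ⟨?_, hf₂', by rw [r₂ _ (by omega), h47],
        by rw [r₂ _ (by omega), h50], by rw [r₂ _ (by omega), h51], by rw [r₂ _ (by omega)],
        Or.inl (r₂ _ (by omega)), fun l hl hlt => ?_⟩
    · simp only [List.length_cons, List.length_nil]; omega
    · obtain ⟨i, hi, rfl⟩ := (hB.mem_iff l).2 hl
      have := hp1 i (by omega)
      omega

/-- Besides the sorted list, this enumeration remembers only the threshold `R 40`; each sum is
searched for from scratch. That costs about `n ^ d` steps for `d + 1` lists but no further memory.
-/
theorem searchStep_spec (hI : Instance I N k n S V) {o d hi : ℕ} (hod : o + (d + 1) ≤ k) {bb : ℤ}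
    {m : ℕ} (hbb : 0 ≤ bb) (hbN : bb + m ≤ N) (hmn : m ≤ n) (hhi : 65 + 4 * d ≤ hi) (y : ℤ)
    {s : AState} {Φ : ℕ} (h : SearchInv I k n S o d bb m s Φ) (h40 : Small I (s.R 40)) :
    WP I N (searchStep o d) s (EnumStep (sumset S n o (d + 1)) (SearchInv I k n S o d bb m) hi y y
      (searchStepTime n d) s Φ) := by
  have hn := hI.n_le
  have hn1 := hI.n_pos
  apply WP.seq
  apply WP.block_frame 42 65 (by simp [blockOk, Instr.Ok]) (by simp [Instr.Within])
  intro s₁ hs₁ hsM₁ hsf₁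
  have e42 : s₁.R 42 = 0 := by simp [← hs₁, blockExec, Instr.aexec]
  have e44 : s₁.R 44 = I := by simp [← hs₁, blockExec, Instr.aexec, h.consts.r5]
  have e64 : s₁.R 64 = 0 := by simp [← hs₁, blockExec, Instr.aexec]
  have e50 : s₁.R 50 = bb := by simp [← hs₁, blockExec, Instr.aexec, h.r47]
  have e51 : s₁.R 51 = m := by simp [← hs₁, blockExec, Instr.aexec, h.r43]
  have e43 : s₁.R 43 = m := by simp [← hs₁, blockExec, Instr.aexec, h.r43]
  have e47 : s₁.R 47 = bb := by simp [← hs₁, blockExec, Instr.aexec, h.r47]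
  have hc₁ := h.consts.frame (hsf₁ 0 0) (by norm_num)
  have e40 : s₁.R 40 = s.R 40 := (hsf₁ 0 0).reg _ (by omega)
  have e41 : s₁.R 41 = s.R 41 := (hsf₁ 0 0).reg _ (by omega)
  apply WP.seq
  -- `Seen x` says that the candidate `R 44` is at most every admissible sum with partial sum `x`;
  -- it persists because the candidate never increases.
  refine (nest_spec (M := s.M) (Seen := fun x s' => ∀ l ∈ values S n o, s.R 40 < l + x →
    s'.R 44 ≤ l + x) (c := 15 * Nat.log 2 n + 60) (e := d) hn d (o + 1) 0 0 (fun s' =>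
      Frame 44 hi y y s₁ s' ∧ s'.R 47 = bb ∧ s'.R 50 = bb ∧ s'.R 51 = m ∧
      (s'.R 44 = I ∨ s'.R 44 ∈ sumset S n o (d + 1) ∧ s.R 40 < s'.R 44)) (by omega)
      (fun r hr j hj => h.input.list _ (by omega) j hj) ?_ ?_ ?_ ?_ s₁
      ⟨.refl _, e47, e50, e51, Or.inl e44⟩ hc₁.r0 hc₁.r3 hsM₁ (by simpa using e64)).mono ?_
  · have h1 : ((o + 1 + d : ℕ) : ℤ) * n ≤ k * n :=
      mul_le_mul_of_nonneg_right (by exact_mod_cast (by omega)) (by positivity)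
    exact h1.trans hI.mem_le.le
  · rintro t t' hf hM ⟨h1, h2, h3, h4, h5⟩
    refine ⟨h1.trans ⟨fun r hr => hf.reg r (by omega), fun x _ => by rw [hM]⟩,
      by rw [hf.reg _ (by omega), h2], by rw [hf.reg _ (by omega), h3],
      by rw [hf.reg _ (by omega), h4], by rw [hf.reg _ (by omega)]; exact h5⟩
  · intro t t' x hf hM ht l hl hlt
    rw [hf.reg _ (by omega)]
    exact ht l hl hlt
  · rintro t x js ⟨h1, h2, h3, h4, h5⟩ h0 h3' hM hx hjs hxs
    have hxm : x ∈ sumset S n (o + 1) d :=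
      mem_sumset.2 ⟨js, fun r hr => (hjs r hr).1, by simpa using hxs⟩
    have h40' : t.R 40 = s.R 40 := by rw [h1.reg _ (by omega), e40]
    have hsm : Small I (t.R 44) := by
      rcases h5 with h5 | h5
      · rw [h5, Small]; omega
      · have := hI.abs_sumset_lt hod h5.1
        rw [Small]; omega
    refine (completeSum_spec hI hod hbb hbN hmn (hc₁.frame h1 (by norm_num))
      (by rw [h1.reg _ (by omega), e43]) h2 h3 h4 (by rw [hM]; exact h.sorted) (by rwa [h40']) hsm
      hx hxm).mono ?_
    rintro t' c ⟨hc, hf, g47, g50, g51, hle, hor, hall⟩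
    rw [h40'] at hor hall
    refine ⟨hc, ⟨h1.trans ((hf y).mono (by omega) (by omega) le_rfl le_rfl), g47, g50, g51, ?_⟩,
      hall, fun z hz l hl hlt => hle.trans (hz l hl hlt), fun r hr => (hf 0).reg r (by omega),
      funext fun x => (hf (x + 1)).mem x (by omega)⟩
    rcases hor with hor | hor
    · rw [hor]; exact h5
    · exact Or.inr hor
  rintro s₂ t₂ ⟨ht₂, ⟨hf₂, g47, g50, g51, hbest⟩, hseen, -, hk⟩
  have hc₂ := hc₁.frame hf₂ (by norm_num)
  have hM₂ : s₂.M = s.M := by rw [hk.mem, hsM₁]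
  have k40 : s₂.R 40 = s.R 40 := by rw [hf₂.reg _ (by omega), e40]
  have k41 : s₂.R 41 = s.R 41 := by rw [hf₂.reg _ (by omega), e41]
  have k42 : s₂.R 42 = 0 := by rw [hf₂.reg _ (by omega), e42]
  have k43 : s₂.R 43 = m := by rw [hf₂.reg _ (by omega), e43]
  have hfr : Frame 40 hi y y s s₂ :=
    ((hsf₁ y y).mono (by omega) (by omega) le_rfl le_rfl).trans
      (hf₂.mono (by omega) le_rfl le_rfl le_rfl)
  have hall : ∀ l ∈ sumset S n o (d + 1), s.R 40 < l → s₂.R 44 ≤ l := by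
    intro l hl hlt
    obtain ⟨j, hj, x, hx, rfl⟩ := mem_sumset_succ.1 hl
    have := hseen x hx (S o j) (mem_values.2 ⟨j, hj, rfl⟩)
    rw [zero_add] at this
    exact this hlt
  have hsm : InRange I (s₂.R 44) := by
    rcases hbest with h5 | h5
    · rw [h5, InRange]; omega
    · have := hI.abs_sumset_lt hod h5.1
      rw [InRange]; omega
  refine WP.ite (by exact ⟨hsm, by rw [hc₂.r5, InRange]; omega⟩) ?_ ?_
  · intro hb
    simp only [Test.Holds, hc₂.r5] at hb
    rcases hbest with hbest | ⟨hmem, hgt⟩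
    · omega
    apply WP.block_frame 40 43 (by simp [blockOk, Instr.Ok]) (by simp [Instr.Within])
    intro s₃ hs₃ hsM₃ hsf₃
    have l40 : s₃.R 40 = s₂.R 44 := by simp [← hs₃, blockExec, Instr.aexec]
    have l41 : s₃.R 41 = s.R 41 := by simp [← hs₃, blockExec, Instr.aexec, k41]
    have l42 : s₃.R 42 = 1 := by simp [← hs₃, blockExec, Instr.aexec]
    have r₃ := (hsf₃ 0 0).reg
    refine ⟨?_, hfr.trans ((hsf₃ y y).mono le_rfl (by omega) le_rfl le_rfl), _,
      ⟨hc₂.frame (hsf₃ 0 0) (by norm_num), by rw [r₃ _ (by omega), k43],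
        by rw [r₃ _ (by omega), g47], by rw [hsM₃, hM₂]; exact h.input,
        by rw [hsM₃, hM₂]; exact h.sorted, rfl⟩, Or.inr (Or.inl ⟨l42, by omega, by rwa [l40], ?_,
          l41, ?_⟩)⟩
    · simp only [searchStepTime, List.length_cons, List.length_nil]; omega
    · intro l hl hlt
      by_contra hlt'
      have := hall l hl (by omega)
      omega
    · rw [h.left, l40]
      -- The sum that becomes the new threshold was above the old one and is not above itself.
      refine Finset.card_lt_card ⟨fun l hl => ?_, fun hsub => ?_⟩
      · rw [Finset.mem_filter] at hl ⊢
        exact ⟨hl.1, hgt.trans hl.2⟩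
      · have := hsub (Finset.mem_filter.2 ⟨hmem, hgt⟩)
        exact lt_irrefl _ (Finset.mem_filter.1 this).2
  · intro hb
    simp only [Test.Holds, hc₂.r5, not_lt] at hb
    apply WP.block_frame 41 42 (by simp [blockOk, Instr.Ok]) (by simp [Instr.Within])
    intro s₃ hs₃ hsM₃ hsf₃
    have r₃ := (hsf₃ 0 0).reg
    have l40 : s₃.R 40 = s.R 40 := by rw [r₃ _ (by omega), k40]
    refine ⟨?_, hfr.trans ((hsf₃ y y).mono (by omega) (by omega) le_rfl le_rfl), Φ,
      ⟨hc₂.frame (hsf₃ 0 0) (by norm_num), by rw [r₃ _ (by omega), k43],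
        by rw [r₃ _ (by omega), g47], by rw [hsM₃, hM₂]; exact h.input,
        by rw [hsM₃, hM₂]; exact h.sorted, by rw [l40]; exact h.left⟩, Or.inr (Or.inr ⟨?_, l40, ?_,
          ?_⟩)⟩
    · simp only [searchStepTime, List.length_cons, List.length_nil]; omega
    · rw [r₃ _ (by omega), k42]
    · simp [← hs₃, blockExec, Instr.aexec]
    · intro l hl
      by_contra hlt
      have h1 := hall l hl (by omega)
      have h2 := hI.abs_sumset_lt hod hl
      omega

end KSum

namespace KSum

variable {I N : ℤ}

/-! ### Levels of the enumeration -/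

/-- The lists are divided into groups. A group is processed in one of these ways: element by element
(one list), by merging (two lists), or by repeated search (`d + 1` lists). -/
inductive Level
  | free
  | merge
  | search (d : ℕ)

/-- The number of lists in a group. -/
def Level.size : Level → ℕ
  | free => 1
  | merge => 2
  | search d => d + 1

/-- The number of lists in several groups. -/
def numLists : List Level → ℕ
  | [] => 0
  | a :: L => numLists L + a.size

/-- The first register of a level. Relative to it, the registers are: `0`, `1` the bounds of the
interval, `2` the sum, `3` the summand from the group, `4` the last enumerated summand, `5` whether
the enumeration is complete, `6` the length of the chunk, `7` the length of the sorted list,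
`8`, `9` positions in the chunk, `10` the address of the chunk. -/
def regBase (k d : ℕ) : ℕ := 72 + 4 * k + 16 * d

/-- The first memory cell of a level. -/
def memBase (k n d : ℕ) : ℤ := ((k + 5 * d : ℕ) : ℤ) * n + 1

theorem memBase_succ (k n d : ℕ) : memBase k n (d + 1) = memBase k n d + 5 * n := by
  simp only [memBase]; push_cast; ring

theorem memBase_mono (k n : ℕ) {d d' : ℕ} (h : d ≤ d') : memBase k n d ≤ memBase k n d' := by
  obtain ⟨e, rfl⟩ := Nat.exists_eq_add_of_le h
  have : (0 : ℤ) ≤ 5 * e * n := by positivity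
  simp only [memBase]; push_cast; linarith

/-- The constants are in their registers, and the input is in memory. -/
structure Ctx (I : ℤ) (k n : ℕ) (S : ℕ → ℕ → ℤ) (s : AState) : Prop where
  consts : Consts I n s
  input : InputMem k n S s.M

/-- The sums of elements from all lists of the groups. -/
def sums (S : ℕ → ℕ → ℤ) (n : ℕ) : List Level → Finset ℤ
  | [] => {0}
  | a :: L => Finset.image₂ (· + ·) (sumset S n (numLists L) a.size) (sums S n L)

/-- The registers of the levels hold a decomposition of the sum. -/
def ValidRegs (S : ℕ → ℕ → ℤ) (k n : ℕ) : List Level → AState → Prop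
  | [], s => s.R (regBase k 0 + 2) = 0
  | a :: L, s => ValidRegs S k n L s ∧
      s.R (regBase k (L.length + 1) + 3) ∈ sumset S n (numLists L) a.size ∧
      s.R (regBase k (L.length + 1) + 2) =
        s.R (regBase k (L.length + 1) + 3) + s.R (regBase k L.length + 2)

/-- The sum of the values of a function over all sums that the enumeration may visit. -/
def weight (S : ℕ → ℕ → ℤ) (n : ℕ) : List Level → (ℤ → ℕ) → ℕ
  | [], φ => φ 0
  | .free :: L, φ => ∑ j ∈ Finset.range n, weight S n L fun r => φ (S (numLists L) j + r)
  | a :: L, φ => ∑ l ∈ sumset S n (numLists L) a.size, weight S n L fun r => φ (l + r)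

variable {k n : ℕ} {S : ℕ → ℕ → ℤ} {V : ℤ}

theorem mem_sums_cons {a : Level} {L : List Level} {x : ℤ} : x ∈ sums S n (a :: L) ↔
    ∃ l ∈ sumset S n (numLists L) a.size, ∃ r ∈ sums S n L, l + r = x := by
  simp [sums, Finset.mem_image₂]

theorem ValidRegs.mem_sums {L : List Level} {s : AState} (h : ValidRegs S k n L s) :
    s.R (regBase k L.length + 2) ∈ sums S n L := by
  induction L with
  | nil => simpa [sums, ValidRegs] using h
  | cons a L ih => exact mem_sums_cons.2 ⟨_, h.2.1, _, ih h.1, h.2.2.symm⟩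

theorem ValidRegs.congr {L : List Level} {s s' : AState} (h : ValidRegs S k n L s)
    (hr : ∀ r, regBase k 0 ≤ r → r < regBase k L.length + 4 → s'.R r = s.R r) :
    ValidRegs S k n L s' := by
  induction L with
  | nil =>
    rw [ValidRegs] at h ⊢
    rw [hr _ (by omega) (by simp), h]
  | cons a L ih =>
    simp only [List.length_cons, regBase] at hr
    simp only [ValidRegs, regBase] at h ⊢
    refine ⟨ih h.1 fun r h1 h2 => ?_, ?_, ?_⟩
    · simp only [regBase] at h1 h2
      exact hr r h1 (by omega)
    · rw [hr _ (by omega) (by omega)]; exact h.2.1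
    · rw [hr _ (by omega) (by omega), hr _ (by omega) (by omega), hr _ (by omega) (by omega)]
      exact h.2.2

theorem abs_sums_le (hI : Instance I N k n S V) {L : List Level} (hL : numLists L ≤ k) {x : ℤ}
    (hx : x ∈ sums S n L) : |x| ≤ numLists L * V := by
  induction L generalizing x with
  | nil => simp [sums] at hx; simp [hx, numLists]
  | cons a L ih =>
    obtain ⟨l, hl, r, hr, rfl⟩ := mem_sums_cons.1 hx
    rw [numLists] at hL ⊢
    have h1 := abs_sumset_le hI.bound (by omega) hl
    have h2 := ih (by omega) hr
    have h3 := abs_add_le l r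
    push_cast
    linarith

theorem weight_mono (L : List Level) {φ ψ : ℤ → ℕ} (h : ∀ x, φ x ≤ ψ x) :
    weight S n L φ ≤ weight S n L ψ := by
  induction L generalizing φ ψ with
  | nil => exact h 0
  | cons a L ih =>
    cases a <;> exact Finset.sum_le_sum fun _ _ => ih fun _ => h _

theorem weight_add (L : List Level) (φ ψ : ℤ → ℕ) :
    weight S n L (fun x => φ x + ψ x) = weight S n L φ + weight S n L ψ := by
  induction L generalizing φ ψ with
  | nil => rfl
  | cons a L ih =>
    cases a <;> simp only [weight] <;> rw [← Finset.sum_add_distrib] <;>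
      exact Finset.sum_congr rfl fun _ _ => ih _ _

theorem weight_const_le (L : List Level) (c : ℕ) :
    weight S n L (fun _ => c) ≤ c * n ^ numLists L := by
  induction L with
  | nil => simp [weight, numLists]
  | cons a L ih =>
    have key : ∀ (m : ℕ), m ≤ n ^ a.size → m * (c * n ^ numLists L) ≤ c * n ^ numLists (a :: L) := by
      intro m hm
      rw [numLists, pow_add]
      calc m * (c * n ^ numLists L) ≤ n ^ a.size * (c * n ^ numLists L) := Nat.mul_le_mul_right _ hm
        _ = c * (n ^ numLists L * n ^ a.size) := by ring
    cases a <;> simp only [weight]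
    · refine (Finset.sum_le_card_nsmul _ _ _ fun _ _ => ih).trans ?_
      rw [smul_eq_mul]
      exact key _ (by simp [Level.size])
    all_goals
      refine (Finset.sum_le_card_nsmul _ _ _ fun _ _ => ih).trans ?_
      rw [smul_eq_mul]
      exact key _ (card_sumset_le _ _)

theorem weight_zero (L : List Level) : weight S n L (fun _ => 0) = 0 := by
  have := weight_const_le (S := S) (n := n) L 0
  omega

theorem weight_sum (L : List Level) {α : Type*} (A : Finset α) (φ : α → ℤ → ℕ) :
    weight S n L (fun x => ∑ l ∈ A, φ l x) = ∑ l ∈ A, weight S n L (φ l) := by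
  classical
  induction A using Finset.induction_on with
  | empty => simpa using weight_zero L
  | insert a A ha ih => simp only [Finset.sum_insert ha]; rw [weight_add, ih]

/-- The property does not depend on the registers and memory cells of the first `d` levels. -/
def StableAbove (k n d : ℕ) (P : AState → Prop) : Prop :=
  ∀ s s' : AState, (∀ r, regBase k (d + 1) ≤ r → s'.R r = s.R r) →
    (∀ x, memBase k n d ≤ x → s'.M x = s.M x) → P s → P s'

/-- The constants, the input, and the registers and memory cells of the first `d` levels are not
changed. -/
structure KeepsBelow (k n d : ℕ) (s s' : AState) : Prop where
  reg : ∀ r, r < 7 ∨ regBase k 0 ≤ r ∧ r < regBase k (d + 1) → s'.R r = s.R r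
  mem : ∀ x, x < memBase k n d → s'.M x = s.M x

theorem Ctx.congr {s s' : AState} (h : Ctx I k n S s) (hr : ∀ r < 7, s'.R r = s.R r)
    (hm : ∀ x < memBase k n 0, s'.M x = s.M x) : Ctx I k n S s' := by
  refine ⟨?_, fun i hi j hj => ?_, ?_⟩
  · constructor <;> rw [hr _ (by omega)]
    exacts [h.consts.r0, h.consts.r2, h.consts.r3, h.consts.r4, h.consts.r5, h.consts.r6]
  · rw [hm, h.input.list i hi j hj]
    have : ((i : ℤ) + 1) * n ≤ k * n :=
      mul_le_mul_of_nonneg_right (by exact_mod_cast hi) (by positivity)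
    simp only [memBase]
    push_cast
    linarith [(by exact_mod_cast hj : (j : ℤ) < n)]
  · rw [hm, h.input.zero]
    simp [memBase]

theorem Ctx.keeps {d : ℕ} {s s' : AState} (h : Ctx I k n S s) (hk : KeepsBelow k n d s s') :
    Ctx I k n S s' :=
  h.congr (fun r hr => hk.reg r (Or.inl hr))
    fun x hx => hk.mem x (hx.trans_le (memBase_mono k n (Nat.zero_le d)))

/-- What it means that `enum p` executes `p` for all sums of elements of the lists of the groups `L`
in the interval that is given by the first two registers of the level. -/
def Enumerates (I N : ℤ) (k n : ℕ) (S : ℕ → ℕ → ℤ) (V : ℤ) (L : List Level) (enum : Prog → Prog)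
    (A c : ℕ) : Prop :=
  ∀ (p : Prog) (Inv : AState → Prop) (Seen : ℤ → AState → Prop) (β : ℤ → ℕ) (u v : ℤ),
    |u| + numLists L * V < I → |v| + numLists L * V < I → StableAbove k n L.length Inv →
    (∀ x, StableAbove k n L.length (Seen x)) →
    (∀ s x, Ctx I k n S s → Inv s → ValidRegs S k n L s → s.R (regBase k L.length + 2) = x →
      u ≤ x → x ≤ v → WP I N p s fun s' t => t ≤ β x ∧ Inv s' ∧ Seen x s' ∧
        (∀ y, Seen y s → Seen y s') ∧ KeepsBelow k n L.length s s') →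
    ∀ s, Ctx I k n S s → Inv s → s.R (regBase k L.length) = u → s.R (regBase k L.length + 1) = v →
    WP I N (enum p) s fun s' t =>
      t ≤ A + weight S n L (fun x => if u ≤ x ∧ x ≤ v then c + β x else 0) ∧ Ctx I k n S s' ∧
      Inv s' ∧ (∀ x ∈ sums S n L, u ≤ x → x ≤ v → Seen x s') ∧ (∀ y, Seen y s → Seen y s')

/-- The enumeration of the empty sum. -/
def enumEmpty (k : ℕ) (p : Prog) : Prog :=
  .seq (block [.const (regBase k 0 + 2) 0])
    (.ite (.slt 2 (regBase k 0)) .skip (.ite (.slt (regBase k 0 + 1) 2) .skip p))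

theorem enumEmpty_spec (hI : Instance I N k n S V) :
    Enumerates I N k n S V [] (enumEmpty k) 10 0 := by
  intro p Inv Seen β u v hu hv hInv hSeen hp s hs hi hsu hsv
  have h0 := hI.n_le
  simp only [List.length_nil, numLists, Nat.cast_zero, zero_mul, add_zero] at *
  have hu' := abs_lt.1 hu
  have hv' := abs_lt.1 hv
  apply WP.seq
  apply WP.block_frame (regBase k 0 + 2) (regBase k 0 + 3) (by simp [blockOk, Instr.Ok])
    (by simp [Instr.Within])
  intro s₁ hs₁ hsM hsf
  have hreg := (hsf 0 0).reg
  have e2 : s₁.R 2 = 0 := by rw [hreg _ (by simp only [regBase]; omega), hs.consts.r2]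
  have eu : s₁.R (regBase k 0) = u := by rw [hreg _ (by omega), hsu]
  have ev : s₁.R (regBase k 0 + 1) = v := by rw [hreg _ (by omega), hsv]
  have ex : s₁.R (regBase k 0 + 2) = 0 := by simp [← hs₁, blockExec, Instr.aexec]
  have hst : ∀ P, StableAbove k n 0 P → P s → P s₁ := fun P hP h =>
    hP _ _ (fun r hr => hreg _ (by simp only [regBase] at *; omega)) (fun x _ => by rw [hsM]) h
  have hs₁' : Ctx I k n S s₁ := hs.congr (fun r hr => hreg _ (by simp only [regBase]; omega))
    (fun x _ => by rw [hsM])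
  simp only [weight]
  refine WP.ite (by simp only [Test.Ok, e2, eu, InRange]; omega) ?_ ?_
  · intro hb
    simp only [Test.Holds, e2, eu] at hb
    refine WP.skip ⟨by simp; omega, hs₁', hst _ hInv hi, ?_, fun y hy => hst _ (hSeen y) hy⟩
    intro x hx h1 h2
    simp [sums] at hx; omega
  · intro hb
    simp only [Test.Holds, e2, eu, not_lt] at hb
    refine WP.ite (by simp only [Test.Ok, e2, ev, InRange]; omega) ?_ ?_
    · intro hb'
      simp only [Test.Holds, e2, ev] at hb'
      refine WP.skip ⟨by simp; omega, hs₁', hst _ hInv hi, ?_, fun y hy => hst _ (hSeen y) hy⟩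
      intro x hx h1 h2
      simp [sums] at hx; omega
    · intro hb'
      simp only [Test.Holds, e2, ev, not_lt] at hb'
      refine (hp s₁ 0 hs₁' (hst _ hInv hi) ex ex hb hb').mono ?_
      rintro s₂ t ⟨h1, h2, h3, h4, h5⟩
      refine ⟨?_, hs₁'.keeps h5, h2, fun x hx _ _ => ?_, fun y hy => h4 y (hst _ (hSeen y) hy)⟩
      · simp [hb, hb']; omega
      · simp only [sums, Finset.mem_singleton] at hx; subst hx; exact h3

/-- The enumeration that adds the elements of list `o` one by one. -/
def enumFree (k o d : ℕ) (inner : Prog → Prog) (p : Prog) : Prog :=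
  forLoop (regBase k (d + 1) + 4)
    (.seq (block [.const 20 o, .bin .mul 20 20 0, .bin .add 20 20 (regBase k (d + 1) + 4),
        .load (regBase k (d + 1) + 3) 20,
        .bin .sub (regBase k d) (regBase k (d + 1)) (regBase k (d + 1) + 3),
        .bin .sub (regBase k d + 1) (regBase k (d + 1) + 1) (regBase k (d + 1) + 3)])
      (inner (.seq (block [.bin .add (regBase k (d + 1) + 2) (regBase k (d + 1) + 3)
        (regBase k d + 2)]) p)))

/-- Fixing the element `S o j` translates the interval by `S o j`. Equal elements of the list are
not identified here, which is why `weight` runs over positions for a `free` group and over values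
for the others. -/
theorem enumFree_spec (hI : Instance I N k n S V) {L : List Level} {inner : Prog → Prog} {A c : ℕ}
    (hL : numLists (.free :: L) ≤ k) (h : Enumerates I N k n S V L inner A c) :
    Enumerates I N k n S V (.free :: L) (enumFree k (numLists L) L.length inner)
      (n * (A + 19) + 5) (c + 4) := by
  intro p Inv Seen β u v hu hv hInv hSeen hp s hs hi hsu hsv
  have h0 := hI.n_le
  simp only [numLists, Level.size] at hL hu hv
  simp only [List.length_cons] at hInv hSeen hp hsu hsv
  set o := numLists L with ho
  set d := L.length with hd
  obtain ⟨b, hb⟩ : ∃ b, b = regBase k d := ⟨_, rfl⟩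
  have hb' : regBase k (d + 1) = b + 16 := by simp only [hb, regBase]; ring
  have hb0 : 72 ≤ b := by rw [hb, regBase]; omega
  have hb1 : regBase k 0 ≤ b := by rw [hb]; simp only [regBase]; omega
  have hb2 : regBase k (d + 1 + 1) = b + 32 := by simp only [hb, regBase]; ring
  have hmb : memBase k n 0 ≤ memBase k n (d + 1) := memBase_mono k n (by omega)
  have hmb' : memBase k n d ≤ memBase k n (d + 1) := memBase_mono k n (by omega)
  rw [hb'] at hsu hsv hp
  simp only [enumFree, hb', ← hb]
  push_cast at hu hv
  have hS : ∀ j < n, |S o j| ≤ V := hI.bound o (by omega)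
  have hno : (0 : ℤ) ≤ (o : ℤ) * n := by positivity
  have hno' : ((o : ℤ) + 1) * n ≤ k * n :=
    mul_le_mul_of_nonneg_right (by exact_mod_cast hL) (by positivity)
  have hkN := hI.mem_le
  have stable : ∀ {s s' : AState} {lo hi : ℕ} {y : ℤ} (P : AState → Prop),
      StableAbove k n (d + 1) P → Frame lo hi y y s s' → hi ≤ b + 32 → P s → P s' := by
    intro s s' lo hi y P hP hf hhi h
    exact hP _ _ (fun r hr => hf.reg r (by omega)) (fun x _ => hf.mem x (by omega)) h
  refine WP.forLoop h0 (fun i s' => Ctx I k n S s' ∧ Inv s' ∧ s'.R (b + 16) = u ∧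
    s'.R (b + 17) = v ∧ (∀ j < i, ∀ r ∈ sums S n L, u ≤ S o j + r → S o j + r ≤ v →
      Seen (S o j + r) s') ∧ ∀ y, Seen y s → Seen y s')
    (fun i => A + weight S n L (fun r => if u ≤ S o i + r ∧ S o i + r ≤ v then c + 4 + β (S o i + r)
      else 0) + 14) (by omega) (by omega) hs.consts.r0 hs.consts.r3 ?_ ?_ ?_
  · have hf : Frame (b + 20) (b + 21) 0 0 s (s.set (b + 16 + 4) 0) := .set _ (by omega)
    exact ⟨hs.congr (fun r hr => hf.reg r (by omega)) (fun _ _ => rfl),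
      stable _ hInv hf (by omega) hi, by rw [hf.reg _ (by omega), hsu],
      by rw [hf.reg _ (by omega), hsv], by simp, fun y hy => stable _ (hSeen y) hf (by omega) hy⟩
  · rintro i hin s₁ ⟨hc₁, hi₁, hu₁, hv₁, hseen₁, hmono₁⟩ hri h0' h3'
    have hSi := hS i hin
    have hMi := hc₁.input.list o (by omega) i hin
    have hu2 := abs_sub u (S o i)
    have hv2 := abs_sub v (S o i)
    apply WP.seq
    have c1 : ¬ b + 16 = b + 16 + 3 := by omega
    apply WP.block
    · simp [blockOk, Instr.Ok, Instr.aexec, hri, h0', show ¬ 0 = 20 by omega,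
        show ¬ b + 16 + 4 = 20 by omega]
      constructor
      · omega
      · linarith
    obtain ⟨s₂, hs₂⟩ : ∃ s₂, s₂ = blockExec I [.const 20 o, .bin .mul 20 20 0,
      .bin .add 20 20 (b + 16 + 4), .load (b + 16 + 3) 20, .bin .sub b (b + 16) (b + 16 + 3),
      .bin .sub (b + 1) (b + 16 + 1) (b + 16 + 3)] s₁ := ⟨_, rfl⟩
    rw [← hs₂]
    have e : ∀ r, s₂.R r = if r = b + 1 then v - S o i else if r = b then u - S o i else
        if r = b + 19 then S o i else if r = 20 then o * n + i else s₁.R r := by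
      intro r
      have q1 : s₁.R (b + 16 + 4) = i := hri
      have q2 : s₁.R (b + 16 + 1) = v := hv₁
      simp [hs₂, blockExec, Instr.aexec, q1, q2, h0', hu₁, show ¬ b + 16 = 20 by omega,
        show ¬ b + 16 + 1 = 20 by omega, add_assoc]
      split_ifs <;> first | rfl | omega
    have eM : s₂.M = s₁.M := by simp [hs₂, blockExec, Instr.aexec]
    have e0 : ∀ r, r ≠ b + 1 → r ≠ b → r ≠ b + 19 → r ≠ 20 → s₂.R r = s₁.R r := by
      intro r r1 r2 r3 r4
      rw [e, if_neg r1, if_neg r2, if_neg r3, if_neg r4]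
    have stable₂ : ∀ P, StableAbove k n (d + 1) P → P s₁ → P s₂ := by
      intro P hP h
      exact hP _ _ (fun r hr => e0 r (by omega) (by omega) (by omega) (by omega))
        (fun x _ => by rw [eM]) h
    have hc₂ : Ctx I k n S s₂ := hc₁.congr (fun r hr => e0 r (by omega) (by omega) (by omega)
      (by omega)) (fun x _ => by rw [eM])
    have eu : s₂.R b = u - S o i := by rw [e, if_neg (by omega), if_pos rfl]
    have ev : s₂.R (b + 1) = v - S o i := by rw [e, if_pos rfl]
    refine (h (.seq (block [.bin .add (b + 16 + 2) (b + 16 + 3) (b + 2)]) p)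
      (fun s' => Inv s' ∧ s'.R (b + 16) = u ∧ s'.R (b + 17) = v ∧ s'.R (b + 19) = S o i ∧
        s'.R (b + 20) = i) (fun r s' => Seen (S o i + r) s') (fun r => β (S o i + r) + 4)
      (u - S o i) (v - S o i) (by linarith) (by linarith) ?_ ?_ ?_ s₂ hc₂
      ⟨stable₂ _ hInv hi₁, by rw [e0 _ (by omega) (by omega) (by omega) (by omega), hu₁],
        by rw [e0 _ (by omega) (by omega) (by omega) (by omega), hv₁],
        by rw [e, if_neg (by omega), if_neg (by omega), if_pos rfl],
        by rw [e0 _ (by omega) (by omega) (by omega) (by omega)]; exact hri⟩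
      (by rw [← hd, ← hb]; exact eu) (by rw [← hd, ← hb]; exact ev)).mono ?_
    · rintro t t' hr hM ⟨g1, g2, g3, g4, g5⟩
      rw [← hd, hb'] at hr
      exact ⟨hInv _ _ (fun r hr' => hr r (by omega)) (fun x hx => hM x (by rw [← hd]; omega)) g1,
        by rw [hr _ (by omega), g2], by rw [hr _ (by omega), g3], by rw [hr _ (by omega), g4],
        by rw [hr _ (by omega), g5]⟩
    · rintro r t t' hr hM g
      rw [← hd, hb'] at hr
      exact hSeen _ _ _ (fun r hr' => hr r (by omega)) (fun x hx => hM x (by rw [← hd]; omega)) g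
    · rintro t r hct ⟨g1, g2, g3, g4, g5⟩ hval hr hur hvr
      rw [← hd, ← hb] at hr
      apply WP.seq
      apply WP.block_frame (b + 18) (b + 19) (by simp [blockOk, Instr.Ok]) (by simp [Instr.Within])
      intro t₁ ht₁ hM₁ hf₁
      have hreg := (hf₁ 0 0).reg
      have ex : t₁.R (b + 18) = S o i + r := by
        have q : t.R (b + 16 + 3) = S o i := g4
        simp [← ht₁, blockExec, Instr.aexec, q, hr]
      have st : ∀ P, StableAbove k n (d + 1) P → P t → P t₁ := fun P hP h =>
        stable P hP (hf₁ 0 0) (by omega) h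
      have hct₁ : Ctx I k n S t₁ := hct.congr (fun r hr => hreg r (by omega))
        (fun x _ => by rw [hM₁])
      have el : t₁.R (b + 19) = S o i := by rw [hreg _ (by omega), g4]
      refine (hp t₁ (S o i + r) hct₁ (st _ hInv g1) ⟨hval.congr fun r _ hr' => hreg r ?_, ?_, ?_⟩ ex
        (by linarith) (by linarith)).mono ?_
      · rw [← hd, ← hb] at hr'; omega
      · rw [← hd, hb']
        show t₁.R (b + 19) ∈ _
        rw [el, Level.size, mem_sumset_succ]
        exact ⟨i, hin, 0, by simp [sumset], by rw [add_zero]⟩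
      · rw [← hd, hb', ← hb]
        show t₁.R (b + 18) = t₁.R (b + 19) + t₁.R (b + 2)
        rw [ex, el, hreg _ (by omega), hr]
      · rintro t₂ m ⟨q1, q2, q3, q4, q5⟩
        have hk := q5.reg
        rw [hb2] at hk
        refine ⟨by simp; omega, ⟨q2, ?_, ?_, ?_, ?_⟩, q3, fun y hy => q4 _ (st _ (hSeen _) hy), ?_, ?_⟩
        · rw [hk _ (by omega), hreg _ (by omega), g2]
        · rw [hk _ (by omega), hreg _ (by omega), g3]
        · rw [hk _ (by omega), hreg _ (by omega), g4]
        · rw [hk _ (by omega), hreg _ (by omega), g5]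
        · intro r hr'
          rw [← hd, hb'] at hr'
          rw [hk _ (by omega), hreg _ (by omega)]
        · intro x hx
          rw [← hd] at hx
          rw [q5.mem x (by omega), hM₁]
    · rintro s₃ t ⟨ht, hc₃, ⟨g1, g2, g3, g4, g5⟩, hseen, hmono⟩
      have hf : Frame (b + 20) (b + 21) 0 0 s₃ (s₃.set (b + 16 + 4) (i + 1)) := .set _ (by omega)
      refine ⟨?_, g5, hc₃.consts.r0, hc₃.consts.r3, hc₃.congr (fun r hr => hf.reg r (by omega))
        (fun _ _ => rfl), stable _ hInv hf (by omega) g1, by rw [hf.reg _ (by omega), g2],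
        by rw [hf.reg _ (by omega), g3], fun j hj r hr h1 h2 => ?_, fun y hy => ?_⟩
      · have hw : weight S n L (fun x => if u - S o i ≤ x ∧ x ≤ v - S o i then
            c + (β (S o i + x) + 4) else 0) = weight S n L (fun r => if u ≤ S o i + r ∧
            S o i + r ≤ v then c + 4 + β (S o i + r) else 0) := by
          congr 1; funext x
          by_cases hx : u ≤ S o i + x ∧ S o i + x ≤ v
          · rw [if_pos hx, if_pos ⟨by linarith [hx.1], by linarith [hx.2]⟩]; ring
          · rw [if_neg hx, if_neg fun h => hx ⟨by linarith [h.1], by linarith [h.2]⟩]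
        rw [hw] at ht
        simp only [List.length_cons, List.length_nil]
        omega
      · refine stable _ (hSeen _) hf (by omega) ?_
        rcases Nat.lt_succ_iff_lt_or_eq.1 hj with hj | rfl
        · have := stable₂ _ (hSeen _) (hseen₁ j hj r hr h1 h2)
          -- The inner enumeration preserves `Seen` in the form `Seen (S o i + ·)`, and every value
          -- can be written in this form.
          have e' : S o j + r = S o i + (S o j + r - S o i) := by ring
          rw [e'] at this ⊢
          exact hmono _ this
        · exact hseen r hr (by linarith) (by linarith)
      · refine stable _ (hSeen _) hf (by omega) ?_
        have := stable₂ _ (hSeen _) (hmono₁ y hy)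
        have e' : y = S o i + (y - S o i) := by ring
        rw [e'] at this ⊢
        exact hmono _ this
  · rintro s' t ⟨hc', hi', _, _, hseen, hmono⟩ _ _ _ ht
    refine ⟨?_, hc', hi', fun x hx h1 h2 => ?_, hmono⟩
    · simp only [Finset.sum_add_distrib, Finset.sum_const, Finset.card_range, smul_eq_mul] at ht
      simp only [weight]
      rw [← ho]
      nlinarith
    · obtain ⟨l, hl, r, hr, rfl⟩ := mem_sums_cons.1 hx
      rw [Level.size, mem_sumset_succ] at hl
      obtain ⟨j, hj, z, hz, rfl⟩ := hl
      obtain rfl : z = 0 := by simpa [sumset] using hz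
      rw [add_zero] at h1 h2 ⊢
      exact hseen j hj r hr h1 h2

end KSum

/-! ### Completing a partial sum from a chunk. -/

namespace KSum

variable {I N : ℤ}

/-- Find all elements of the chunk whose sum with `R (regBase k d + 2)` belongs to the interval, and
execute `p` for each of them. -/
def scanChunk (k d : ℕ) (p : Prog) : Prog :=
  .seq (block [.move 50 (regBase k (d + 1) + 10), .move 51 (regBase k (d + 1) + 6),
      .bin .sub 52 (regBase k (d + 1)) (regBase k d + 2), .bin .sub 52 52 3])
    (.seq binarySearch
    (.seq (block [.move (regBase k (d + 1) + 8) 53, .move 50 (regBase k (d + 1) + 10),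
      .move 51 (regBase k (d + 1) + 6), .bin .sub 52 (regBase k (d + 1) + 1) (regBase k d + 2)])
    (.seq binarySearch
    (.seq (block [.move (regBase k (d + 1) + 9) 53])
    (.loop (.slt (regBase k (d + 1) + 8) (regBase k (d + 1) + 9))
      (.seq (block [.bin .add 20 (regBase k (d + 1) + 10) (regBase k (d + 1) + 8),
        .load (regBase k (d + 1) + 3) 20,
        .bin .add (regBase k (d + 1) + 2) (regBase k (d + 1) + 3) (regBase k d + 2)])
      (.seq p (block [.bin .add (regBase k (d + 1) + 8) (regBase k (d + 1) + 8) 3]))))))))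

/-- A bound on the number of steps of `scanChunk` without the executions of `p`. -/
def scanTime (n : ℕ) : ℕ := 30 * Nat.log 2 n + 90

/-- The data that `scanChunk` does not change. -/
structure ScanKeeps (k n d : ℕ) (s s' : AState) : Prop where
  reg : ∀ r, r < 7 ∨ (regBase k 0 ≤ r ∧ r < regBase k (d + 1) + 2) ∨
    (regBase k (d + 1) + 4 ≤ r ∧ r < regBase k (d + 1) + 8) ∨ r = regBase k (d + 1) + 10 →
    s'.R r = s.R r
  mem : ∀ x, x < memBase k n (d + 1) → s'.M x = s.M x

variable {k n : ℕ} {S : ℕ → ℕ → ℤ} {V : ℤ}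

/-- The elements of a sorted chunk that complete `r` to the interval occupy consecutive positions,
delimited by two binary searches. Without hits the time is logarithmic, and every hit accounts for
its own execution of `p`. -/
theorem scanChunk_spec (hI : Instance I N k n S V) {a : Level} {L : List Level}
    (hL : numLists (a :: L) ≤ k) {p : Prog} {Inv : AState → Prop}
    {Seen : ℤ → AState → Prop} {β : ℤ → ℕ} {u v : ℤ}
    (hu : |u| + numLists (a :: L) * V < I) (hv : |v| + numLists (a :: L) * V < I)
    (hInv : StableAbove k n (L.length + 1) Inv)
    (hSeen : ∀ x, StableAbove k n (L.length + 1) (Seen x))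
    (hp : ∀ s x, Ctx I k n S s → Inv s → ValidRegs S k n (a :: L) s →
      s.R (regBase k (L.length + 1) + 2) = x →
      u ≤ x → x ≤ v → WP I N p s fun s' t => t ≤ β x ∧ Inv s' ∧ Seen x s' ∧
        (∀ y, Seen y s → Seen y s') ∧ KeepsBelow k n (L.length + 1) s s')
    {cnt : ℕ} {thr thr' r : ℤ} (hcnt : cnt ≤ n) (hN : memBase k n (L.length + 1) ≤ N) {s : AState}
    (hs : Ctx I k n S s) (hi : Inv s) (hval : ValidRegs S k n L s)
    (hr : s.R (regBase k L.length + 2) = r)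
    (hsu : s.R (regBase k (L.length + 1)) = u) (hsv : s.R (regBase k (L.length + 1) + 1) = v)
    (hs6 : s.R (regBase k (L.length + 1) + 6) = cnt)
    (hs10 : s.R (regBase k (L.length + 1) + 10) = memBase k n L.length)
    (hch : ListsChunk (sumset S n (numLists L) a.size) (memBase k n L.length) cnt thr thr' s.M) :
    WP I N (scanChunk k L.length p) s fun s' t =>
      t ≤ scanTime n + ∑ l ∈ (sumset S n (numLists L) a.size).filter (fun l => thr < l ∧ l ≤ thr'),
        (if u ≤ l + r ∧ l + r ≤ v then 13 + β (l + r) else 0) ∧ Inv s' ∧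
      (∀ l ∈ sumset S n (numLists L) a.size, thr < l → l ≤ thr' → u ≤ l + r → l + r ≤ v →
        Seen (l + r) s') ∧ (∀ y, Seen y s → Seen y s') ∧ ScanKeeps k n L.length s s' := by
  have h0 := hI.n_le
  have hL' : numLists L ≤ k := by rw [numLists] at hL; omega
  have hr0 := abs_sums_le hI hL' (hr ▸ hval.mem_sums)
  have hV := hI.V_nonneg
  have hnl : (numLists L : ℤ) * V ≤ numLists (a :: L) * V := by
    refine mul_le_mul_of_nonneg_right ?_ hV
    rw [numLists]; push_cast; omega
  have hur : |u - r| < I := (abs_sub u r).trans_lt (by linarith)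
  have hvr : |v - r| < I := (abs_sub v r).trans_lt (by linarith)
  rw [abs_lt] at hur hvr
  have hA : ∀ l ∈ sumset S n (numLists L) a.size, -I < l ∧ l < I := fun l hl =>
    hI.abs_sumset_lt (by rw [numLists] at hL; omega) hl
  set d := L.length with hd
  set A := sumset S n (numLists L) a.size with hAdef
  set Q := memBase k n d with hQ
  have hQ' : memBase k n (d + 1) = Q + 5 * n := memBase_succ k n d
  have hQ0 : 0 ≤ Q := by rw [hQ, memBase]; positivity
  obtain ⟨b, hb⟩ : ∃ b, b = regBase k d := ⟨_, rfl⟩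
  have hb' : regBase k (d + 1) = b + 16 := by simp only [hb, regBase]; ring
  have hb0 : 72 ≤ b := by rw [hb, regBase]; omega
  have hb1 : regBase k 0 ≤ b := by rw [hb]; simp only [regBase]; omega
  have hb2 : regBase k (d + 1 + 1) = b + 32 := by simp only [hb, regBase]; ring
  have hb3 : 72 ≤ regBase k 0 := by rw [regBase]; omega
  rw [hb'] at hsu hsv hs6 hs10 hp
  rw [← hb] at hr
  have hbd := hb
  simp only [scanChunk, hb', ← hb]
  have keep : ∀ {s s' : AState}, (∀ r, r < 20 ∨ (64 ≤ r ∧ r < b + 18) ∨ (b + 20 ≤ r ∧ r < b + 24) ∨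
      r = b + 26 → s'.R r = s.R r) → s'.M = s.M → ScanKeeps k n d s s' := by
    intro s s' h hM
    refine ⟨fun r hr => h r ?_, fun x _ => by rw [hM]⟩
    rw [hb'] at hr; omega
  have stable : ∀ {s s' : AState} (P : AState → Prop), StableAbove k n (d + 1) P →
      (∀ r, b + 32 ≤ r → s'.R r = s.R r) → s'.M = s.M → P s → P s' := by
    intro s s' P hP h hM
    exact hP _ _ (fun r hr => h r (by omega)) (fun x _ => by rw [hM])
  have hval' : ∀ i < cnt, InRange I (s.M (Q + i)) := by
    intro i hi'
    have := hA _ ((hch.mem_iff _).1 ⟨i, hi', rfl⟩).1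
    rw [InRange]; omega
  have hmono : ∀ i j : ℕ, i ≤ j → j < cnt → s.M (Q + i) ≤ s.M (Q + j) := by
    intro i j hij hj
    rcases hij.lt_or_eq with h | rfl
    · exact (hch.strict i j h hj).le
    · exact le_rfl
  have hlog : Nat.log 2 cnt ≤ Nat.log 2 n := Nat.log_mono_right hcnt
  -- the first search
  apply WP.seq
  apply WP.block_frame 50 53 (by simp [blockOk, Instr.Ok]) (by simp [Instr.Within])
  intro s₁ hs₁ hM₁ hf₁
  have r₁ := (hf₁ 0 0).reg
  have e50 : s₁.R 50 = Q := by
    have q : s.R (b + 16 + 10) = Q := hs10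
    simp [← hs₁, blockExec, Instr.aexec, q]
  have e51 : s₁.R 51 = cnt := by
    have q : s.R (b + 16 + 6) = cnt := hs6
    have c1 : b + 16 + 6 ≠ 50 := by omega
    simp [← hs₁, blockExec, Instr.aexec, q, c1]
  -- The search finds the first element strictly above its key; on integers, the key `u - r - 1`
  -- gives the first `l` with `u ≤ l + r`.
  have e52 : s₁.R 52 = u - r - 1 := by
    simp [← hs₁, blockExec, Instr.aexec, hsu, hr, hs.consts.r3, show b + 16 ≠ 50 by omega,
      show b + 16 ≠ 51 by omega, show b + 2 ≠ 50 by omega, show b + 2 ≠ 51 by omega]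
  apply WP.seq
  refine (binarySearch_spec (b := fun i => s.M (Q + i)) (hs.consts.frame (hf₁ 0 0) (by norm_num))
    e50 e51 (by rw [e52, InRange]; omega) (by omega) hQ0 (by omega)
    (by rw [hM₁]; exact fun _ _ => rfl) hval' hmono).mono ?_
  rintro s₂ t₂ ⟨ht₂, hf₂, p₁, hp₁, h53, hlt₁, hge₁⟩
  rw [e52] at hlt₁ hge₁
  have r₂ : ∀ r, r < 50 ∨ 58 ≤ r → s₂.R r = s.R r := fun r hr => by
    rw [hf₂.reg _ (by omega), r₁ _ (by omega)]
  have hM₂ : s₂.M = s.M := by rw [← hM₁]; exact funext fun x => hf₂.mem x (by omega)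
  -- the second search
  apply WP.seq
  apply WP.block (by simp [blockOk, Instr.Ok])
  obtain ⟨s₃, hs₃⟩ : ∃ s₃, s₃ = blockExec I [.move (b + 16 + 8) 53, .move 50 (b + 16 + 10),
      .move 51 (b + 16 + 6), .bin .sub 52 (b + 16 + 1) (b + 2)] s₂ := ⟨_, rfl⟩
  rw [← hs₃]
  have hM₃ : s₃.M = s.M := by rw [hs₃]; simp [blockExec, Instr.aexec, hM₂]
  have e3 : ∀ r', s₃.R r' = if r' = 52 then v - r else if r' = 51 then (cnt : ℤ) else if r' = 50
      then Q else if r' = b + 24 then (p₁ : ℤ) else s₂.R r' := by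
    intro r'
    have q1 : s₂.R (b + 16 + 10) = Q := by rw [r₂ _ (by omega)]; exact hs10
    have q2 : s₂.R (b + 16 + 6) = cnt := by rw [r₂ _ (by omega)]; exact hs6
    have q3 : s₂.R (b + 16 + 1) = v := by rw [r₂ _ (by omega)]; exact hsv
    have q4 : s₂.R (b + 2) = r := by rw [r₂ _ (by omega)]; exact hr
    simp [hs₃, blockExec, Instr.aexec, q1, q2, q3, q4, h53, show b + 16 + 6 ≠ 50 by omega,
      show b + 16 + 1 ≠ 50 by omega, show b + 16 + 1 ≠ 51 by omega,
      show b + 2 ≠ 50 by omega, show b + 2 ≠ 51 by omega]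
  have r₃ : ∀ r', r' < 50 ∨ 58 ≤ r' → r' ≠ b + 24 → s₃.R r' = s.R r' := by
    intro r' h h'
    rw [e3, if_neg (by omega), if_neg (by omega), if_neg (by omega), if_neg h', r₂ _ h]
  have hc₃ : Consts I n s₃ := by
    constructor <;> rw [r₃ _ (by omega) (by omega)]
    exacts [hs.consts.r0, hs.consts.r2, hs.consts.r3, hs.consts.r4, hs.consts.r5, hs.consts.r6]
  apply WP.seq
  refine (binarySearch_spec (base := Q) (len := cnt) (b := fun i => s.M (Q + i)) hc₃
    (by rw [e3]; simp) (by rw [e3]; simp) (by rw [e3]; simp [InRange]; omega) (by omega) hQ0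
    (by omega) (by rw [hM₃]; exact fun _ _ => rfl) hval' hmono).mono ?_
  rintro s₄ t₄ ⟨ht₄, hf₄, p₂, hp₂, h53', hlt₂, hge₂⟩
  have e52' : s₃.R 52 = v - r := by rw [e3, if_pos rfl]
  rw [e52'] at hlt₂ hge₂
  have hM₄ : s₄.M = s.M := by rw [← hM₃]; exact funext fun x => hf₄.mem x (by omega)
  have r₄ : ∀ r', r' < 50 ∨ 58 ≤ r' → r' ≠ b + 24 → s₄.R r' = s.R r' := fun r' h h' => by
    rw [hf₄.reg _ (by omega), r₃ _ h h']
  have e24 : s₄.R (b + 24) = p₁ := by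
    rw [hf₄.reg _ (by omega), e3, if_neg (by omega), if_neg (by omega), if_neg (by omega), if_pos rfl]
  apply WP.seq
  apply WP.block_frame (b + 25) (b + 26) (by simp [blockOk, Instr.Ok]) (by simp [Instr.Within])
  intro s₅ hs₅ hM₅ hf₅
  have e25 : s₅.R (b + 25) = p₂ := by simp [← hs₅, blockExec, Instr.aexec, h53']
  have r₅ : ∀ r', r' < 50 ∨ 58 ≤ r' → r' ≠ b + 24 → r' ≠ b + 25 → s₅.R r' = s.R r' := by
    intro r' h h' h''
    rw [(hf₅ 0 0).reg _ (by omega), r₄ _ h h']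
  have e24' : s₅.R (b + 24) = p₁ := by rw [(hf₅ 0 0).reg _ (by omega), e24]
  have hM₅' : s₅.M = s.M := by rw [hM₅, hM₄]
  -- `p₂ < p₁` can occur when the interval is empty, hence the maximum.
  refine WP.loop (fun j s' t => ∃ pos : ℕ, j = p₂ - pos ∧ p₁ ≤ pos ∧ pos ≤ max p₁ p₂ ∧
    s'.R (b + 24) = pos ∧ s'.R (b + 25) = p₂ ∧ ScanKeeps k n d s s' ∧ Inv s' ∧
    (∀ i, p₁ ≤ i → i < pos → Seen (s.M (Q + i) + r) s') ∧ (∀ y, Seen y s → Seen y s') ∧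
    t ≤ ∑ i ∈ Finset.Ico p₁ pos, (13 + β (s.M (Q + i) + r))) ?_ (j := p₂ - p₁)
    ⟨p₁, rfl, le_rfl, le_max_left _ _, e24', e25,
      keep (fun r' hr' => r₅ r' (by omega) (by omega) (by omega)) hM₅',
      stable _ hInv (fun r' hr' => r₅ r' (by omega) (by omega) (by omega)) hM₅' hi, by omega,
      fun y hy => stable _ (hSeen y) (fun r' hr' => r₅ r' (by omega) (by omega) (by omega)) hM₅' hy,
      by simp⟩
  rintro j t m ⟨pos, rfl, hpos1, hpos2, ht24, ht25, hk, hit, hseen, hmon, hm⟩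
  have hkr := hk.reg
  rw [hb'] at hkr
  have ht24' : t.R (b + 16 + 8) = pos := ht24
  have ht25' : t.R (b + 16 + 9) = p₂ := ht25
  have htM : ∀ i < cnt, t.M (Q + i) = s.M (Q + i) := fun i hi' => hk.mem _ (by omega)
  refine ⟨by simp only [Test.Ok, ht24', ht25', InRange]; omega, fun hb => ?_, fun hb => ?_⟩
  · have hb : pos < p₂ := by simpa [Test.Holds, ht24', ht25'] using hb
    have q10 : t.R (b + 16 + 10) = Q := by rw [hkr _ (by omega), hs10]
    have q2 : t.R (b + 2) = r := by rw [hkr _ (by omega), hr]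
    obtain ⟨l, hl⟩ : ∃ l, l = s.M (Q + pos) := ⟨_, rfl⟩
    have qM : t.M (Q + pos) = l := by rw [htM _ (by omega), hl]
    have hlA : l ∈ A ∧ thr < l ∧ l ≤ thr' := (hch.mem_iff _).1 ⟨pos, by omega, hl.symm⟩
    have hlu : u ≤ l + r := by have := hge₁ pos (by omega) hpos1; rw [← hl] at this; omega
    have hlv : l + r ≤ v := by have := hlt₂ pos hb; rw [← hl] at this; omega
    apply WP.seq
    apply WP.block
    · simp [blockOk, Instr.Ok, Instr.aexec, q10, ht24']
      omega
    obtain ⟨t₁, ht₁⟩ : ∃ t₁, t₁ = blockExec I [.bin .add 20 (b + 16 + 10) (b + 16 + 8),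
        .load (b + 16 + 3) 20, .bin .add (b + 16 + 2) (b + 16 + 3) (b + 2)] t := ⟨_, rfl⟩
    rw [← ht₁]
    have e : ∀ r', t₁.R r' = if r' = b + 18 then l + r else if r' = b + 19 then l else
        if r' = 20 then Q + pos else t.R r' := by
      intro r'
      simp [ht₁, blockExec, Instr.aexec, q10, ht24', q2, qM, show b + 2 ≠ 20 by omega]
    have re : ∀ r', r' ≠ 20 → r' ≠ b + 18 → r' ≠ b + 19 → t₁.R r' = t.R r' := fun r' h1 h2 h3 => by
      rw [e, if_neg h2, if_neg h3, if_neg h1]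
    have hM' : t₁.M = t.M := by simp [ht₁, blockExec, Instr.aexec]
    have st : ∀ P, StableAbove k n (d + 1) P → P t → P t₁ := fun P hP h =>
      stable P hP (fun r' hr' => re r' (by omega) (by omega) (by omega)) hM' h
    have hct : Ctx I k n S t₁ := hs.congr
      (fun r' hr' => by rw [re _ (by omega) (by omega) (by omega), hkr _ (by omega)])
      (fun x hx => by rw [hM', hk.mem x (hx.trans_le (memBase_mono k n (by omega)))])
    apply WP.seq
    refine (hp t₁ (l + r) hct (st _ hInv hit) ⟨hval.congr fun r' h1 h2 => ?_, ?_, ?_⟩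
      (by rw [e, if_pos rfl]) hlu hlv).mono ?_
    · rw [← hd, ← hbd] at h2
      rw [re _ (by omega) (by omega) (by omega), hkr _ (by omega)]
    · rw [← hd, hb', e, if_neg (by omega), if_pos rfl]; exact hlA.1
    · rw [← hd, hb', e, if_pos rfl, e, if_neg (by omega), if_pos rfl, ← hbd, e,
        if_neg (by omega), if_neg (by omega), if_neg (by omega), q2]
    rintro t₂ m₂ ⟨g1, g2, g3, g4, g5⟩
    have gr := g5.reg
    rw [hb2] at gr
    have gM := g5.mem
    have re₂ : ∀ r', r' < 7 ∨ regBase k 0 ≤ r' ∧ r' < b + 18 ∨ b + 20 ≤ r' ∧ r' < b + 32 →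
        t₂.R r' = t.R r' := fun r' h => by
      rw [gr _ (by omega), re _ (by omega) (by omega) (by omega)]
    apply WP.block_frame (b + 24) (b + 25) (by simp [blockOk, Instr.Ok]) (by simp [Instr.Within])
    intro t₃ ht₃ hM₃' hf₃
    have r3 := (hf₃ 0 0).reg
    have stf : ∀ P, StableAbove k n (d + 1) P → P t₂ → P t₃ := fun P hP h =>
      stable P hP (fun r' hr' => r3 r' (by omega)) hM₃' h
    refine ⟨p₂ - (pos + 1), by omega, pos + 1, rfl, by omega, by omega, ?_, ?_, ⟨?_, ?_⟩,
      stf _ hInv g2, fun i h1 h2 => ?_, fun y hy => stf _ (hSeen y) (g4 y (st _ (hSeen y) (hmon y hy))),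
      ?_⟩
    · have q3 : t₂.R 3 = 1 := by rw [re₂ _ (by omega), hkr _ (by omega), hs.consts.r3]
      have q24 : t₂.R (b + 16 + 8) = pos := by rw [re₂ _ (by omega), ht24']
      simp [← ht₃, blockExec, Instr.aexec, q3, q24]
    · rw [r3 _ (by omega), re₂ _ (by omega), ht25]
    · intro r' hr'
      rw [hb'] at hr'
      rw [r3 _ (by omega), re₂ _ (by omega), hkr _ (by omega)]
    · intro x hx
      rw [hM₃', gM x hx, hM', hk.mem x hx]
    · refine stf _ (hSeen _) ?_
      rcases Nat.lt_succ_iff_lt_or_eq.1 h2 with h2 | rfl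
      · exact g4 _ (st _ (hSeen _) (hseen i h1 h2))
      · rw [← hl]; exact g3
    · rw [Finset.sum_Ico_succ_top hpos1, ← hl]
      simp only [List.length_cons, List.length_nil]
      omega
  · have hb : ¬ pos < p₂ := by simpa [Test.Holds, ht24', ht25'] using hb
    refine ⟨?_, hit, fun l hl h1 h2 h3 h4 => ?_, hmon, hk⟩
    · have hsum : ∑ i ∈ Finset.Ico p₁ pos, (13 + β (s.M (Q + i) + r)) ≤
          ∑ l ∈ A.filter (fun l => thr < l ∧ l ≤ thr'),
            (if u ≤ l + r ∧ l + r ≤ v then 13 + β (l + r) else 0) := by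
        rw [← Finset.sum_filter]
        have hlt : ∀ i ∈ Finset.Ico p₁ pos, i < p₂ := fun i hi' => by
          rw [Finset.mem_Ico] at hi'; omega
        -- The chunk is strictly increasing, so a sum over positions is a sum over distinct
        -- elements.
        have hinj : Set.InjOn (fun i : ℕ => s.M (Q + i)) (Finset.Ico p₁ pos) := by
          intro i hi' j hj' hij
          have := hlt i (by exact_mod_cast hi')
          have := hlt j (by exact_mod_cast hj')
          rcases lt_trichotomy i j with h | h | h
          · exact absurd hij (hch.strict i j h (by omega)).ne
          · exact h
          · exact absurd hij (hch.strict j i h (by omega)).ne'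
        rw [← Finset.sum_image (f := fun l => 13 + β (l + r)) hinj]
        refine Finset.sum_le_sum_of_subset fun l hl => ?_
        obtain ⟨i, hi', rfl⟩ := Finset.mem_image.1 hl
        have h2 := hlt i hi'
        rw [Finset.mem_Ico] at hi'
        have h3 := (hch.mem_iff _).1 ⟨i, by omega, rfl⟩
        have h4 := hge₁ i (by omega) hi'.1
        have h5 := hlt₂ i h2
        simp only [Finset.mem_filter]
        exact ⟨⟨h3.1, h3.2⟩, by omega, by omega⟩
      simp only [List.length_cons, List.length_nil, scanTime]
      omega
    · obtain ⟨i, hi', rfl⟩ := (hch.mem_iff l).2 ⟨hl, h1, h2⟩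
      refine hseen i ?_ ?_
      · by_contra hc
        have := hlt₁ i (by omega); omega
      · by_contra hc
        have := hge₂ i hi' (by omega); omega

end KSum

/-! ### The recursion over chunks and the accounting of its cost. -/

namespace KSum

variable {I N : ℤ}

/-- The enumeration in which the sums of one group of lists are enumerated in increasing order, in
chunks. For each chunk the sums of the other groups are enumerated, restricted to the interval that
is relevant for the chunk. -/
def chunkLevel (k d : ℕ) (init fill : Prog) (inner : Prog → Prog) (p : Prog) : Prog :=
  .seq init (.loop (.eq (regBase k (d + 1) + 5) 2)
    (.seq fill (.ite (.slt 2 (regBase k (d + 1) + 6))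
      (.seq (block [.load 20 (regBase k (d + 1) + 10),
          .bin .add 21 (regBase k (d + 1) + 10) (regBase k (d + 1) + 6), .bin .sub 21 21 3,
          .load 21 21, .bin .sub (regBase k d) (regBase k (d + 1)) 21,
          .bin .sub (regBase k d + 1) (regBase k (d + 1) + 1) 20])
        (inner (scanChunk k d p)))
      .skip)))

/-- The data differ only in the registers of level `d` from `lo` on, in auxiliary registers, and in
the memory of level `d`. -/
structure LevelFrame (k n d lo : ℕ) (s s' : AState) : Prop where
  reg : ∀ r, r < 7 ∨ (regBase k 0 ≤ r ∧ r < regBase k (d + 1) + lo) ∨ regBase k (d + 1 + 1) ≤ r →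
    s'.R r = s.R r
  mem : ∀ x, x < memBase k n d ∨ memBase k n (d + 1) ≤ x → s'.M x = s.M x

/-- The programs `init` and `fill` enumerate the elements of `A` in increasing order, in chunks. The
potential `Φ` of the state `G` of the enumeration bounds the number of elementary steps left. -/
structure ChunkSpec (I N : ℤ) (k n : ℕ) (S : ℕ → ℕ → ℤ) (d : ℕ) (A : Finset ℤ) (init fill : Prog)
    (G : AState → ℕ → Prop) (Ti Tf Φ₀ : ℕ) : Prop where
  stable : ∀ s s' Φ, Ctx I k n S s' → s'.R (regBase k (d + 1) + 4) = s.R (regBase k (d + 1) + 4) →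
    s'.R (regBase k (d + 1) + 7) = s.R (regBase k (d + 1) + 7) →
    (∀ x, memBase k n d ≤ x → x < memBase k n (d + 1) → s'.M x = s.M x) → G s Φ → G s' Φ
  init : ∀ s, Ctx I k n S s → WP I N init s fun s' t => t ≤ Ti ∧ LevelFrame k n d 4 s s' ∧
    (∃ Φ ≤ Φ₀, G s' Φ) ∧ s'.R (regBase k (d + 1) + 4) = -I ∧ s'.R (regBase k (d + 1) + 5) = 0 ∧
    s'.R (regBase k (d + 1) + 10) = memBase k n d
  fill : ∀ s Φ, Ctx I k n S s → G s Φ → Small I (s.R (regBase k (d + 1) + 4)) →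
    s.R (regBase k (d + 1) + 5) = 0 → s.R (regBase k (d + 1) + 10) = memBase k n d →
    WP I N fill s fun s' t => t ≤ Tf ∧ LevelFrame k n d 4 s s' ∧
      Small I (s'.R (regBase k (d + 1) + 4)) ∧
      s'.R (regBase k (d + 1) + 10) = memBase k n d ∧
      (∃ cnt ≤ n, s'.R (regBase k (d + 1) + 6) = cnt ∧ ListsChunk A (memBase k n d) cnt
        (s.R (regBase k (d + 1) + 4)) (s'.R (regBase k (d + 1) + 4)) s'.M) ∧
      ∃ Φ', G s' Φ' ∧ ((s'.R (regBase k (d + 1) + 5) = 1 ∧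
        ∀ l ∈ A, l ≤ s'.R (regBase k (d + 1) + 4)) ∨
        (s'.R (regBase k (d + 1) + 5) = 0 ∧ Φ' + n ≤ Φ))

/-- The cost, for one sum `r` of the other groups, of the chunks with elements up to `thr`. -/
def chunkPotential (A : Finset ℤ) (D : ℕ) (β : ℤ → ℕ) (u v thr r : ℤ) : ℕ :=
  (if v - r < thr then D else 0) +
    ∑ l ∈ A.filter (· ≤ thr), if u ≤ l + r ∧ l + r ≤ v then D + 13 + β (l + r) else 0

theorem chunkPotential_le (A : Finset ℤ) (D : ℕ) (β : ℤ → ℕ) (u v thr r : ℤ) :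
    chunkPotential A D β u v thr r ≤
      D + ∑ l ∈ A, if u ≤ l + r ∧ l + r ≤ v then D + 13 + β (l + r) else 0 := by
  refine add_le_add (by split_ifs <;> omega) (Finset.sum_le_sum_of_subset (Finset.filter_subset _ _))

theorem chunkPotential_mono (A : Finset ℤ) (D : ℕ) (β : ℤ → ℕ) (u v : ℤ) {thr thr' : ℤ}
    (h : thr ≤ thr') (r : ℤ) : chunkPotential A D β u v thr r ≤ chunkPotential A D β u v thr' r := by
  refine add_le_add ?_ (Finset.sum_le_sum_of_subset fun l hl => ?_)
  · split_ifs <;> omega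
  · rw [Finset.mem_filter] at hl ⊢
    exact ⟨hl.1, hl.2.trans h⟩

/-- Visiting a chunk for `r` costs `D`. If the chunk contains a hit, the term of that hit includes
another `D`. If not, `thr' + r` exceeds `v` while `lo + r` does not, so the condition `v - r < thr`
turns from false to true at this chunk and releases `D`, once for each `r`. -/
theorem chunkPotential_step (A : Finset ℤ) (D : ℕ) (β : ℤ → ℕ) {u v thr thr' lo : ℤ} (r : ℤ)
    (hthr : thr' ∈ A) (hlo : thr < lo) (hlo' : lo ≤ thr') :
    chunkPotential A D β u v thr r + (if u - thr' ≤ r ∧ r ≤ v - lo then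
      D + ∑ l ∈ A.filter (fun l => thr < l ∧ l ≤ thr'),
        (if u ≤ l + r ∧ l + r ≤ v then 13 + β (l + r) else 0) else 0) ≤
      chunkPotential A D β u v thr' r := by
  by_cases hr : u - thr' ≤ r ∧ r ≤ v - lo
  swap
  · rw [if_neg hr, add_zero]; exact chunkPotential_mono A D β u v (by omega) r
  rw [if_pos hr]
  have hsplit : A.filter (· ≤ thr') = A.filter (· ≤ thr) ∪
      A.filter (fun l => thr < l ∧ l ≤ thr') := by
    ext l; simp only [Finset.mem_filter, Finset.mem_union]
    constructor
    · rintro ⟨h1, h2⟩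
      by_cases h : l ≤ thr
      · exact Or.inl ⟨h1, h⟩
      · exact Or.inr ⟨h1, by omega, h2⟩
    · rintro (⟨h1, h2⟩ | ⟨h1, h2, h3⟩)
      · exact ⟨h1, by omega⟩
      · exact ⟨h1, h3⟩
  have hdisj : Disjoint (A.filter (· ≤ thr)) (A.filter (fun l => thr < l ∧ l ≤ thr')) := by
    rw [Finset.disjoint_filter]; intro l _ h; omega
  simp only [chunkPotential]
  rw [hsplit, Finset.sum_union hdisj]
  set B := A.filter (fun l => thr < l ∧ l ≤ thr') with hB
  have h1 : ∑ l ∈ B, (if u ≤ l + r ∧ l + r ≤ v then 13 + β (l + r) else 0) ≤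
      ∑ l ∈ B, (if u ≤ l + r ∧ l + r ≤ v then D + 13 + β (l + r) else 0) :=
    Finset.sum_le_sum fun l _ => by split_ifs <;> omega
  by_cases hex : ∃ l ∈ B, u ≤ l + r ∧ l + r ≤ v
  · obtain ⟨l, hl, hw⟩ := hex
    have h2 : D + ∑ l ∈ B, (if u ≤ l + r ∧ l + r ≤ v then 13 + β (l + r) else 0) ≤
        ∑ l ∈ B, (if u ≤ l + r ∧ l + r ≤ v then D + 13 + β (l + r) else 0) := by
      rw [← Finset.add_sum_erase _ _ hl, ← Finset.add_sum_erase _ _ hl, if_pos hw, if_pos hw]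
      have : ∑ l ∈ B.erase l, (if u ≤ l + r ∧ l + r ≤ v then 13 + β (l + r) else 0) ≤
          ∑ l ∈ B.erase l, (if u ≤ l + r ∧ l + r ≤ v then D + 13 + β (l + r) else 0) :=
        Finset.sum_le_sum fun l _ => by split_ifs <;> omega
      omega
    have h3 : (if v - r < thr then D else 0) ≤ (if v - r < thr' then D else 0) := by
      split_ifs <;> omega
    omega
  -- `thr'` is not a hit although `u ≤ thr' + r`; hence `v - r < thr'`, whereas `thr < lo ≤ v - r`.
  · have hmem : thr' ∈ B := by rw [hB, Finset.mem_filter]; exact ⟨hthr, by omega, le_rfl⟩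
    have h3 : ¬ (u ≤ thr' + r ∧ thr' + r ≤ v) := fun h => hex ⟨_, hmem, h⟩
    rw [if_neg (show ¬ v - r < thr by omega), if_pos (show v - r < thr' by omega)]
    omega

variable {k n : ℕ} {S : ℕ → ℕ → ℤ} {V : ℤ}

/-- Every one of the at most `P + 1` chunks costs its filling and the base cost `A` of one inner
enumeration. The costs that depend on `r` are not multiplied by the number of chunks: over all
chunks they add up to `chunkPotential`, which is `D` for each inner sum plus the cost of the hits.
-/
theorem chunkLevel_spec (hI : Instance I N k n S V) {a : Level} {L : List Level}
    (ha : ∀ φ, weight S n (a :: L) φ =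
      ∑ l ∈ sumset S n (numLists L) a.size, weight S n L fun r => φ (l + r))
    {inner : Prog → Prog} {A c : ℕ} (hL : numLists (a :: L) ≤ k)
    (hN : memBase k n (L.length + 1) ≤ N) (h : Enumerates I N k n S V L inner A c)
    {init fill : Prog} {G : AState → ℕ → Prop} {Ti Tf Φ₀ P : ℕ}
    (hG : ChunkSpec I N k n S L.length (sumset S n (numLists L) a.size) init fill G Ti Tf Φ₀)
    (hP : Φ₀ ≤ n * P) :
    Enumerates I N k n S V (a :: L) (chunkLevel k L.length init fill inner)
      (Ti + (P + 1) * (Tf + A + 30) + (c + scanTime n) * n ^ numLists L + 10)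
      (c + scanTime n + 13) := by
  intro p Inv Seen β u v hu hv hInv hSeen hp s hs hi hsu hsv
  have h0 := hI.n_le
  have h1 := hI.n_pos
  have hV := hI.V_nonneg
  have hu0 := hu
  have hv0 := hv
  simp only [numLists] at hu hv
  simp only [List.length_cons] at hInv hSeen hp hsu hsv
  have hLk : numLists L + a.size ≤ k := hL
  set A' := sumset S n (numLists L) a.size with hA'
  have hA : ∀ l ∈ A', |l| ≤ a.size * V := fun l hl => abs_sumset_le hI.bound hLk hl
  have hA2 : ∀ l ∈ A', -I < l ∧ l < I := fun l hl => hI.abs_sumset_lt hLk hl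
  obtain ⟨d, hd⟩ : ∃ d, d = L.length := ⟨_, rfl⟩
  rw [← hd] at hInv hSeen hp hsu hsv hN hG ⊢
  set Q := memBase k n d with hQ
  have hQ' : memBase k n (d + 1) = Q + 5 * n := memBase_succ k n d
  have hQ0 : memBase k n 0 ≤ Q := memBase_mono k n (by omega)
  have hQ1 : 0 ≤ Q := by rw [hQ, memBase]; positivity
  obtain ⟨b, hb⟩ : ∃ b, b = regBase k d := ⟨_, rfl⟩
  have hb' : regBase k (d + 1) = b + 16 := by simp only [hb, regBase]; ring
  have hb0 : 72 ≤ b := by rw [hb, regBase]; omega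
  have hb1 : regBase k 0 ≤ b := by rw [hb]; simp only [regBase]; omega
  have hb2 : regBase k (d + 1 + 1) = b + 32 := by simp only [hb, regBase]; ring
  have hb3 : 72 ≤ regBase k 0 := by rw [regBase]; omega
  obtain ⟨Gst, Gin, Gfi⟩ := hG
  simp only [hb'] at Gst Gin Gfi
  rw [hb'] at hsu hsv
  set D := c + scanTime n with hD
  have levelStable : ∀ {s s' : AState} (P : AState → Prop), StableAbove k n (d + 1) P →
      LevelFrame k n d 4 s s' → P s → P s' := by
    intro s s' P hP hf h
    exact hP _ _ (fun r hr => hf.reg r (by omega)) (fun x hx => hf.mem x (by omega)) h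
  have levelCtx : ∀ {s s' : AState}, LevelFrame k n d 4 s s' → Ctx I k n S s → Ctx I k n S s' := by
    intro s s' hf h
    exact h.congr (fun r hr => hf.reg r (by omega)) (fun x hx => hf.mem x (by omega))
  simp only [chunkLevel, hb', ← hb]
  apply WP.seq
  refine (Gin s hs).mono ?_
  rintro s₁ t₁ ⟨ht₁, hf₁, ⟨Φ₁, hΦ₁, hG₁⟩, q4, q5, q10⟩
  have hr₁ := hf₁.reg
  rw [hb'] at hr₁
  -- `i` counts the chunks. Each consumes `n` of the potential `Φ₀`, except possibly the one that
  -- ends the enumeration, whence `i * n ≤ Φ₀ + n`. The value `j = 0` is reserved for the completed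
  -- enumeration.
  refine WP.loop (fun j s' m => ∃ i Φ, Ctx I k n S s' ∧ G s' Φ ∧ Inv s' ∧ s'.R (b + 16) = u ∧
    s'.R (b + 17) = v ∧ s'.R (b + 26) = Q ∧ Small I (s'.R (b + 20)) ∧
    (∀ l ∈ A', l ≤ s'.R (b + 20) → ∀ r ∈ sums S n L, u ≤ l + r → l + r ≤ v → Seen (l + r) s') ∧
    (∀ y, Seen y s → Seen y s') ∧
    ((s'.R (b + 21) = 0 ∧ j = Φ + 1 ∧ i * n + Φ ≤ Φ₀) ∨
      (s'.R (b + 21) = 1 ∧ j = 0 ∧ i * n ≤ Φ₀ + n ∧ ∀ l ∈ A', l ≤ s'.R (b + 20))) ∧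
    m ≤ i * (Tf + A + 30) + weight S n L (chunkPotential A' D β u v (s'.R (b + 20))))
    ?_ (j := Φ₁ + 1)
    ⟨0, Φ₁, levelCtx hf₁ hs, hG₁, levelStable _ hInv hf₁ hi, by rw [hr₁ _ (by omega), hsu],
      by rw [hr₁ _ (by omega), ← hsv], q10, by rw [q4, Small]; omega, ?_,
      fun y hy => levelStable _ (hSeen y) hf₁ hy, Or.inl ⟨q5, rfl, by omega⟩, by omega⟩
  swap
  · intro l hl hle
    rw [show s₁.R (b + 20) = -I from q4] at hle
    have := hA2 l hl
    omega
  rintro j s₂ m ⟨i, Φ, hc₂, hG₂, hi₂, hu₂, hv₂, hq₂, hsm, hseen₂, hmono₂, hcase, hm⟩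
  have e21 : s₂.R (b + 16 + 5) = s₂.R (b + 21) := rfl
  have e2 := hc₂.consts.r2
  refine ⟨?_, fun hb => ?_, fun hb => ?_⟩
  · simp only [Test.Ok, InRange, e2, e21]
    omega
  · rw [Test.Holds, e21, e2] at hb
    obtain ⟨-, rfl, hΦ⟩ : s₂.R (b + 21) = 0 ∧ j = Φ + 1 ∧ i * n + Φ ≤ Φ₀ := by
      rcases hcase with h | h
      · exact h
      · omega
    clear hcase
    apply WP.seq
    refine (Gfi s₂ Φ hc₂ hG₂ hsm hb hq₂).mono ?_
    rintro s₃ t₃ ⟨ht₃, hf₃, hsm₃, q10₃, ⟨cnt, hcnt, h6, hch⟩, Φ₃, hG₃, hcase⟩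
    have hr₃ := hf₃.reg
    rw [hb'] at hr₃
    have hc₃ := levelCtx hf₃ hc₂
    have hi₃ := levelStable _ hInv hf₃ hi₂
    have hu₃ : s₃.R (b + 16) = u := by rw [hr₃ _ (by omega), hu₂]
    have hv₃ : s₃.R (b + 17) = v := by rw [hr₃ _ (by omega), hv₂]
    obtain ⟨thr, hthr⟩ : ∃ thr, thr = s₂.R (b + 20) := ⟨_, rfl⟩
    obtain ⟨thr', hthr'⟩ : ∃ thr', thr' = s₃.R (b + 20) := ⟨_, rfl⟩
    have hch : ListsChunk A' Q cnt thr thr' s₃.M := by rw [hthr, hthr']; exact hch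
    have h6' : s₃.R (b + 16 + 6) = cnt := h6
    -- the end of an iteration
    have fin : ∀ s' t, Ctx I k n S s' → Inv s' → (∀ r, b + 16 ≤ r → r < b + 18 ∨ b + 20 ≤ r ∧
        r < b + 24 ∨ r = b + 26 → s'.R r = s₃.R r) →
        (∀ x, Q ≤ x → x < memBase k n (d + 1) → s'.M x = s₃.M x) →
        (∀ l ∈ A', thr < l → l ≤ thr' → ∀ r ∈ sums S n L, u ≤ l + r → l + r ≤ v →
          Seen (l + r) s') → (∀ y, Seen y s₃ → Seen y s') →
        m + t + 1 ≤ (i + 1) * (Tf + A + 30) + weight S n L (chunkPotential A' D β u v thr') →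
        ∃ j' < Φ + 1, ∃ i Φ, Ctx I k n S s' ∧ G s' Φ ∧ Inv s' ∧ s'.R (b + 16) = u ∧
          s'.R (b + 17) = v ∧ s'.R (b + 26) = Q ∧ Small I (s'.R (b + 20)) ∧
          (∀ l ∈ A', l ≤ s'.R (b + 20) → ∀ r ∈ sums S n L, u ≤ l + r → l + r ≤ v →
            Seen (l + r) s') ∧ (∀ y, Seen y s → Seen y s') ∧
          ((s'.R (b + 21) = 0 ∧ j' = Φ + 1 ∧ i * n + Φ ≤ Φ₀) ∨
            (s'.R (b + 21) = 1 ∧ j' = 0 ∧ i * n ≤ Φ₀ + n ∧ ∀ l ∈ A', l ≤ s'.R (b + 20))) ∧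
          m + t + 1 ≤ i * (Tf + A + 30) +
            weight S n L (chunkPotential A' D β u v (s'.R (b + 20))) := by
      intro s' t hc' hi' hr' hM' hs' hmo' ht'
      have e20 : s'.R (b + 20) = thr' := by rw [hr' _ (by omega) (by omega), hthr']
      have e21' : s'.R (b + 21) = s₃.R (b + 16 + 5) := hr' _ (by omega) (by omega)
      have hG' := Gst s₃ s' Φ₃ hc' (hr' _ (by omega) (by omega)) (hr' _ (by omega) (by omega)) hM' hG₃
      have hseen' : ∀ l ∈ A', l ≤ s'.R (b + 20) → ∀ r ∈ sums S n L, u ≤ l + r → l + r ≤ v →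
            Seen (l + r) s' := by
        intro l hl hle r hr h2 h3
        rw [e20] at hle
        by_cases hlt : thr < l
        · exact hs' l hl hlt hle r hr h2 h3
        · exact hmo' _ (levelStable _ (hSeen _) hf₃ (hseen₂ l hl (by omega) r hr h2 h3))
      have hmono' : ∀ y, Seen y s → Seen y s' := fun y hy =>
        hmo' _ (levelStable _ (hSeen _) hf₃ (hmono₂ y hy))
      have common : s'.R (b + 16) = u ∧ s'.R (b + 17) = v ∧ s'.R (b + 26) = Q ∧
          Small I (s'.R (b + 20)) :=
        ⟨by rw [hr' _ (by omega) (by omega), hu₃], by rw [hr' _ (by omega) (by omega), hv₃],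
          by rw [hr' _ (by omega) (by omega)]; exact q10₃, by
            rw [hr' _ (by omega) (by omega)]; exact hsm₃⟩
      obtain ⟨c1, c2, c3, c4⟩ := common
      have hin : (i + 1) * n = i * n + n := by ring
      rcases hcase with ⟨g1, g2⟩ | ⟨g1, g2⟩
      · exact ⟨0, by omega, i + 1, Φ₃, hc', hG', hi', c1, c2, c3, c4, hseen', hmono',
          Or.inr ⟨by rw [e21', g1], rfl, by omega, fun l hl => by rw [e20, hthr']; exact g2 l hl⟩,
          by rw [e20]; exact ht'⟩
      · exact ⟨Φ₃ + 1, by omega, i + 1, Φ₃, hc', hG', hi', c1, c2, c3, c4, hseen', hmono',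
          Or.inl ⟨by rw [e21', g1], rfl, by omega⟩, by rw [e20]; exact ht'⟩
    rw [← hthr] at hm
    refine WP.ite (by simp only [Test.Ok, InRange, h6', hc₃.consts.r2]; omega) ?_ ?_
    · intro hb
      have hcnt0 : 0 < cnt := by simpa [Test.Holds, h6', hc₃.consts.r2] using hb
      obtain ⟨lo, hlo⟩ : ∃ lo, lo = s₃.M Q := ⟨_, rfl⟩
      obtain ⟨cm, rfl⟩ : ∃ cm, cnt = cm + 1 := ⟨cnt - 1, by omega⟩
      have hhi := hch.last cm rfl
      have hthrA : thr' ∈ A' := ((hch.mem_iff _).1 ⟨cm, by omega, hhi⟩).1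
      have hloA := (hch.mem_iff lo).1 ⟨0, by omega, by simp [hlo]⟩
      have q10₃' : s₃.R (b + 16 + 10) = Q := q10₃
      have hv₃' : s₃.R (b + 16 + 1) = v := hv₃
      have q3 := hc₃.consts.r3
      have hQc : Q + ((cm + 1 : ℕ) : ℤ) - 1 = Q + cm := by push_cast; ring
      apply WP.seq
      apply WP.block
      · simp [blockOk, Instr.Ok, Instr.aexec, q10₃', h6', q3,
          show ¬ b + 16 + 10 = 20 by omega, show ¬ b + 16 + 6 = 20 by omega]
        omega
      obtain ⟨s₄, hs₄⟩ : ∃ s₄, s₄ = blockExec I [.load 20 (b + 16 + 10),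
          .bin .add 21 (b + 16 + 10) (b + 16 + 6), .bin .sub 21 21 3, .load 21 21,
          .bin .sub b (b + 16) 21, .bin .sub (b + 1) (b + 16 + 1) 20] s₃ := ⟨_, rfl⟩
      rw [← hs₄]
      have hM₄ : s₄.M = s₃.M := by simp [hs₄, blockExec, Instr.aexec]
      have e₄ : ∀ r, s₄.R r = if r = b + 1 then v - lo else if r = b then u - thr' else
          if r = 21 then thr' else if r = 20 then lo else s₃.R r := by
        intro r
        have hhi' : s₃.M (Q + (cm + 1) - 1) = thr' := by rw [← hhi]; congr 1
        simp [hs₄, blockExec, Instr.aexec, q10₃', h6', q3, hu₃, hv₃', hhi', ← hlo,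
          show ¬ b + 16 + 10 = 20 by omega, show ¬ b + 16 + 6 = 20 by omega,
          show ¬ b + 16 = 20 by omega, show ¬ b + 16 = 21 by omega,
          show ¬ b + 16 + 1 = 20 by omega, show ¬ b + 16 + 1 = 21 by omega,
          show ¬ 20 = b by omega]
        split_ifs <;> first | rfl | omega
      have r₄ : ∀ r, r ≠ b + 1 → r ≠ b → r ≠ 21 → r ≠ 20 → s₄.R r = s₃.R r := by
        intro r r1 r2 r3 r4
        rw [e₄, if_neg r1, if_neg r2, if_neg r3, if_neg r4]
      have st₄ : ∀ P, StableAbove k n (d + 1) P → P s₃ → P s₄ := fun P hP h =>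
        hP _ _ (fun r hr => r₄ r (by omega) (by omega) (by omega) (by omega))
          (fun x _ => by rw [hM₄]) h
      have hc₄ : Ctx I k n S s₄ := hc₃.congr
        (fun r hr => r₄ r (by omega) (by omega) (by omega) (by omega)) (fun x _ => by rw [hM₄])
      have hthrb := hA thr' hthrA
      have hlob := hA lo hloA.1
      have hub := abs_sub u thr'
      have hvb := abs_sub v lo
      push_cast at hu hv
      refine (h (scanChunk k d p) (fun s' => Inv s' ∧ (∀ r, b + 16 ≤ r → r < b + 18 ∨ b + 20 ≤ r ∧
          r < b + 24 ∨ r = b + 26 → s'.R r = s₃.R r) ∧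
          (∀ x, Q ≤ x → x < memBase k n (d + 1) → s'.M x = s₃.M x) ∧
          ∀ y, Seen y s₃ → Seen y s')
        (fun r s' => ∀ l ∈ A', thr < l → l ≤ thr' → u ≤ l + r → l + r ≤ v → Seen (l + r) s')
        (fun r => scanTime n + ∑ l ∈ A'.filter (fun l => thr < l ∧ l ≤ thr'),
          (if u ≤ l + r ∧ l + r ≤ v then 13 + β (l + r) else 0))
        (u - thr') (v - lo) (by linarith) (by linarith) ?_ ?_ ?_ s₄ hc₄ ⟨st₄ _ hInv hi₃,
          fun r hr hr' => r₄ r (by omega) (by omega) (by omega) (by omega),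
          fun x _ _ => by rw [hM₄], fun y hy => st₄ _ (hSeen y) hy⟩
        (by rw [← hd, ← ‹b = regBase k d›, e₄, if_neg (by omega), if_pos rfl])
        (by rw [← hd, ← ‹b = regBase k d›, e₄, if_pos rfl])).mono ?_
      · rintro t t' hr hM ⟨g1, g2, g3, g4⟩
        rw [← hd, hb'] at hr
        rw [← hd] at hM
        have g : ∀ P, StableAbove k n (d + 1) P → P t → P t' := fun P hP h =>
          hP _ _ (fun r hr' => hr r (by omega)) (fun x hx => hM x (by omega)) h
        exact ⟨g _ hInv g1, fun r h1 h2 => by rw [hr r h1, g2 r h1 h2],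
          fun x h1 h2 => by rw [hM x h1, g3 x h1 h2], fun y hy => g _ (hSeen y) (g4 y hy)⟩
      · rintro r t t' hr hM g l hl g1 g2 g3 g4
        rw [← hd, hb'] at hr
        rw [← hd] at hM
        exact hSeen _ _ _ (fun r hr' => hr r (by omega)) (fun x hx => hM x (by omega))
          (g l hl g1 g2 g3 g4)
      · rintro t r hct ⟨g1, g2, g3, g4⟩ hval hr hur hvr
        have hch' : ListsChunk A' Q (cm + 1) thr thr' t.M := by
          have e : ∀ i < cm + 1, t.M (Q + i) = s₃.M (Q + i) := fun i hi => g3 _ (by omega) (by omega)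
          refine ⟨fun i j hij hj => ?_, fun l => ?_, fun c hc => ?_, hch.le⟩
          · rw [e i (by omega), e j hj]; exact hch.strict i j hij hj
          · rw [← hch.mem_iff]
            exact ⟨fun ⟨i, hi, h⟩ => ⟨i, hi, by rw [← e i hi, h]⟩,
              fun ⟨i, hi, h⟩ => ⟨i, hi, by rw [e i hi, h]⟩⟩
          · rw [e c (by omega)]; exact hch.last c hc
        have := scanChunk_spec hI hL (p := p) (Inv := Inv) (Seen := Seen) (β := β) hu0 hv0
          (by rw [← hd]; exact hInv) (by rw [← hd]; exact hSeen)
          (by rw [← hd]; exact hp) (thr := thr) (thr' := thr') hcnt (by rw [← hd]; exact hN) hct g1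
          hval hr (by rw [← hd, hb', g2 _ (by omega) (by omega), hu₃])
          (by rw [← hd, hb', g2 _ (by omega) (by omega)]; exact hv₃)
          (by rw [← hd, hb', g2 _ (by omega) (by omega)]; exact h6)
          (by rw [← hd, hb', g2 _ (by omega) (by omega)]; exact q10₃)
          (by rw [← hd]; exact hch')
        rw [← hd] at this
        refine this.mono ?_
        rintro t' m' ⟨w1, w2, w3, w4, w5⟩
        have wr := w5.reg
        have wm := w5.mem
        rw [hb'] at wr
        refine ⟨w1, ⟨w2, fun r h1 h2 => ?_, fun x h1 h2 => ?_, fun y hy => w4 y (g4 y hy)⟩, w3,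
          fun y hy l hl z1 z2 z3 z4 => w4 _ (hy l hl z1 z2 z3 z4), ?_, ?_⟩
        · rw [wr r (by omega), g2 r h1 h2]
        · rw [wm x h2, g3 x h1 h2]
        · intro r' hr'
          rw [← hd, hb'] at hr'
          exact wr r' (by omega)
        · intro x hx
          rw [← hd] at hx
          exact wm x (by omega)
      · rintro s₅ t₅ ⟨ht₅, hc₅, ⟨g1, g2, g3, g4⟩, hseen, hmono⟩
        have hw : weight S n L (chunkPotential A' D β u v thr) + weight S n L (fun r =>
            if u - thr' ≤ r ∧ r ≤ v - lo then c + (scanTime n + ∑ l ∈ A'.filter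
              (fun l => thr < l ∧ l ≤ thr'), (if u ≤ l + r ∧ l + r ≤ v then 13 + β (l + r) else 0))
              else 0) ≤ weight S n L (chunkPotential A' D β u v thr') := by
          rw [← weight_add]
          refine weight_mono L fun r => ?_
          have := chunkPotential_step A' D β (u := u) (v := v) r hthrA hloA.2.1 hloA.2.2
          simpa only [hD, add_assoc] using this
        -- No pair is lost by the restriction: `lo ≤ l ≤ thr'` and `u ≤ l + r ≤ v` imply that `r`
        -- lies in the inner interval.
        refine fin s₅ _ hc₅ g1 g2 g3 (fun l hl z1 z2 r hr z3 z4 => hseen r hr ?_ ?_ l hl z1 z2 z3 z4)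
          g4 ?_
        · linarith
        · have : lo ≤ l := by
            obtain ⟨i', hi', rfl⟩ := (hch.mem_iff l).2 ⟨hl, z1, z2⟩
            rw [hlo]
            rcases Nat.eq_zero_or_pos i' with rfl | hpos
            · simp
            · have := hch.strict 0 i' hpos hi'
              simp only [Nat.cast_zero, add_zero] at this
              exact this.le
          linarith
        · simp only [List.length_cons, List.length_nil]
          have : (i + 1) * (Tf + A + 30) = i * (Tf + A + 30) + (Tf + A + 30) := by ring
          omega
    · intro hb
      have hcnt0 : cnt = 0 := by
        simp only [Test.Holds, h6', hc₃.consts.r2] at hb; omega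
      subst hcnt0
      refine WP.skip (fin s₃ _ hc₃ hi₃ (fun _ _ _ => rfl) (fun _ _ _ => rfl)
        (fun l hl z1 z2 => ?_) (fun _ => id) ?_)
      · obtain ⟨i', hi', -⟩ := (hch.mem_iff l).2 ⟨hl, z1, z2⟩
        omega
      · have := weight_mono (S := S) (n := n) L (chunkPotential_mono A' D β u v hch.le)
        have : (i + 1) * (Tf + A + 30) = i * (Tf + A + 30) + (Tf + A + 30) := by ring
        omega
  · rw [Test.Holds, e21, e2] at hb
    obtain ⟨-, -, hin, hall⟩ : s₂.R (b + 21) = 1 ∧ j = 0 ∧ i * n ≤ Φ₀ + n ∧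
        ∀ l ∈ A', l ≤ s₂.R (b + 20) := by
      rcases hcase with h | h
      · exact absurd h.1 hb
      · exact h
    refine ⟨?_, hc₂, hi₂, fun x hx z1 z2 => ?_, hmono₂⟩
    · have hiP : i ≤ P + 1 := by
        have : n * i ≤ n * (P + 1) := by rw [mul_comm n i, mul_add, mul_one]; omega
        exact Nat.le_of_mul_le_mul_left this h1
      have hK : i * (Tf + A + 30) ≤ (P + 1) * (Tf + A + 30) := Nat.mul_le_mul_right _ hiP
      have hw : weight S n L (chunkPotential A' D β u v (s₂.R (b + 20))) ≤ D * n ^ numLists L +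
          weight S n (a :: L) (fun x => if u ≤ x ∧ x ≤ v then D + 13 + β x else 0) := by
        refine (weight_mono L (chunkPotential_le A' D β u v _)).trans ?_
        rw [weight_add, ha, weight_sum]
        exact Nat.add_le_add_right (weight_const_le L D) _
      omega
    · obtain ⟨l, hl, r, hr, rfl⟩ := mem_sums_cons.1 hx
      exact hseen₂ l hl (hall l hl) r hr z1 z2

end KSum

/-! ### Sorting, and suspending an enumeration between two chunks. -/

namespace KSum

variable {I N : ℤ}

theorem MergeInv.congr {n m : ℕ} {ab bb tb : ℤ} {a b : ℕ → ℤ} {s s' : AState} {Φ : ℕ}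
    (h : MergeInv I n m ab bb tb a b s Φ) (hr : MergeRegs I n m ab bb tb a b s')
    (h40 : s'.R 40 = s.R 40) (hM : ∀ x, tb ≤ x → x < tb + 3 * n → s'.M x = s.M x) :
    MergeInv I n m ab bb tb a b s' Φ := by
  obtain ⟨-, q, hT, hq, hΦ⟩ := h
  refine ⟨hr, q, ⟨hT.pos_le, fun i hi => ?_, fun i hi => ?_, fun x h1 h2 h3 => ?_⟩,
    by rw [h40]; exact hq, hΦ⟩
  · rw [hM _ (by omega) (by omega), hT.pos_mem i hi]
  · rw [hM _ (by omega) (by omega), hT.leaf_mem i hi]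
  · have := hT.node x h1 h2 h3
    rwa [NodeOk, hM _ (by omega) (by omega), hM _ (by omega) (by omega),
      hM _ (by omega) (by omega)]

variable {k n : ℕ} {S : ℕ → ℕ → ℤ} {V : ℤ}

/-- Load the addresses of the parts of the memory of level `d`, and of list `o`. -/
def levelParams (k d o : ℕ) : List Instr :=
  [.const 30 (k + 5 * d), .bin .mul 30 30 0, .bin .add 30 30 3, .bin .add 47 30 0,
    .bin .add 44 47 0, .bin .add 45 44 0, .bin .add 45 45 0, .const 46 o, .bin .mul 46 46 0]

/-- Sort list `o`, and initialize level `d`. -/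
def sortInit (k d o : ℕ) : Prog :=
  .seq (block (levelParams k d o ++ [.move 30 47, .const 47 k, .bin .mul 47 47 0, .move 43 3]))
    (.seq mergeInit (.seq (fillArray mergeStep)
      (block [.move (regBase k (d + 1) + 7) 31, .move (regBase k (d + 1) + 4) 6,
        .const (regBase k (d + 1) + 5) 0, .const (regBase k (d + 1) + 10) (k + 5 * d),
        .bin .mul (regBase k (d + 1) + 10) (regBase k (d + 1) + 10) 0,
        .bin .add (regBase k (d + 1) + 10) (regBase k (d + 1) + 10) 3])))

/-- A bound on the number of steps of `sortInit`. -/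
def sortTime (n : ℕ) : ℕ := n * (mergeStepTime n + 118) + 200

theorem LevelFrame.trans {d lo : ℕ} {s s' s'' : AState} (h : LevelFrame k n d lo s s')
    (h' : LevelFrame k n d lo s' s'') : LevelFrame k n d lo s s'' :=
  ⟨fun r hr => (h'.reg r hr).trans (h.reg r hr), fun x hx => (h'.mem x hx).trans (h.mem x hx)⟩

theorem Frame.level {d lo hi : ℕ} {y z : ℤ} {s s' : AState} (h : Frame lo hi y z s s')
    (hlo : 7 ≤ lo) (hhi : hi ≤ regBase k 0) (hy : memBase k n d ≤ y)
    (hz : z ≤ memBase k n (d + 1)) : LevelFrame k n d 4 s s' :=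
  ⟨fun r hr => h.reg r (by simp only [regBase] at *; omega), fun x hx => h.mem x (by omega)⟩

theorem Frame.level_regs {d : ℕ} {s s' : AState}
    (h : Frame (regBase k (d + 1) + 4) (regBase k (d + 1 + 1)) 0 0 s s') :
    LevelFrame k n d 4 s s' :=
  ⟨fun r hr => h.reg r (by simp only [regBase] at *; omega), fun x _ => h.mem x (by omega)⟩

theorem LevelFrame.ctx {d : ℕ} {s s' : AState} (h : LevelFrame k n d 4 s s')
    (hs : Ctx I k n S s) : Ctx I k n S s' :=
  hs.congr (fun r hr => h.reg r (by omega))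
    (fun x hx => h.mem x (Or.inl (hx.trans_le (memBase_mono k n (by omega)))))

theorem Instance.abs_value_lt (hI : Instance I N k n S V) {o : ℕ} (ho : o < k) {i : ℕ}
    (hi : i < n) : -I < S o i ∧ S o i < I :=
  hI.abs_sumset_lt (o := o) (d := 1) (by omega)
    (mem_sumset_succ.2 ⟨i, hi, 0, by simp [sumset], add_zero _⟩)

theorem mul_le_memBase {o d : ℕ} (ho : o < k) : ((o : ℤ) * n) + n < memBase k n d := by
  have h1 : ((o : ℤ) + 1) * n ≤ (k + 5 * d) * n :=
    mul_le_mul_of_nonneg_right (by omega) (by positivity)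
  simp only [memBase]
  push_cast
  linarith

/-- Sorting is merging with the one-element list `0`, for which the cell behind the input serves.
The rows then have length one, `n` steps use them all up, and equal elements are listed once. -/
theorem sortInit_spec (hI : Instance I N k n S V) {d o : ℕ} (ho : o < k)
    (hN : memBase k n (d + 1) ≤ N) {s : AState} (hs : Ctx I k n S s) :
    WP I N (sortInit k d o) s fun s' t => t ≤ sortTime n ∧ LevelFrame k n d 4 s s' ∧
      s'.R (regBase k (d + 1) + 4) = -I ∧ s'.R (regBase k (d + 1) + 5) = 0 ∧
      s'.R (regBase k (d + 1) + 10) = memBase k n d ∧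
      ∃ m ≤ n, s'.R (regBase k (d + 1) + 7) = m ∧
        SortedValues S n o (memBase k n d + n) m s'.M := by
  have hn := hI.n_le
  have hn1 := hI.n_pos
  have hQ' := memBase_succ k n d
  have hab := mul_le_memBase (n := n) (d := d) ho
  have hkn : (k : ℤ) * n < memBase k n d := by
    have : (0 : ℤ) ≤ 5 * d * n := by positivity
    simp only [memBase]; push_cast; linarith
  have hQ : ((k : ℤ) + 5 * d) * n + 1 = memBase k n d := by rw [memBase]; push_cast; ring
  set Q := memBase k n d with hQdef
  have ho0 : (0 : ℤ) ≤ o * n := by positivity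
  have hk0 : (0 : ℤ) ≤ k * n := by positivity
  have hb0 : 72 ≤ regBase k 0 := by simp only [regBase]; omega
  have hb1 : regBase k 0 ≤ regBase k (d + 1) := by simp only [regBase]; omega
  have hb2 : regBase k (d + 1 + 1) = regBase k (d + 1) + 16 := by simp only [regBase]; ring
  have hc := hs.consts
  have hp : MergeParams I N n 1 (o * n) (k * n) (Q + 2 * n) (S o) (fun _ => 0) :=
    ⟨hn1, le_rfl, hn, by omega, ho0, by omega, hk0, by omega, by omega, fun i hi j _ => by
      rw [add_zero]; exact hI.abs_value_lt ho hi, fun _ _ _ _ => le_rfl⟩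
  have hA : ∀ l, l ∈ values S n o ↔ ∃ i < n, ∃ j < 1, l = S o i + (fun _ : ℕ => (0 : ℤ)) j := by
    intro l
    rw [mem_values]
    exact ⟨fun ⟨i, hi, e⟩ => ⟨i, hi, 0, by omega, by simp [e]⟩,
      fun ⟨i, hi, _, _, e⟩ => ⟨i, hi, by simpa using e.symm⟩⟩
  apply WP.seq
  apply WP.block_frame 30 48 (by simp [levelParams, blockOk, Instr.Ok])
    (by simp [levelParams, Instr.Within])
  intro s₁ hs₁ hM₁ hf₁
  have r₁ := (hf₁ 0 0).reg
  have f₁ : LevelFrame k n d 4 s s₁ := (hf₁ Q Q).level (by omega) (by omega) le_rfl (by omega)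
  have e30 : s₁.R 30 = Q + n := by
    simp [← hs₁, levelParams, blockExec, Instr.aexec, hc.r0, hc.r3, hQ]
  have hmr : MergeRegs I n 1 (o * n) (k * n) (Q + 2 * n) (S o) (fun _ => 0) s₁ := by
    refine ⟨hc.frame (hf₁ 0 0) (by omega), ?_, ?_, ?_, ?_, ?_, fun i hi => ?_, fun j hj => ?_⟩
    any_goals simp [← hs₁, levelParams, blockExec, Instr.aexec, hc.r0, hc.r3, hQ]
    · ring
    · ring
    · rw [hs.input.list o ho i hi]
    · obtain rfl : j = 0 := by omega
      rw [Nat.cast_zero, add_zero, hs.input.zero]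
  apply WP.seq
  refine (mergeInit_spec hp hmr).mono ?_
  rintro s₂ t₂ ⟨ht₂, hf₂, hinv, h40, h41⟩
  have f₂ : LevelFrame k n d 4 s₁ s₂ := hf₂.level (by omega) (by omega) (by omega) (by omega)
  apply WP.seq
  refine (fillArray_spec (A := values S n o)
    (J := MergeInv I n 1 (o * n) (k * n) (Q + 2 * n) (S o) (fun _ => 0)) (hi := 54) (dst := Q + n)
    (x := Q + 2 * n) (y := Q + 5 * n) (c := mergeStepTime n) ?_ hn (by omega) (by omega) (by omega)
    (by omega) (by omega) ?_ (fun s Φ h => ⟨h.1.consts.r0, h.1.consts.r3⟩) ?_ hinv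
    (by rw [hf₂.reg _ (by omega), e30]) (by rw [h40, Small]; omega) h41).mono ?_
  · intro l hl
    obtain ⟨i, hi, rfl⟩ := mem_values.1 hl
    exact hI.abs_value_lt ho hi
  · intro t t' Φ hf h
    refine h.congr ⟨h.1.consts.frame hf (by omega), ?_, ?_, ?_, ?_, ?_, fun i hi => ?_,
      fun j hj => ?_⟩ (hf.reg _ (by omega)) (fun x hx _ => hf.mem x (by omega))
    · rw [hf.reg _ (by omega), h.1.r43]
    · rw [hf.reg _ (by omega), h.1.r44]
    · rw [hf.reg _ (by omega), h.1.r45]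
    · rw [hf.reg _ (by omega), h.1.r46]
    · rw [hf.reg _ (by omega), h.1.r47]
    · rw [hf.mem _ (by omega), h.1.a_mem i hi]
    · rw [hf.mem _ (by omega), h.1.b_mem j hj]
  · intro t Φ h hsm
    have := mergeStep_spec hp hA h (by rw [Small] at hsm; rw [InRange]; omega)
    rwa [show Q + 2 * (n : ℤ) + 3 * n = Q + 5 * n by ring] at this
  rintro s₃ t₃ ⟨ht₃, hf₃, -, ⟨m, hm, h31, hch⟩, Φ', hinv', hdone⟩
  have f₃ : LevelFrame k n d 4 s₂ s₃ := hf₃.level (by omega) (by omega) (by omega) (by omega)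
  have f := (f₁.trans f₂).trans f₃
  have hc₃ := (f.ctx hs).consts
  -- Even if the flag of completion is not set, the potential has dropped from `n` to `0`, so every
  -- row has been used.
  have hall : ∀ l ∈ values S n o, l ≤ s₃.R 40 := by
    rcases hdone with h | ⟨-, hΦ⟩
    · exact h.2
    · intro l hl
      obtain ⟨-, q, hT, hq, rfl⟩ := hinv'
      obtain ⟨i, hi, rfl⟩ := mem_values.1 hl
      have h0 : ∑ i ∈ Finset.range n, (1 - q i) = 0 := by omega
      have := Finset.sum_eq_zero_iff.1 h0 i (Finset.mem_range.2 hi)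
      simpa using hq i hi 0 (by omega)
  apply WP.block_frame (regBase k (d + 1) + 4) (regBase k (d + 1 + 1))
    (by simp [blockOk, Instr.Ok]) (by simp [Instr.Within, hb2])
  intro s₄ hs₄ hM₄ hf₄
  refine ⟨?_, f.trans (Frame.level_regs (hf₄ 0 0)), ?_, ?_, ?_, m, hm, ?_, ?_⟩
  · simp only [sortTime, levelParams, List.length_append, List.length_cons, List.length_nil]
    have : n * (mergeStepTime n + 118) = n * (mergeStepTime n + 18) + 100 * n := by ring
    omega
  · simp [← hs₄, blockExec, Instr.aexec, hc₃.r6]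
  · simp [← hs₄, blockExec, Instr.aexec]
  · have q0 : s₃.R 0 = n := hc₃.r0
    have q3 : s₃.R 3 = 1 := hc₃.r3
    simp [← hs₄, blockExec, Instr.aexec, q0, q3, hQ]
  · simp [← hs₄, blockExec, Instr.aexec, h31]
  · rw [hM₄]
    refine ⟨hch.strict, fun l => ?_⟩
    rw [hch.mem_iff, h40]
    refine ⟨fun h => h.1, fun h => ⟨h, ?_, hall l h⟩⟩
    obtain ⟨i, hi, rfl⟩ := mem_values.1 h
    exact (hI.abs_value_lt ho hi).1

/-- Fill the chunk of level `d`. -/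
def chunkFill (k d o : ℕ) (step : Prog) : Prog :=
  .seq (block (levelParams k d o ++ [.move 40 (regBase k (d + 1) + 4),
      .move 41 (regBase k (d + 1) + 5), .move 43 (regBase k (d + 1) + 7)]))
    (.seq (fillArray step) (block [.move (regBase k (d + 1) + 4) 40,
      .move (regBase k (d + 1) + 5) 41, .move (regBase k (d + 1) + 6) 31]))

/-- What `chunkFill` needs to know about the steps of an enumeration. -/
structure StepSpec (I N : ℤ) (k n : ℕ) (S : ℕ → ℕ → ℤ) (d o : ℕ) (A : Finset ℤ)
    (J : ℕ → AState → ℕ → Prop) (step : Prog) (c : ℕ) : Prop where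
  load : ∀ m s s' Φ, J m s Φ → Ctx I k n S s' → s'.R 40 = s.R 40 → s'.R 43 = m →
    s'.R 44 = memBase k n d + 2 * n → s'.R 45 = memBase k n d + 4 * n → s'.R 46 = o * n →
    s'.R 47 = memBase k n d + n →
    (∀ x, memBase k n d + n ≤ x → x < memBase k n (d + 1) → s'.M x = s.M x) → J m s' Φ
  frame : ∀ m s s' Φ, Frame 30 34 (memBase k n d) (memBase k n d + n) s s' → J m s Φ → J m s' Φ
  regs : ∀ m s Φ, J m s Φ → s.R 0 = n ∧ s.R 3 = 1 ∧ s.R 43 = m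
  step : ∀ m s Φ, J m s Φ → Small I (s.R 40) → WP I N step s
    (EnumStep A (J m) (regBase k 0) (memBase k n d + 2 * n) (memBase k n (d + 1)) c s Φ)

/-- The state of an enumeration, as stored between the executions of `chunkFill`. -/
def StoredState (k n d : ℕ) (J : ℕ → AState → ℕ → Prop) (s : AState) (Φ : ℕ) : Prop :=
  ∃ m s₀, J m s₀ Φ ∧ s₀.R 40 = s.R (regBase k (d + 1) + 4) ∧ s.R (regBase k (d + 1) + 7) = m ∧
    ∀ x, memBase k n d ≤ x → x < memBase k n (d + 1) → s.M x = s₀.M x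

/-- All levels share the working registers, so between two chunks an enumeration survives only in
the registers and the memory reserved for its level. `StepSpec.load` guarantees that it can be
resumed from these. -/
theorem chunkSpec_of_stepSpec (hI : Instance I N k n S V) {d o : ℕ}
    (hN : memBase k n (d + 1) ≤ N) {A : Finset ℤ} (hA : ∀ l ∈ A, -I < l ∧ l < I)
    {J : ℕ → AState → ℕ → Prop} {step init : Prog} {c Ti Φ₀ : ℕ}
    (h : StepSpec I N k n S d o A J step c)
    (hinit : ∀ s, Ctx I k n S s → WP I N init s fun s' t => t ≤ Ti ∧ LevelFrame k n d 4 s s' ∧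
      (∃ Φ ≤ Φ₀, StoredState k n d J s' Φ) ∧ s'.R (regBase k (d + 1) + 4) = -I ∧
      s'.R (regBase k (d + 1) + 5) = 0 ∧ s'.R (regBase k (d + 1) + 10) = memBase k n d) :
    ChunkSpec I N k n S d A init (chunkFill k d o step) (StoredState k n d J) Ti
      (n * (c + 18) + 50) Φ₀ := by
  have hn := hI.n_le
  have hn1 := hI.n_pos
  have hQ' := memBase_succ k n d
  have hQ : ((k : ℤ) + 5 * d) * n + 1 = memBase k n d := by rw [memBase]; push_cast; ring
  have hQ0 : 0 ≤ memBase k n d := by rw [memBase]; positivity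
  have hb0 : 72 ≤ regBase k 0 := by simp only [regBase]; omega
  have hb1 : regBase k 0 ≤ regBase k (d + 1) := by simp only [regBase]; omega
  have hb2 : regBase k (d + 1 + 1) = regBase k (d + 1) + 16 := by simp only [regBase]; ring
  refine ⟨?_, hinit, ?_⟩
  · rintro s s' Φ hc' h4 h7 hM ⟨m, s₀, hJ, h40, h43, hM₀⟩
    exact ⟨m, s₀, hJ, by rw [h40, h4], by rw [h7, h43], fun x h1 h2 => by
      rw [hM x h1 h2, hM₀ x h1 h2]⟩
  · rintro s Φ hs ⟨m, s₀, hJ, h40, h43, hM₀⟩ hsm h5 h10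
    have hc := hs.consts
    apply WP.seq
    apply WP.block_frame 30 48 (by simp [levelParams, blockOk, Instr.Ok])
      (by simp [levelParams, Instr.Within])
    intro s₁ hs₁ hM₁ hf₁
    have f₁ : LevelFrame k n d 4 s s₁ :=
      (hf₁ _ _).level (by omega) (by omega) le_rfl (by omega : memBase k n d ≤ _)
    have hne : ∀ i r, r < 50 → regBase k (d + 1) + i ≠ r := by intro i r hr; omega
    have e30 : s₁.R 30 = memBase k n d := by
      simp [← hs₁, levelParams, blockExec, Instr.aexec, hc.r0, hc.r3, hQ]
    have e40 : s₁.R 40 = s.R (regBase k (d + 1) + 4) := by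
      simp [← hs₁, levelParams, blockExec, Instr.aexec, hne]
    have e41 : s₁.R 41 = 0 := by
      simp [← hs₁, levelParams, blockExec, Instr.aexec, hne, h5]
    have hJ₁ : J m s₁ Φ := by
      refine h.load m s₀ s₁ Φ hJ (f₁.ctx hs) (by rw [e40, h40]) ?_ ?_ ?_ ?_ ?_
        (fun x h1 h2 => by rw [hM₁, hM₀ x (by omega) h2])
      · simp [← hs₁, levelParams, blockExec, Instr.aexec, hne, h43]
      all_goals
        simp [← hs₁, levelParams, blockExec, Instr.aexec, hc.r0, hc.r3, hQ]
      · ring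
      · ring
    apply WP.seq
    refine (fillArray_spec hA hn (by omega) (x := memBase k n d + 2 * n) (by omega)
      (by omega) hQ0 (by omega) (h.frame m) (fun s Φ hJ => ⟨(h.regs m s Φ hJ).1, (h.regs m s Φ hJ).2.1⟩)
      (h.step m) hJ₁ e30 (by rw [e40]; exact hsm) e41).mono ?_
    rintro s₂ t₂ ⟨ht₂, hf₂, hsm₂, ⟨cnt, hcnt, h31, hch⟩, Φ', hJ', hdone⟩
    have f₂ : LevelFrame k n d 4 s₁ s₂ := hf₂.level (by omega) le_rfl le_rfl le_rfl
    apply WP.block_frame (regBase k (d + 1) + 4) (regBase k (d + 1) + 7)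
      (by simp [blockOk, Instr.Ok]) (by simp [Instr.Within])
    intro s₃ hs₃ hM₃ hf₃
    have r₃ := (hf₃ 0 0).reg
    have e4 : s₃.R (regBase k (d + 1) + 4) = s₂.R 40 := by
      simp [← hs₃, blockExec, Instr.aexec]
    have e5 : s₃.R (regBase k (d + 1) + 5) = s₂.R 41 := by
      simp [← hs₃, blockExec, Instr.aexec, (hne _ _ _).symm]
    have e6 : s₃.R (regBase k (d + 1) + 6) = s₂.R 31 := by
      simp [← hs₃, blockExec, Instr.aexec, (hne _ _ _).symm]
    have keep : ∀ r, regBase k (d + 1) + 7 ≤ r → s₃.R r = s.R r := fun r hr => by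
      rw [r₃ _ (by omega), hf₂.reg _ (by omega), (hf₁ 0 0).reg _ (by omega)]
    refine ⟨?_, (f₁.trans f₂).trans (Frame.level_regs ((hf₃ 0 0).mono le_rfl (by omega) le_rfl
      le_rfl)), by rw [e4]; exact hsm₂, by rw [keep _ (by omega), h10],
      ⟨cnt, hcnt, by rw [e6, h31], by rw [e4, hM₃, ← e40]; exact hch⟩, Φ',
      ⟨m, s₂, hJ', e4.symm, by rw [keep _ (by omega), h43], fun x _ _ => by rw [hM₃]⟩,
      by rw [e4, e5]; exact hdone⟩
    simp only [levelParams, List.length_append, List.length_cons, List.length_nil]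
    omega

end KSum

/-! ### Merging and searching as levels of the enumeration. -/

namespace KSum

variable {I N : ℤ} {k n : ℕ} {S : ℕ → ℕ → ℤ} {V : ℤ}

/-- Initialize the enumeration of the sums of the lists `o` and `o + 1` by merging. -/
def mergeLevelInit (k d o : ℕ) : Prog :=
  .seq (sortInit k d o)
    (.seq (block (levelParams k d (o + 1) ++ [.move 43 (regBase k (d + 1) + 7)])) mergeInit)

/-- The state of the enumeration of the sums of the lists `o` and `o + 1` by merging, where list `o`
has `m` different elements. -/
def MergeState (I N : ℤ) (k n : ℕ) (S : ℕ → ℕ → ℤ) (d o m : ℕ) (s : AState) (Φ : ℕ) : Prop :=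
  ∃ b, MergeParams I N n m ((o + 1 : ℕ) * n) (memBase k n d + n) (memBase k n d + 2 * n) (S (o + 1)) b ∧
    (∀ l, l ∈ sumset S n o 2 ↔ ∃ i < n, ∃ j < m, l = S (o + 1) i + b j) ∧
    MergeInv I n m ((o + 1 : ℕ) * n) (memBase k n d + n) (memBase k n d + 2 * n) (S (o + 1)) b s Φ

theorem mergeState_stepSpec {d o : ℕ} (ho : o + 1 < k) :
    StepSpec I N k n S d (o + 1) (sumset S n o 2) (MergeState I N k n S d o) mergeStep
      (mergeStepTime n) := by
  have hab := mul_le_memBase (n := n) (d := d) ho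
  have hQ' := memBase_succ k n d
  have hb0 : 72 ≤ regBase k 0 := by simp only [regBase]; omega
  have ho0 : (0 : ℤ) ≤ (o + 1 : ℕ) * n := by positivity
  refine ⟨?_, ?_, ?_, ?_⟩
  · rintro m s s' Φ ⟨b, hp, hA, h⟩ hc h40 h43 h44 h45 h46 h47 hM
    have := hp.bb_le
    refine ⟨b, hp, hA, h.congr ⟨hc.consts, h43, h44, by rw [h45]; ring, h46, h47,
      fun i hi => hc.input.list _ ho i hi, fun j hj => ?_⟩ h40
      fun x h1 h2 => hM x (by omega) (by omega)⟩
    rw [hM _ (by omega) (by omega), h.1.b_mem j hj]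
  · rintro m s s' Φ hf ⟨b, hp, hA, h⟩
    refine ⟨b, hp, hA, h.congr ⟨h.1.consts.frame hf (by omega), ?_, ?_, ?_, ?_, ?_, fun i hi => ?_,
      fun j hj => ?_⟩ (hf.reg _ (by omega)) (fun x hx _ => hf.mem x (by omega))⟩
    · rw [hf.reg _ (by omega), h.1.r43]
    · rw [hf.reg _ (by omega), h.1.r44]
    · rw [hf.reg _ (by omega), h.1.r45]
    · rw [hf.reg _ (by omega), h.1.r46]
    · rw [hf.reg _ (by omega), h.1.r47]
    · rw [hf.mem _ (by omega), h.1.a_mem i hi]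
    · rw [hf.mem _ (by omega), h.1.b_mem j hj]
  · rintro m s Φ ⟨b, hp, hA, h⟩
    exact ⟨h.1.consts.r0, h.1.consts.r3, h.1.r43⟩
  · rintro m s Φ ⟨b, hp, hA, h⟩ hsm
    have := hp.n_le
    refine (mergeStep_spec hp hA h (by rw [Small] at hsm; rw [InRange]; omega)).mono ?_
    rintro s' t ⟨h1, h2, Φ', h3, h4⟩
    exact ⟨h1, h2.mono le_rfl (by omega) le_rfl (by omega), Φ', ⟨b, hp, hA, h3⟩, h4⟩

/-- Only list `o` is sorted. List `o + 1` numbers the rows of the merge, whose order is irrelevant.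
-/
theorem mergeLevelInit_spec (hI : Instance I N k n S V) {d o : ℕ} (ho : o + 1 < k)
    (hN : memBase k n (d + 1) ≤ N) {s : AState} (hs : Ctx I k n S s) :
    WP I N (mergeLevelInit k d o) s fun s' t => t ≤ sortTime n + 100 * n + 130 ∧
      LevelFrame k n d 4 s s' ∧
      (∃ Φ ≤ n * n, StoredState k n d (MergeState I N k n S d o) s' Φ) ∧
      s'.R (regBase k (d + 1) + 4) = -I ∧ s'.R (regBase k (d + 1) + 5) = 0 ∧
      s'.R (regBase k (d + 1) + 10) = memBase k n d := by
  have hn := hI.n_le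
  have hn1 := hI.n_pos
  have hQ' := memBase_succ k n d
  have hab := mul_le_memBase (n := n) (d := d) ho
  have hQ : ((k : ℤ) + 5 * d) * n + 1 = memBase k n d := by rw [memBase]; push_cast; ring
  have hQ0 : 0 ≤ memBase k n d := by rw [memBase]; positivity
  have ho0 : (0 : ℤ) ≤ (o + 1 : ℕ) * n := by positivity
  have hb0 : 72 ≤ regBase k 0 := by simp only [regBase]; omega
  have hb1 : regBase k 0 ≤ regBase k (d + 1) := by simp only [regBase]; omega
  apply WP.seq
  refine (sortInit_spec hI (by omega) hN hs).mono ?_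
  rintro s₁ t₁ ⟨ht₁, f₁, e4, e5, e10, m, hm, e7, hB⟩
  have hs₁ := f₁.ctx hs
  have hc := hs₁.consts
  have hval : ∀ j < m, s₁.M (memBase k n d + n + j) ∈ values S n o := fun j hj =>
    (hB.mem_iff _).1 ⟨j, hj, rfl⟩
  have hmem : ∀ l, l ∈ sumset S n o 2 ↔
      ∃ i < n, ∃ j < m, l = S (o + 1) i + s₁.M (memBase k n d + n + j) := by
    intro l
    rw [mem_sumset_succ]
    constructor
    · rintro ⟨i, hi, x, hx, rfl⟩
      obtain ⟨i', hi', z, hz, rfl⟩ := mem_sumset_succ.1 hx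
      obtain ⟨j, hj, e⟩ := (hB.mem_iff _).2 (mem_values.2 ⟨i, hi, rfl⟩)
      have hz : z = 0 := by simpa [sumset] using hz
      exact ⟨i', hi', j, hj, by rw [e, hz]; ring⟩
    · rintro ⟨i, hi, j, hj, rfl⟩
      obtain ⟨i', hi', e⟩ := mem_values.1 (hval j hj)
      exact ⟨i', hi', S (o + 1) i, mem_sumset_succ.2 ⟨i, hi, 0, by simp [sumset], add_zero _⟩,
        by rw [e]; ring⟩
  have hp : MergeParams I N n m ((o + 1 : ℕ) * n) (memBase k n d + n) (memBase k n d + 2 * n)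
      (S (o + 1)) (fun j => s₁.M (memBase k n d + n + j)) :=
    ⟨hn1, hB.pos hn1, hn, by omega, ho0, by omega, by omega, by omega, by omega,
      fun i hi j hj => hI.abs_sumset_lt (o := o) (d := 2) (by omega)
        ((hmem _).2 ⟨i, hi, j, hj, rfl⟩), hB.mono⟩
  apply WP.seq
  apply WP.block_frame 30 48 (by simp [levelParams, blockOk, Instr.Ok])
    (by simp [levelParams, Instr.Within])
  intro s₂ hs₂ hM₂ hf₂
  have f₂ : LevelFrame k n d 4 s₁ s₂ :=
    (hf₂ _ _).level (by omega) (by omega) le_rfl (by omega : memBase k n d ≤ _)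
  have hne : ∀ i r, r < 50 → regBase k (d + 1) + i ≠ r := by intro i r hr; omega
  have hmr : MergeRegs I n m ((o + 1 : ℕ) * n) (memBase k n d + n) (memBase k n d + 2 * n)
      (S (o + 1)) (fun j => s₁.M (memBase k n d + n + j)) s₂ := by
    refine ⟨hc.frame (hf₂ 0 0) (by omega), ?_, ?_, ?_, ?_, ?_, fun i hi => ?_, fun j hj => ?_⟩
    · simp [← hs₂, levelParams, blockExec, Instr.aexec, hne, e7]
    · simp [← hs₂, levelParams, blockExec, Instr.aexec, hc.r0, hc.r3, hQ]; ring
    · simp [← hs₂, levelParams, blockExec, Instr.aexec, hc.r0, hc.r3, hQ]; ring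
    · simp [← hs₂, levelParams, blockExec, Instr.aexec, hc.r0]
    · simp [← hs₂, levelParams, blockExec, Instr.aexec, hc.r0, hc.r3, hQ]
    · rw [hM₂, hs₁.input.list _ ho i hi]
    · rw [hM₂]
  refine (mergeInit_spec hp hmr).mono ?_
  rintro s₃ t₃ ⟨ht₃, hf₃, hinv, h40, h41⟩
  have f₃ : LevelFrame k n d 4 s₂ s₃ := hf₃.level (by omega) (by omega) (by omega) (by omega)
  have keep : ∀ r, regBase k 0 ≤ r → s₃.R r = s₁.R r := fun r hr => by
    rw [hf₃.reg _ (by omega), (hf₂ 0 0).reg _ (by omega)]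
  refine ⟨?_, (f₁.trans f₂).trans f₃, ⟨n * m, Nat.mul_le_mul_left _ hm, m, s₃, ⟨_, hp, hmem, hinv⟩,
    by rw [h40, keep _ (by omega), e4], by rw [keep _ (by omega), e7], fun _ _ _ => rfl⟩,
    by rw [keep _ (by omega), e4], by rw [keep _ (by omega), e5], by rw [keep _ (by omega), e10]⟩
  simp only [levelParams, List.length_append, List.length_cons, List.length_nil]
  omega

/-- The state of the enumeration of the sums of the lists `o, …, o + e` by search. -/
def SearchState (I : ℤ) (k n : ℕ) (S : ℕ → ℕ → ℤ) (d o e m : ℕ) (s : AState) (Φ : ℕ) : Prop :=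
  m ≤ n ∧ SearchInv I k n S o e (memBase k n d + n) m s Φ

theorem searchState_stepSpec (hI : Instance I N k n S V) {d o e : ℕ} (ho : o + (e + 1) ≤ k)
    (hN : memBase k n (d + 1) ≤ N) :
    StepSpec I N k n S d o (sumset S n o (e + 1)) (SearchState I k n S d o e) (searchStep o e)
      (searchStepTime n e) := by
  have hQ' := memBase_succ k n d
  have hQ0 : 0 ≤ memBase k n d := by rw [memBase]; positivity
  have hb0 : 72 + 4 * k = regBase k 0 := by simp only [regBase]; omega
  have sorted : ∀ {m : ℕ} {M M' : ℤ → ℤ}, m ≤ n → SortedValues S n o (memBase k n d + n) m M →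
      (∀ x, memBase k n d + n ≤ x → x < memBase k n (d + 1) → M' x = M x) →
      SortedValues S n o (memBase k n d + n) m M' := by
    intro m M M' hm h hM
    have e : ∀ i < m, M' (memBase k n d + n + i) = M (memBase k n d + n + i) := fun i hi =>
      hM _ (by omega) (by omega)
    refine ⟨fun i j hij hj => ?_, fun l => ?_⟩
    · rw [e i (by omega), e j hj]; exact h.strict i j hij hj
    · rw [← h.mem_iff]
      exact ⟨fun ⟨i, hi, h⟩ => ⟨i, hi, by rw [← e i hi, h]⟩,
        fun ⟨i, hi, h⟩ => ⟨i, hi, by rw [e i hi, h]⟩⟩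
  refine ⟨?_, ?_, ?_, ?_⟩
  · rintro m s s' Φ ⟨hm, h⟩ hc h40 h43 h44 h45 h46 h47 hM
    exact ⟨hm, hc.consts, h43, h47, hc.input, sorted hm h.sorted hM, by rw [h40]; exact h.left⟩
  · rintro m s s' Φ hf ⟨hm, h⟩
    have hc : Ctx I k n S s' := Ctx.congr ⟨h.consts, h.input⟩ (fun r hr => hf.reg r (by omega))
      (fun x hx => hf.mem x (Or.inl (hx.trans_le (memBase_mono k n (by omega)))))
    exact ⟨hm, hc.consts, by rw [hf.reg _ (by omega), h.r43], by rw [hf.reg _ (by omega), h.r47],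
      hc.input, sorted hm h.sorted (fun x hx _ => hf.mem x (by omega)),
      by rw [hf.reg _ (by omega)]; exact h.left⟩
  · rintro m s Φ ⟨hm, h⟩
    exact ⟨h.consts.r0, h.consts.r3, h.r43⟩
  · rintro m s Φ ⟨hm, h⟩ hsm
    refine (searchStep_spec hI ho (by omega) (by omega) hm (hi := regBase k 0) (by omega)
      (memBase k n (d + 1)) h hsm).mono ?_
    rintro s' t ⟨h1, h2, Φ', h3, h4⟩
    exact ⟨h1, h2.mono le_rfl le_rfl (by omega) le_rfl, Φ', ⟨hm, h3⟩, h4⟩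

theorem searchInit_spec (hI : Instance I N k n S V) {d o e : ℕ} (ho : o + (e + 1) ≤ k)
    (hN : memBase k n (d + 1) ≤ N) {s : AState} (hs : Ctx I k n S s) :
    WP I N (sortInit k d o) s fun s' t => t ≤ sortTime n ∧ LevelFrame k n d 4 s s' ∧
      (∃ Φ ≤ n ^ (e + 1), StoredState k n d (SearchState I k n S d o e) s' Φ) ∧
      s'.R (regBase k (d + 1) + 4) = -I ∧ s'.R (regBase k (d + 1) + 5) = 0 ∧
      s'.R (regBase k (d + 1) + 10) = memBase k n d := by
  refine (sortInit_spec hI (by omega) hN hs).mono ?_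
  rintro s₁ t₁ ⟨ht₁, f₁, e4, e5, e10, m, hm, e7, hB⟩
  have hs₁ := f₁.ctx hs
  -- A stored state refers to some full state of the enumeration; the witness is the current one
  -- with the threshold, the length and the address of the sorted list put into their working
  -- registers.
  refine ⟨ht₁, f₁, ⟨((sumset S n o (e + 1)).filter (-I < ·)).card,
    (Finset.card_filter_le _ _).trans (card_sumset_le _ _), m,
    ((s₁.set 40 (-I)).set 43 m).set 47 (memBase k n d + n), ⟨hm, ?_, by simp, by simp,
      hs₁.input, hB, by simp⟩, by simp [e4], e7, fun _ _ _ => rfl⟩, e4, e5, e10⟩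
  have hc := hs₁.consts
  constructor <;> simp [hc.r0, hc.r2, hc.r3, hc.r4, hc.r5, hc.r6]

/-! ### The enumeration for a list of groups -/

/-- Execute a program for all sums of elements of the lists of the groups in an interval. -/
def enumerate (k : ℕ) : List Level → Prog → Prog
  | [] => enumEmpty k
  | .free :: L => enumFree k (numLists L) L.length (enumerate k L)
  | .merge :: L => chunkLevel k L.length (mergeLevelInit k L.length (numLists L))
      (chunkFill k L.length (numLists L + 1) mergeStep) (enumerate k L)
  | .search e :: L => chunkLevel k L.length (sortInit k L.length (numLists L))
      (chunkFill k L.length (numLists L) (searchStep (numLists L) e)) (enumerate k L)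

/-- A bound on the number of steps of `enumerate` per enumerated sum. -/
def itemCost (n : ℕ) : List Level → ℕ
  | [] => 0
  | .free :: L => itemCost n L + 4
  | _ :: L => itemCost n L + scanTime n + 13

/-- A bound on the number of the other steps of `enumerate`. -/
def baseCost (n : ℕ) : List Level → ℕ
  | [] => 10
  | .free :: L => n * (baseCost n L + 19) + 5
  | .merge :: L => sortTime n + 100 * n + 130 +
      (n + 1) * (n * (mergeStepTime n + 18) + 50 + baseCost n L + 30) +
      (itemCost n L + scanTime n) * n ^ numLists L + 10
  | .search e :: L => sortTime n +
      (n ^ e + 1) * (n * (searchStepTime n e + 18) + 50 + baseCost n L + 30) +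
      (itemCost n L + scanTime n) * n ^ numLists L + 10

/-- The initial potentials are at most `n * n` for merging and `n ^ (e + 1)` for searching, so that
at most `n + 1` and `n ^ e + 1` chunks occur. -/
theorem enumerate_spec (hI : Instance I N k n S V) {L : List Level} (hL : numLists L ≤ k)
    (hN : memBase k n L.length ≤ N) :
    Enumerates I N k n S V L (enumerate k L) (baseCost n L) (itemCost n L) := by
  induction L with
  | nil => exact enumEmpty_spec hI
  | cons a L ih =>
    have hL' := hL
    rw [numLists] at hL'
    have := ih (by omega) ((memBase_mono k n (by simp)).trans hN)
    rw [List.length_cons] at hN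
    have hA : ∀ l ∈ sumset S n (numLists L) a.size, -I < l ∧ l < I := fun l hl =>
      hI.abs_sumset_lt hL' hl
    cases a with
    | free => exact enumFree_spec hI hL this
    | merge =>
      exact chunkLevel_spec hI (fun _ => rfl) hL hN this
        (chunkSpec_of_stepSpec hI hN hA (mergeState_stepSpec (N := N) (by simp [Level.size] at hL'; omega))
          fun s hs => mergeLevelInit_spec hI (by simp [Level.size] at hL'; omega) hN hs) le_rfl
    | search e =>
      exact chunkLevel_spec hI (fun _ => rfl) hL hN this
        (chunkSpec_of_stepSpec hI hN hA (searchState_stepSpec hI hL' hN)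
          fun s hs => searchInit_spec hI hL' hN hs) (by rw [pow_succ'])

end KSum

namespace KSum

variable {I N : ℤ} {k n : ℕ} {S : ℕ → ℕ → ℤ} {V : ℤ}

/-! ### The algorithm -/

/-- Copy `m` registers. -/
def copyRegs (dst src : ℕ → ℕ) (m : ℕ) : List Instr :=
  (List.range m).map fun i => .move (dst i) (src i)

theorem blockExec_append (l l' : List Instr) (s : AState) :
    blockExec I (l ++ l') s = blockExec I l' (blockExec I l s) := by
  induction l generalizing s with
  | nil => rfl
  | cons i l ih => exact ih _

theorem blockOk_append {l l' : List Instr} {s : AState} (h : blockOk I N l s)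
    (h' : blockOk I N l' (blockExec I l s)) : blockOk I N (l ++ l') s := by
  induction l generalizing s with
  | nil => exact h'
  | cons i l ih => exact ⟨h.1, ih h.2 h'⟩

theorem copyRegs_ok (dst src : ℕ → ℕ) (m : ℕ) (s : AState) :
    blockOk I N (copyRegs dst src m) s := by
  induction m generalizing s with
  | zero => trivial
  | succ m ih =>
    rw [copyRegs, List.range_succ, List.map_append]
    exact blockOk_append (ih s) ⟨trivial, trivial⟩

theorem copyRegs_exec {dst src : ℕ → ℕ} {m : ℕ} (hinj : ∀ i < m, ∀ j < m, dst i = dst j → i = j)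
    (hds : ∀ i < m, ∀ j < m, dst i ≠ src j) (s : AState) :
    (blockExec I (copyRegs dst src m) s).M = s.M ∧
    (∀ i < m, (blockExec I (copyRegs dst src m) s).R (dst i) = s.R (src i)) ∧
    ∀ r, (∀ i < m, r ≠ dst i) → (blockExec I (copyRegs dst src m) s).R r = s.R r := by
  induction m with
  | zero => exact ⟨rfl, by simp, fun _ _ => rfl⟩
  | succ m ih =>
    obtain ⟨h1, h2, h3⟩ := ih (fun i hi j hj => hinj i (by omega) j (by omega))
      (fun i hi j hj => hds i (by omega) j (by omega))
    have e : blockExec I (copyRegs dst src (m + 1)) s = (blockExec I (copyRegs dst src m) s).set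
        (dst m) ((blockExec I (copyRegs dst src m) s).R (src m)) := by
      rw [copyRegs, List.range_succ, List.map_append, blockExec_append]; rfl
    rw [e]
    refine ⟨h1, fun i hi => ?_, fun r hr => ?_⟩
    · rw [AState.set_R]
      by_cases him : i = m
      · subst him
        rw [if_pos rfl, h3 _ fun j hj => (hds j (by omega) i (by omega)).symm]
      · rw [if_neg fun h => him (hinj i hi m (by omega) h), h2 i (by omega)]
    · rw [AState.set_R, if_neg (hr m (by omega)), h3 r fun i hi => hr i (by omega)]

@[simp] theorem copyRegs_length (dst src : ℕ → ℕ) (m : ℕ) : (copyRegs dst src m).length = m := by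
  simp [copyRegs]

/-- The numbers `g` decompose `x` into sums of elements of the lists of the groups. -/
def Decomposes (S : ℕ → ℕ → ℤ) (n : ℕ) : List Level → (ℕ → ℤ) → ℤ → Prop
  | [], _, x => x = 0
  | a :: L, g, x => g L.length ∈ sumset S n (numLists L) a.size ∧ Decomposes S n L g (x - g L.length)

theorem Decomposes.congr {L : List Level} {g g' : ℕ → ℤ} {x : ℤ} (h : Decomposes S n L g x)
    (hg : ∀ i < L.length, g' i = g i) : Decomposes S n L g' x := by
  induction L generalizing x with
  | nil => exact h
  | cons a L ih =>
    rw [Decomposes, hg _ (by simp)]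
    exact ⟨h.1, ih h.2 fun i hi => hg i (by simp; omega)⟩

theorem ValidRegs.decomposes {L : List Level} {s : AState} (h : ValidRegs S k n L s) :
    Decomposes S n L (fun d => s.R (regBase k (d + 1) + 3)) (s.R (regBase k L.length + 2)) := by
  induction L with
  | nil => exact h
  | cons a L ih =>
    refine ⟨h.2.1, ?_⟩
    rw [List.length_cons, h.2.2, add_sub_cancel_left]
    exact ih h.1

theorem sum_mem_sums {L : List Level} {js : ℕ → ℕ} (h : ∀ i < numLists L, js i < n) :
    ∑ i ∈ Finset.range (numLists L), S i (js i) ∈ sums S n L := by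
  induction L with
  | nil => simp [numLists, sums]
  | cons a L ih =>
    rw [numLists] at h ⊢
    refine mem_sums_cons.2 ⟨∑ r ∈ Finset.range a.size, S (numLists L + r) (js (numLists L + r)),
      mem_sumset.2 ⟨fun r => js (numLists L + r), fun r hr => h _ (by omega), rfl⟩, _,
      ih fun i hi => h i (by omega), ?_⟩
    rw [Finset.sum_range_add, add_comm]

/-- Find positions in the lists from `o` on of `d` elements whose sum is in register `g`, and put
them into the registers from `res + o` on. -/
def recoverGroup (g res o d : ℕ) : Prog :=
  .seq (block [.const 64 0]) (nest o 0 d (.ite (.eq (64 + 4 * d) g)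
    (block (copyRegs (fun r => res + o + r) (fun r => 65 + 4 * r) d)) .skip))

/-- The enumeration forgets positions, and they are found again by trying all tuples of the group.
This is affordable because only the sum of this one group has to be matched. -/
theorem recoverGroup_spec (hI : Instance I N k n S V) {g res o d : ℕ} (hd : o + d ≤ k)
    (hg : 65 + 4 * d ≤ g) (hres : g < res) {s : AState} (hs : Ctx I k n S s)
    (hl : s.R g ∈ sumset S n o d) :
    WP I N (recoverGroup g res o d) s fun s' t => t ≤ nestTime n (2 * d + 2) d + 4 ∧
      Ctx I k n S s' ∧
      (∀ r, 65 + 4 * d ≤ r → r < res + o ∨ res + o + d ≤ r → s'.R r = s.R r) ∧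
      ∃ js : ℕ → ℕ, (∀ r < d, js r < n ∧ s'.R (res + o + r) = js r) ∧
        ∑ r ∈ Finset.range d, S (o + r) (js r) = s.R g := by
  obtain ⟨l, hl'⟩ : ∃ l, l = s.R g := ⟨_, rfl⟩
  have hn := hI.n_le
  have hlI := hI.abs_sumset_lt hd hl
  rw [← hl'] at hl hlI ⊢
  have hon : ((o + d : ℕ) : ℤ) * n ≤ k * n :=
    mul_le_mul_of_nonneg_right (by exact_mod_cast hd) (by positivity)
  apply WP.seq
  apply WP.block_frame 64 65 (by simp [blockOk, Instr.Ok]) (by simp [Instr.Within])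
  intro s₁ hs₁ hM₁ hf₁
  have r₁ := (hf₁ 0 0).reg
  have e64 : s₁.R (64 + 4 * 0) = 0 := by simp [← hs₁, blockExec, Instr.aexec]
  have hk := hI.mem_le
  refine (nest_spec (I := I) (N := N) (S := S) (n := n) (M := s.M)
    (Seen := fun x s' => x = l → ∃ js : ℕ → ℕ, (∀ r < d, js r < n ∧ s'.R (res + o + r) = js r) ∧
      ∑ r ∈ Finset.range d, S (o + r) (js r) = l) (c := 2 * d + 2) (e := d) hn d o 0 0
    (fun s' => ∀ r, 65 + 4 * d ≤ r → r < res + o ∨ res + o + d ≤ r → s'.R r = s.R r) (by omega)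
    (fun r hr j hj => hs.input.list _ (by omega) j hj) (by omega) ?_ ?_ ?_ s₁
    (fun r hr _ => r₁ r (by omega)) (by rw [r₁ _ (by omega), hs.consts.r0])
    (by rw [r₁ _ (by omega), hs.consts.r3]) hM₁ e64).mono ?_
  · intro t t' hf _ h r hr hr'
    rw [hf.reg r (by omega), h r hr hr']
  · intro t t' x hf _ h hx
    obtain ⟨js, hjs, e⟩ := h hx
    exact ⟨js, fun r hr => ⟨(hjs r hr).1, by rw [hf.reg _ (by omega), (hjs r hr).2]⟩, e⟩
  · intro t x js ht h0 h3 hM hx hjs hxs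
    have htg : t.R g = l := by rw [ht g hg (by omega), hl']
    rw [zero_add] at hxs
    have hxm : x ∈ sumset S n o d := mem_sumset.2 ⟨js, fun r hr => (hjs r hr).1, hxs⟩
    have hxI := hI.abs_sumset_lt hd hxm
    refine WP.ite (by simp only [Test.Ok, InRange, hx, htg]; omega) (fun hb => ?_) (fun hb => ?_)
    · have hxl : x = l := by simpa [Test.Holds, hx, htg] using hb
      apply WP.block (copyRegs_ok _ _ _ _)
      obtain ⟨c1, c2, c3⟩ := copyRegs_exec (I := I) (dst := fun r => res + o + r)
        (src := fun r => 65 + 4 * r) (m := d) (fun i _ j _ => by simp)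
        (fun i hi j hj => by omega) t
      -- A further tuple with the sum `l` overwrites the result, but again with valid positions; so
      -- `good` also re-establishes what had been seen before.
      have good : ∃ js' : ℕ → ℕ, (∀ r < d, js' r < n ∧ (blockExec I (copyRegs
          (fun r => res + o + r) (fun r => 65 + 4 * r) d) t).R (res + o + r) = js' r) ∧
          ∑ r ∈ Finset.range d, S (o + r) (js' r) = l := by
        refine ⟨js, fun r hr => ⟨(hjs r hr).1, ?_⟩, by rw [← hxs, hxl]⟩
        have := (hjs r hr).2
        rw [zero_add] at this
        rw [c2 r hr, this]
      refine ⟨by simp, fun r hr hr' => ?_, fun _ => good, fun _ _ _ => good, fun r hr => ?_, c1⟩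
      · rw [c3 r fun i hi => by omega, ht r hr hr']
      · exact c3 r fun i hi => by omega
    · have hxl : x ≠ l := by simpa [Test.Holds, hx, htg] using hb
      exact WP.skip ⟨by omega, ht, fun h => absurd h hxl, fun _ h => h, fun _ _ => rfl, rfl⟩
  · rintro s₂ t ⟨ht, hinv, hseen, -, hk⟩
    refine ⟨?_, hs.congr (fun r hr => ?_) (fun x _ => by rw [hk.mem, hM₁]), hinv,
      hseen l hl (zero_add l)⟩
    · simp only [List.length_cons, List.length_nil]; omega
    · rw [hk.reg r (by omega), r₁ r (by omega)]

/-- Find positions of elements for the sums in the registers from `g` on. -/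
def recoverAll (g res : ℕ) : List Level → Prog
  | [] => .skip
  | a :: L => .seq (recoverGroup (g + L.length) res (numLists L) a.size) (recoverAll g res L)

/-- A bound on the number of steps of `recoverAll`. -/
def recoverTime (n : ℕ) : List Level → ℕ
  | [] => 1
  | a :: L => nestTime n (2 * a.size + 2) a.size + 5 + recoverTime n L

theorem recoverAll_spec (hI : Instance I N k n S V) {g res : ℕ} {L : List Level}
    (hL : numLists L ≤ k) (hg : 65 + 4 * k ≤ g) (hres : g + L.length ≤ res) {x : ℤ} {s : AState}
    (hs : Ctx I k n S s) (hx : Decomposes S n L (fun d => s.R (g + d)) x) :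
    WP I N (recoverAll g res L) s fun s' t => t ≤ recoverTime n L ∧
      (∀ r, 65 + 4 * k ≤ r → r < res ∨ res + numLists L ≤ r → s'.R r = s.R r) ∧
      ∃ js : ℕ → ℕ, (∀ i < numLists L, js i < n ∧ s'.R (res + i) = js i) ∧
        ∑ i ∈ Finset.range (numLists L), S i (js i) = x := by
  induction L generalizing s x with
  | nil => exact WP.skip ⟨le_rfl, fun _ _ _ => rfl, fun _ => 0, by simp [numLists], by
      simpa [numLists] using Eq.symm hx⟩
  | cons a L ih =>
    rw [numLists] at hL ⊢
    rw [List.length_cons] at hres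
    apply WP.seq
    refine (recoverGroup_spec hI hL (by omega) (by omega) hs hx.1).mono ?_
    rintro s₁ t₁ ⟨ht₁, hs₁, hr₁, js₁, hjs₁, hsum₁⟩
    refine (ih (by omega) (by omega) hs₁ (hx.2.congr fun i hi => ?_)).mono ?_
    · exact hr₁ _ (by omega) (by omega)
    · rintro s₂ t₂ ⟨ht₂, hr₂, js₂, hjs₂, hsum₂⟩
      refine ⟨by rw [recoverTime]; omega, fun r hr hr' => ?_,
        fun i => if i < numLists L then js₂ i else js₁ (i - numLists L), fun i hi => ?_, ?_⟩
      · rw [hr₂ r hr (by omega), hr₁ r (by omega) (by omega)]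
      · by_cases h : i < numLists L
        · simpa only [if_pos h] using hjs₂ i h
        · simp only [if_neg h]
          have := hjs₁ (i - numLists L) (by omega)
          rw [show res + numLists L + (i - numLists L) = res + i by omega] at this
          exact ⟨this.1, by rw [hr₂ _ (by omega) (by omega), this.2]⟩
      · rw [Finset.sum_range_add]
        have e1 : ∑ i ∈ Finset.range (numLists L), S i (if i < numLists L then js₂ i else
            js₁ (i - numLists L)) = x - s.R (g + L.length) := by
          rw [← hsum₂]
          refine Finset.sum_congr rfl fun i hi => ?_
          rw [if_pos (Finset.mem_range.1 hi)]
        have e2 : ∑ i ∈ Finset.range a.size, S (numLists L + i) (if numLists L + i < numLists L then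
            js₂ (numLists L + i) else js₁ (numLists L + i - numLists L)) = s.R (g + L.length) := by
          rw [← hsum₁]
          refine Finset.sum_congr rfl fun i hi => ?_
          rw [if_neg (by omega), Nat.add_sub_cancel_left]
        rw [e1, e2, sub_add_cancel]

/-- Record a solution: copy the sums of the groups to the registers from `g + 1` on, and set
register `g` to `1`. -/
def record (k g d : ℕ) : List Instr :=
  copyRegs (fun i => g + 1 + i) (fun i => regBase k (i + 1) + 3) d ++ [.const g 1]

/-- The algorithm for `k` lists that processes the groups `L`. -/
def solve (k : ℕ) (L : List Level) : Prog :=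
  .seq (block [.const 2 0, .const 3 1, .const 4 2, .bin .sub 20 2 3, .const 21 4,
      .bin .div 5 20 21, .bin .sub 6 2 5, .move (regBase k L.length) 1,
      .move (regBase k L.length + 1) 1, .const (regBase k (L.length + 1)) 0])
    (.seq (enumerate k L (block (record k (regBase k (L.length + 1)) L.length)))
      (.ite (.eq (regBase k (L.length + 1)) 3)
        (.seq (recoverAll (regBase k (L.length + 1) + 1) (regBase k (L.length + 1) + 1 + L.length) L)
          (block (copyRegs (fun i => i + 1) (fun i => regBase k (L.length + 1) + 1 + L.length + i) k
            ++ [.const 0 1])))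
        (block [.const 0 0])))

/-- The exponent in a bound on the number of sums with a given value that are enumerated. -/
def multExponent : List Level → ℕ
  | [] => 0
  | .free :: L => multExponent L + 1
  | _ :: L => numLists L

/-- In a group processed by chunks, the summand is determined by the sum `r` of the other groups, so
at most `n ^ numLists L` decompositions of `x` are visited. A free group multiplies the count by
`n`. -/
theorem weight_eq_le (L : List Level) (x : ℤ) (B : ℕ) :
    weight S n L (fun y => if x ≤ y ∧ y ≤ x then B else 0) ≤ B * n ^ multExponent L := by
  have key : ∀ (x : ℤ) (A : Finset ℤ) (L : List Level), ∑ l ∈ A, weight S n L (fun r =>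
      if x ≤ l + r ∧ l + r ≤ x then B else 0) ≤ B * n ^ numLists L := by
    intro x A L
    rw [← weight_sum]
    refine (weight_mono L fun r => ?_).trans (weight_const_le L B)
    have : ∀ l ∈ A, (if x ≤ l + r ∧ l + r ≤ x then B else 0) = if l = x - r then B else 0 := by
      intro l _
      congr 1
      exact propext ⟨fun h => by omega, fun h => by omega⟩
    rw [Finset.sum_congr rfl this, Finset.sum_ite_eq']
    split_ifs <;> omega
  induction L generalizing x with
  | nil => simp only [weight, multExponent]; split_ifs <;> simp
  | cons a L ih =>
    cases a with
    | free =>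
      simp only [weight, multExponent]
      calc _ ≤ ∑ _j ∈ Finset.range n, B * n ^ multExponent L := by
            refine Finset.sum_le_sum fun j _ => ?_
            have e : (fun r => if x ≤ S (numLists L) j + r ∧ S (numLists L) j + r ≤ x then B else 0) =
                fun r => if x - S (numLists L) j ≤ r ∧ r ≤ x - S (numLists L) j then B else 0 := by
              funext r
              congr 1
              exact propext ⟨fun h => by omega, fun h => by omega⟩
            rw [e]
            exact ih _
        _ = B * n ^ (multExponent L + 1) := by
            rw [Finset.sum_const, Finset.card_range, smul_eq_mul, pow_succ]; ring
    | merge => exact key _ _ L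
    | search e => exact key _ _ L

/-- A bound on the number of steps of `solve`. -/
def solveTime (k n : ℕ) (L : List Level) : ℕ :=
  baseCost n L + (itemCost n L + (2 * L.length + 3)) * n ^ multExponent L + recoverTime n L +
    2 * k + 40

theorem solve_spec (hI : Instance I N k n S V) {L : List Level} (hL : numLists L = k)
    (hN : memBase k n L.length ≤ N) {t : ℤ} (ht : |t| + k * V < I) {s : AState}
    (h0 : s.R 0 = n) (h1 : s.R 1 = t) (hM : InputMem k n S s.M) :
    WP I N (solve k L) s fun s' m => m ≤ solveTime k n L ∧
      ((s'.R 0 = 1 ∧ ∃ js : ℕ → ℕ, (∀ i < k, js i < n ∧ s'.R (i + 1) = js i) ∧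
        ∑ i ∈ Finset.range k, S i (js i) = t) ∨ (s'.R 0 = 0 ∧ t ∉ sums S n L)) := by
  have hn := hI.n_le
  have hn1 := hI.n_pos
  obtain ⟨u, hu⟩ : ∃ u, u = regBase k L.length := ⟨_, rfl⟩
  obtain ⟨g, hg⟩ : ∃ g, g = regBase k (L.length + 1) := ⟨_, rfl⟩
  have hgu : g = u + 16 := by rw [hg, hu]; simp only [regBase]; ring
  have hu0 : 72 + 4 * k ≤ u := by rw [hu]; simp only [regBase]; omega
  have hgd : g = 72 + 4 * k + 16 * (L.length + 1) := by rw [hg, regBase]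
  rw [solve, ← hu, ← hg]
  apply WP.seq
  apply WP.block
  · simp [blockOk, Instr.Ok, Instr.aexec]
  obtain ⟨s₁, hs₁⟩ : ∃ s₁, s₁ = blockExec I [.const 2 0, .const 3 1, .const 4 2, .bin .sub 20 2 3,
      .const 21 4, .bin .div 5 20 21, .bin .sub 6 2 5, .move u 1, .move (u + 1) 1, .const g 0] s :=
    ⟨_, rfl⟩
  rw [← hs₁]
  have hlow : ∀ r, r < 72 → s₁.R r = (((((((s.set 2 0).set 3 1).set 4 2).set 20 (-1)).set 21 4).set
      5 I).set 6 (-I)).R r := by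
    intro r hr
    simp [hs₁, blockExec, Instr.aexec, show r ≠ g by omega, show r ≠ u + 1 by omega,
      show r ≠ u by omega]
  have eM : s₁.M = s.M := by simp [hs₁, blockExec, Instr.aexec]
  have eg : s₁.R g = 0 := by simp [hs₁, blockExec, Instr.aexec]
  have eu : s₁.R u = t := by
    simp [hs₁, blockExec, Instr.aexec, h1, show u ≠ g by omega]
  have eu' : s₁.R (u + 1) = t := by
    simp [hs₁, blockExec, Instr.aexec, h1, show u + 1 ≠ g by omega, show 1 ≠ u by omega]
  have hc₁ : Ctx I k n S s₁ := by
    refine ⟨⟨?_, ?_, ?_, ?_, ?_, ?_⟩, by rw [eM]; exact hM⟩ <;> rw [hlow _ (by omega)] <;> simp [h0]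
  apply WP.seq
  -- The interval is `[t, t]`. `Seen` only says that the flag `R g` is set; the invariant says that
  -- a set flag comes with group sums of total `t`. Later hits may overwrite them.
  refine (enumerate_spec hI hL.le hN (block (record k g L.length))
    (fun s' => s'.R g = 0 ∨ s'.R g = 1 ∧ Decomposes S n L (fun d => s'.R (g + 1 + d)) t)
    (fun _ s' => s'.R g = 1) (fun _ => 2 * L.length + 3) t t (by rw [hL]; exact ht)
    (by rw [hL]; exact ht) ?_ ?_ ?_ s₁ hc₁ (Or.inl eg) (by rw [← hu, eu]) (by rw [← hu, eu'])).mono ?_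
  · intro a b hr _ h
    rw [← hg] at hr
    rw [hr g le_rfl]
    exact h.imp id fun h => ⟨h.1, h.2.congr fun d _ => hr _ (by omega)⟩
  · intro x a b hr _ h
    rw [← hg] at hr
    rw [hr g le_rfl, h]
  · intro a x ha _ hval hx h1 h2
    obtain rfl : x = t := by omega
    rw [record]
    refine WP.block ?_ ?_
    · exact blockOk_append (copyRegs_ok _ _ _ _) ⟨trivial, trivial⟩
    rw [blockExec_append]
    obtain ⟨c1, c2, c3⟩ := copyRegs_exec (I := I) (dst := fun i => g + 1 + i)
      (src := fun i => regBase k (i + 1) + 3) (m := L.length) (fun i _ j _ => by simp)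
      (fun i hi j hj => by simp only [regBase]; omega) a
    have hd := hval.decomposes
    rw [hx] at hd
    refine ⟨by simp; omega, Or.inr ⟨by simp [blockExec, Instr.aexec], hd.congr fun i hi => ?_⟩,
      by simp [blockExec, Instr.aexec], fun _ _ => by simp [blockExec, Instr.aexec], fun r hr => ?_,
      fun y _ => ?_⟩
    · simp only [blockExec, Instr.aexec, AState.set_R]
      rw [if_neg (by omega), c2 i hi]
    · simp only [blockExec, Instr.aexec, AState.set_R]
      rw [← hg] at hr
      rw [if_neg (by omega), c3 r fun i hi => by omega]
    · simp only [blockExec, Instr.aexec, AState.set_M, c1]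
  rintro s₂ t₂ ⟨ht₂, hc₂, hfound, hseen, -⟩
  have hT : t₂ ≤ baseCost n L + (itemCost n L + (2 * L.length + 3)) * n ^ multExponent L :=
    ht₂.trans (Nat.add_le_add_left (weight_eq_le L t _) _)
  refine WP.ite ?_ (fun hb => ?_) (fun hb => ?_)
  · simp only [Test.Ok, hc₂.consts.r3, InRange]; omega
  · rw [Test.Holds, hc₂.consts.r3] at hb
    have hdec : Decomposes S n L (fun d => s₂.R (g + 1 + d)) t := by
      rcases hfound with h | h
      · omega
      · exact h.2
    apply WP.seq
    refine (recoverAll_spec hI hL.le (by omega) le_rfl hc₂ hdec).mono ?_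
    rintro s₃ t₃ ⟨ht₃, -, js, hjs, hsum⟩
    refine WP.block ?_ ?_
    · exact blockOk_append (copyRegs_ok _ _ _ _) ⟨trivial, trivial⟩
    rw [blockExec_append]
    obtain ⟨c1, c2, c3⟩ := copyRegs_exec (I := I) (dst := fun i => i + 1)
      (src := fun i => g + 1 + L.length + i) (m := k) (fun i _ j _ => by simp)
      (fun i hi j hj => by omega) s₃
    rw [hL] at hjs hsum
    refine ⟨?_, Or.inl ⟨by simp [blockExec, Instr.aexec], js, fun i hi => ⟨(hjs i hi).1, ?_⟩, hsum⟩⟩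
    · simp only [solveTime, List.length_append, copyRegs_length, List.length_cons, List.length_nil]
      omega
    · simp only [blockExec, Instr.aexec, AState.set_R]
      rw [if_neg (by omega), c2 i hi, (hjs i hi).2]
  · rw [Test.Holds, hc₂.consts.r3] at hb
    apply WP.block (by simp [blockOk, Instr.Ok])
    refine ⟨?_, Or.inr ⟨by simp [blockExec, Instr.aexec], fun h => hb ?_⟩⟩
    · simp only [solveTime, List.length_cons, List.length_nil]
      omega
    · exact hseen t h le_rfl le_rfl

end KSum

namespace KSum

/-! ### Bounds on the number of steps -/

/-- The function is bounded by `n ^ e` up to a polylogarithmic factor. -/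
def PolyLog (e : ℕ) (g : ℕ → ℕ) : Prop :=
  ∃ K c, ∀ n, 1 ≤ n → g n ≤ K * n ^ e * (Nat.log 2 n + 1) ^ c

theorem PolyLog.mono {e e' : ℕ} {g g' : ℕ → ℕ} (h : PolyLog e g) (he : e ≤ e')
    (hg : ∀ n, 1 ≤ n → g' n ≤ g n) : PolyLog e' g' := by
  obtain ⟨K, c, h⟩ := h
  refine ⟨K, c, fun n hn => (hg n hn).trans ((h n hn).trans ?_)⟩
  have := Nat.pow_le_pow_right hn he
  gcongr

theorem PolyLog.add {e : ℕ} {g g' : ℕ → ℕ} (h : PolyLog e g) (h' : PolyLog e g') :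
    PolyLog e fun n => g n + g' n := by
  obtain ⟨K, c, h⟩ := h
  obtain ⟨K', c', h'⟩ := h'
  refine ⟨K + K', c + c', fun n hn => ?_⟩
  have h1 : (Nat.log 2 n + 1) ^ c ≤ (Nat.log 2 n + 1) ^ (c + c') :=
    Nat.pow_le_pow_right (by omega) (by omega)
  have h2 : (Nat.log 2 n + 1) ^ c' ≤ (Nat.log 2 n + 1) ^ (c + c') :=
    Nat.pow_le_pow_right (by omega) (by omega)
  calc g n + g' n ≤ K * n ^ e * (Nat.log 2 n + 1) ^ c + K' * n ^ e * (Nat.log 2 n + 1) ^ c' :=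
        add_le_add (h n hn) (h' n hn)
    _ ≤ K * n ^ e * (Nat.log 2 n + 1) ^ (c + c') + K' * n ^ e * (Nat.log 2 n + 1) ^ (c + c') := by
        gcongr
    _ = _ := by ring

theorem PolyLog.mul {e e' : ℕ} {g g' : ℕ → ℕ} (h : PolyLog e g) (h' : PolyLog e' g') :
    PolyLog (e + e') fun n => g n * g' n := by
  obtain ⟨K, c, h⟩ := h
  obtain ⟨K', c', h'⟩ := h'
  refine ⟨K * K', c + c', fun n hn => (Nat.mul_le_mul (h n hn) (h' n hn)).trans_eq ?_⟩
  ring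

theorem PolyLog.const (e a : ℕ) : PolyLog e fun _ => a :=
  ⟨a, 0, fun n hn => by simpa using Nat.le_mul_of_pos_right a (Nat.pow_pos hn)⟩

theorem PolyLog.pow {e d : ℕ} (h : d ≤ e) : PolyLog e fun n => n ^ d :=
  ⟨1, 0, fun n hn => by simpa using Nat.pow_le_pow_right hn h⟩

theorem PolyLog.id {e : ℕ} (h : 1 ≤ e) : PolyLog e fun n => n := by
  simpa using PolyLog.pow h

theorem PolyLog.log (e : ℕ) : PolyLog e fun n => Nat.log 2 n :=
  ⟨1, 1, fun n hn => by
    simpa using (Nat.le_succ _).trans (Nat.le_mul_of_pos_left _ (Nat.pow_pos (n := e) hn))⟩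

theorem polyLog_scanTime : PolyLog 0 scanTime :=
  ((PolyLog.const 0 30).mul (.log 0)).add (.const 0 90)

theorem polyLog_mergeStepTime : PolyLog 0 mergeStepTime :=
  ((PolyLog.const 0 36).mul (.log 0)).add (.const 0 150)

theorem polyLog_sortTime : PolyLog 1 sortTime :=
  ((PolyLog.id le_rfl).mul (polyLog_mergeStepTime.add (.const 0 118))).add (.const 1 200)

theorem polyLog_nestTime {c : ℕ → ℕ} (hc : PolyLog 0 c) (d : ℕ) :
    PolyLog d fun n => nestTime n (c n) d := by
  induction d with
  | zero => exact hc
  | succ d ih =>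
    exact (((PolyLog.id le_rfl).mul (ih.add (.const d 17))).mono (by omega) fun _ _ => le_rfl).add
      (.const _ 5)

theorem polyLog_searchStepTime (d : ℕ) : PolyLog d fun n => searchStepTime n d :=
  (polyLog_nestTime (((PolyLog.const 0 15).mul (.log 0)).add (.const 0 60)) d).add (.const d 40)

theorem polyLog_itemCost (L : List Level) : PolyLog 0 fun n => itemCost n L := by
  induction L with
  | nil => exact .const 0 0
  | cons a L ih =>
    cases a
    · exact ih.add (.const 0 4)
    all_goals exact (ih.add polyLog_scanTime).add (.const 0 13)

/-- The exponent in the bound on the number of steps of `enumerate`. -/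
def costExponent : List Level → ℕ
  | [] => 0
  | .free :: L => costExponent L + 1
  | .merge :: L => max (1 + max 1 (costExponent L)) (numLists L)
  | .search d :: L => max (d + max (d + 1) (costExponent L)) (numLists L)

/-- For `search d` there are about `n ^ d` chunks, each with `n` searches of cost `n ^ d` up to
logarithms and one inner enumeration of base cost `n ^ costExponent L`. The exponent `numLists L`
comes from the single charge for each inner sum. -/
theorem polyLog_baseCost (L : List Level) : PolyLog (costExponent L) fun n => baseCost n L := by
  induction L with
  | nil => exact .const 0 10
  | cons a L ih =>
    have tail : ∀ e, numLists L ≤ e →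
        PolyLog e fun n => (itemCost n L + scanTime n) * n ^ numLists L := fun e he =>
      (((polyLog_itemCost L).add polyLog_scanTime).mul (.pow le_rfl)).mono (by omega) fun _ _ => le_rfl
    cases a with
    | free =>
      exact (((PolyLog.id le_rfl).mul (ih.add (.const _ 19))).mono (by rw [costExponent]; omega)
        fun _ _ => le_rfl).add (.const _ 5)
    | merge =>
      refine (((?_ : PolyLog _ _).add ?_).add (tail _ (le_max_right _ _))).add (.const _ 10)
      · exact ((polyLog_sortTime.add ((PolyLog.const 0 100).mul (.id le_rfl))).add (.const _ 130)).mono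
          (by omega) fun _ _ => le_rfl
      · exact (((PolyLog.id le_rfl).add (.const 1 1)).mul
          (((((PolyLog.id le_rfl).mul (polyLog_mergeStepTime.add (.const 0 18))).mono
            (le_max_left 1 (costExponent L)) fun _ _ => le_rfl).add (.const _ 50)).add
            (ih.mono (le_max_right _ _) fun _ _ => le_rfl) |>.add (.const _ 30))).mono
          (le_max_left _ _) fun _ _ => le_rfl
    | search d =>
      refine (((?_ : PolyLog _ _).add ?_).add (tail _ (le_max_right _ _))).add (.const _ 10)
      · exact polyLog_sortTime.mono (by omega) fun _ _ => le_rfl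
      · exact (((PolyLog.pow le_rfl).add (.const d 1)).mul
          (((((PolyLog.id le_rfl).mul ((polyLog_searchStepTime d).add (.const d 18))).mono
            ((by omega : 1 + d ≤ d + 1).trans (le_max_left _ (costExponent L)))
            fun _ _ => le_rfl).add (.const _ 50)).add
            (ih.mono (le_max_right _ _) fun _ _ => le_rfl) |>.add (.const _ 30))).mono
          (le_max_left _ _) fun _ _ => le_rfl

theorem multExponent_le (L : List Level) : multExponent L ≤ costExponent L := by
  induction L with
  | nil => exact le_rfl
  | cons a L ih =>
    cases a
    · exact Nat.succ_le_succ ih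
    all_goals exact le_max_right _ _

theorem polyLog_recoverTime (L : List Level) :
    PolyLog (costExponent L) fun n => recoverTime n L := by
  induction L with
  | nil => exact .const 0 1
  | cons a L ih =>
    -- Every way to process a group has at least the exponent of a trial of all its tuples.
    have h1 : a.size ≤ costExponent (a :: L) ∧ costExponent L ≤ costExponent (a :: L) := by
      cases a <;> simp only [costExponent, Level.size] <;> omega
    exact (((polyLog_nestTime (.const 0 _) a.size).mono h1.1 fun _ _ => le_rfl).add (.const _ 5)).add
      (ih.mono h1.2 fun _ _ => le_rfl)

theorem polyLog_solveTime (k : ℕ) (L : List Level) :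
    PolyLog (costExponent L) fun n => solveTime k n L :=
  ((((polyLog_baseCost L).add ((((polyLog_itemCost L).add (.const 0 _)).mul
    (.pow (multExponent_le L))).mono (by omega) fun _ _ => le_rfl)).add
    (polyLog_recoverTime L)).add (.const _ _)).add (.const _ 40)

/-! ### The choice of the groups -/

/-- Groups for which the exponent is smaller by `s` than the number of lists. -/
def savingLevels : ℕ → List Level
  | 0 => [.free]
  | 1 => [.search 0, .free]
  | 2 => [.merge, .search 0, .free]
  | 3 => [.search 2, .free, .merge, .search 0, .free]
  | s + 4 => .search (s + 3) :: savingLevels (s + 3)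

/-- The number of lists that is needed to save `s` in the exponent. -/
def savingSize (s : ℕ) : ℕ := numLists (savingLevels s)

theorem savingSize_succ (s : ℕ) : savingSize (s + 4) = savingSize (s + 3) + (s + 4) := rfl

/-- The saving `s + 4` takes `s + 4` lists more than the saving `s + 3`, so `savingSize` follows the
triangular numbers. This bound and `le_two_mul_savingSize` confine it between `1` and `2` plus the
triangular number, which is precise enough for `savingSize_le_mul`. -/
theorem two_mul_savingSize_le (s : ℕ) : 2 * savingSize s ≤ 4 + s * (s + 1) := by
  match s with
  | 0 | 1 | 2 | 3 => decide
  | s + 4 =>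
    have := two_mul_savingSize_le (s + 3)
    rw [savingSize_succ]
    nlinarith

theorem le_two_mul_savingSize (s : ℕ) : 2 + s * (s + 1) ≤ 2 * savingSize s := by
  match s with
  | 0 | 1 | 2 | 3 => decide
  | s + 4 =>
    have := le_two_mul_savingSize (s + 3)
    rw [savingSize_succ]
    nlinarith

theorem savingSize_mono : Monotone savingSize := by
  refine monotone_nat_of_le_succ fun s => ?_
  match s with
  | 0 | 1 | 2 => decide
  | s + 3 => rw [savingSize_succ]; omega

/-- A group `search d` in front of `L` gains one if `d + 1 ≤ costExponent L`, so that filling the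
chunks does not dominate, and if the saving of `L` is at most `d`, so that `n ^ numLists L` does not
dominate. The best choice for `d` is the saving of `L`. For the saving `3` a free list is inserted
because the exponent would otherwise be too small for the first condition. -/
theorem costExponent_savingLevels (s : ℕ) :
    costExponent (savingLevels s) + s = savingSize s := by
  match s with
  | 0 | 1 | 2 | 3 => decide
  | s + 4 =>
    have h1 := costExponent_savingLevels (s + 3)
    have h2 := le_two_mul_savingSize (s + 3)
    have h3 : numLists (savingLevels (s + 3)) = savingSize (s + 3) := rfl
    rw [savingSize_succ, savingLevels, costExponent, h3]
    -- Equivalently, the exponent of the previous groups is at least `s + 4`, the exponent of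
    -- filling one chunk.
    have h4 : s + 3 + 1 + (s + 3) ≤ savingSize (s + 3) := by nlinarith
    omega

/-- Add groups of one list. -/
theorem exists_levels {k s : ℕ} (h : savingSize s ≤ k) :
    ∃ L, numLists L = k ∧ costExponent L + s = k := by
  induction k, h using Nat.le_induction with
  | base => exact ⟨savingLevels s, rfl, costExponent_savingLevels s⟩
  | succ k _ ih =>
    obtain ⟨L, h1, h2⟩ := ih
    exact ⟨.free :: L, by simp [numLists, Level.size, h1], by rw [costExponent]; omega⟩

theorem f_le {k : ℕ} (hk : 1 ≤ k) : f k ≤ k := by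
  induction k using Nat.strong_induction_on with
  | _ k ih =>
    match k, hk with
    | 1, _ | 2, _ | 3, _ | 4, _ => simp [f]
    | k + 5, _ =>
      rw [f, Finset.fold_min_le]
      have := ih (k + 4) (by omega) (by omega)
      left; omega

/-- The candidate of `f` with `k₁ = b`, `k₂ = c` saves the smaller of `b - f b + c - 1` and `b - 1`;
with `a = b - f b` these are the bounds on `s`. For `s = a + e + 1` one has `a + e + 2 ≤ b` and `e +
2 ≤ c`, and in the doubled inequality the quadratic bounds leave a margin of `(e + 1) * (e + 2) - 2
≥ 0`. -/
theorem savingSize_le_mul {a b c s : ℕ} (ha : savingSize a ≤ b) (hs : s < a + c) (hsb : s < b)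
    (hc : 1 ≤ c) : savingSize s ≤ b * c := by
  by_cases hsa : s ≤ a
  · exact (savingSize_mono hsa).trans (ha.trans (Nat.le_mul_of_pos_right b hc))
  · obtain ⟨e, rfl⟩ : ∃ e, s = a + (e + 1) := ⟨s - a - 1, by omega⟩
    have h1 := two_mul_savingSize_le (a + (e + 1))
    have h2 := le_two_mul_savingSize a
    have h3 : b * (e + 2) ≤ b * c := Nat.mul_le_mul_left b (by omega)
    have h4 : (a + e + 2) * (e + 1) ≤ b * (e + 1) := Nat.mul_le_mul_right _ (by omega)
    nlinarith

/-- A saving `s` in the recursion of `f` is inherited from `k - 1` or comes from a product, and in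
both cases `savingSize s` lists are available. The groups can be strictly better: `f 12 = 9`, while
`savingSize 4 = 12` gives the exponent `8`. -/
theorem lt_f_add {k : ℕ} (hk : 1 ≤ k) : ∀ s, k < savingSize s → k < f k + s := by
  induction k using Nat.strong_induction_on with
  | _ k ih =>
    intro s hs
    match k, hk with
    | 1, _ | 2, _ | 3, _ | 4, _ =>
      have : ∀ s', s ≤ s' → _ := fun s' h => hs.trans_le (savingSize_mono h)
      have h0 := this 0
      have h1 := this 1
      have h2 := this 2
      have e0 : savingSize 0 = 1 := rfl
      have e1 : savingSize 1 = 2 := rfl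
      have e2 : savingSize 2 = 4 := rfl
      simp only [f]
      omega
    | k + 5, _ =>
      -- `k + 6` is the argument plus one; this states the strict inequality in a form suited to a
      -- minimum, and truncation does no harm.
      have key : k + 6 - s ≤ f (k + 5) := by
        rw [f, Finset.le_fold_min]
        refine ⟨?_, ?_⟩
        · have := ih (k + 4) (by omega) (by omega) s (by omega)
          omega
        · rintro ⟨d, hd⟩ -
          rw [Nat.mem_properDivisors] at hd
          obtain ⟨⟨e, hde⟩, hlt⟩ := hd
          simp only
          have hd0 : 0 < d := by
            rcases Nat.eq_zero_or_pos d with rfl | h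
            · omega
            · exact h
          rw [hde, Nat.mul_div_cancel_left _ hd0, ← hde]
          have he : 1 ≤ e := by
            rcases Nat.eq_zero_or_pos e with rfl | h
            · omega
            · exact h
          have hle := f_le hd0
          -- If this failed, the induction hypothesis would say that `d` saves less than `d - f d`.
          have ha : savingSize (d - f d) ≤ d := by
            by_contra hc
            have := ih d hlt hd0 (d - f d) (by omega)
            omega
          by_contra hc
          -- `(d - 1) * (e - 1) ≥ 0`, so the subtractions in the definition of `f` do not truncate.
          have hsum : d + e ≤ k + 6 := by
            have : d + e ≤ d * e + 1 := by nlinarith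
            omega
          have := savingSize_le_mul (s := s) ha (c := e) (by omega) (by omega) he
          omega
      omega

/-- The saving is chosen to be exactly that of `f`, even where more would be possible; superfluous
lists become free groups. -/
theorem exists_levels_f {k : ℕ} (hk : 1 ≤ k) : ∃ L, numLists L = k ∧ costExponent L = f k := by
  have h1 := f_le hk
  obtain ⟨L, h2, h3⟩ := exists_levels (k := k) (s := k - f k) (by
    by_contra hc
    have := lt_f_add hk (k - f k) (by omega)
    omega)
  exact ⟨L, h2, by omega⟩

/-! ### Initial and final states -/

/-- The instance with indices in the natural numbers. -/
def extend {k n : ℕ} (S : Fin k → Fin n → ℤ) (i j : ℕ) : ℤ :=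
  if h : i < k ∧ j < n then S ⟨i, h.1⟩ ⟨j, h.2⟩ else 0

/-- The initial data of the abstract machine. -/
def initialA {k n : ℕ} (S : Fin k → Fin n → ℤ) (t : ℤ) : AState where
  R r := if r = 0 then n else if r = 1 then t else 0
  M a := if a.toNat < k * n then extend S (a.toNat / n) (a.toNat % n) else 0

theorem represents_initial (w : ℕ) {k n : ℕ} (S : Fin k → Fin n → ℤ) (t : ℤ) :
    Represents (initial w S t) (initialA S t) := by
  refine ⟨fun r => ?_, fun a => ?_⟩
  · simp only [initial, initialA]
    split_ifs <;> simp
  · simp only [initial, initialA, Int.toNat_natCast]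
    split_ifs with h
    · have hn : 0 < n := by
        rcases Nat.eq_zero_or_pos n with rfl | h'
        · simp at h
        · exact h'
      rw [extend, dif_pos ⟨(Nat.div_lt_iff_lt_mul hn).2 h, Nat.mod_lt _ hn⟩]
      rfl
    · simp

theorem inputMem_initial {k n : ℕ} (S : Fin k → Fin n → ℤ) (t : ℤ) :
    InputMem k n (extend S) (initialA S t).M := by
  refine ⟨fun i hi j hj => ?_, ?_⟩
  · have e : ((i : ℤ) * n + j).toNat = i * n + j := by
      rw [show (i : ℤ) * n + j = ((i * n + j : ℕ) : ℤ) by push_cast; ring, Int.toNat_natCast]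
    have h : i * n + j < k * n := by
      have : (i + 1) * n ≤ k * n := Nat.mul_le_mul_right n hi
      linarith
    simp only [initialA, e]
    rw [if_pos h, mul_comm i n, Nat.mul_add_div (by omega), Nat.mul_add_mod,
      Nat.div_eq_of_lt hj, Nat.mod_eq_of_lt hj, add_zero]
  · have e : ((k : ℤ) * n).toNat = k * n := by
      rw [show (k : ℤ) * n = ((k * n : ℕ) : ℤ) by push_cast; ring, Int.toNat_natCast]
    simp only [initialA, e, lt_irrefl, if_false]

/-- `I + 1` is a quarter of the number of words, so that sums and differences of two numbers of size
at most `I` keep their sign as words. `V` is the largest absolute value that `Fits` permits, and `8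
* (k + 2) ≤ C` makes `(k + 1) * V` and `n` small compared with `I`. The summand `q` reserves space
for registers. -/
theorem Fits.exists_instance {k n d C q w : ℕ} {S : Fin k → Fin n → ℤ} {t : ℤ} (hn : 1 ≤ n)
    (hC : 8 * (k + 2) ≤ C) (hC' : k + 5 * d + 1 + q ≤ C) (h : Fits C w S t) :
    ∃ I V : ℤ, 4 * (I + 1) = 2 ^ w ∧ Instance I (memBase k n d) k n (extend S) V ∧
      |t| + k * V < I ∧ memBase k n d + q ≤ C * n := by
  obtain ⟨hw1, hw2, hw3⟩ := h
  have hCn : C ≤ C * n := Nat.le_mul_of_pos_right C hn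
  obtain ⟨I, hI⟩ : ∃ I : ℤ, 4 * (I + 1) = 2 ^ w := by
    have hw : 2 ≤ w := by
      by_contra h
      have : 2 ^ w ≤ 2 ^ 1 := Nat.pow_le_pow_right (by norm_num) (by omega)
      omega
    obtain ⟨v, rfl⟩ := Nat.exists_eq_add_of_le hw
    exact ⟨2 ^ v - 1, by rw [pow_add]; ring⟩
  have hw1' : (C : ℤ) * n < 2 ^ w := by exact_mod_cast hw1
  have hCZ : 8 * ((k : ℤ) + 2) ≤ C := by exact_mod_cast hC
  have hnZ : (1 : ℤ) ≤ n := by exact_mod_cast hn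
  have hCpos : (0 : ℤ) < C := by omega
  have h8n : 8 * ((k : ℤ) + 2) * n ≤ C * n := mul_le_mul_of_nonneg_right hCZ (by omega)
  have hkn : 0 ≤ (k : ℤ) * n := by positivity
  obtain ⟨V, hV⟩ : ∃ V : ℤ, V = (2 ^ w - 1) / C := ⟨_, rfl⟩
  have hbound : ∀ z : ℤ, C * |z| < 2 ^ w → |z| ≤ V := fun z hz => by
    rw [hV, Int.le_ediv_iff_mul_le hCpos, mul_comm]; omega
  have htV := hbound t hw3
  have hV0 : 0 ≤ V := (abs_nonneg t).trans htV
  have hCV : C * V ≤ 2 ^ w - 1 := by rw [hV]; exact Int.mul_ediv_self_le hCpos.ne'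
  have h8V : 8 * ((k : ℤ) + 2) * V ≤ C * V := mul_le_mul_of_nonneg_right hCZ hV0
  have hS : ∀ i < k, ∀ j < n, |extend S i j| ≤ V := fun i hi j hj => by
    rw [extend, dif_pos ⟨hi, hj⟩]; exact hbound _ (hw2 _ _)
  have hln : 0 ≤ 5 * (d : ℤ) * n := by positivity
  have hCr : ((k : ℤ) + 5 * d + 1 + q) * n ≤ C * n :=
    mul_le_mul_of_nonneg_right (by exact_mod_cast hC') (by omega)
  have hq : (q : ℤ) ≤ q * n := le_mul_of_one_le_right (Int.natCast_nonneg q) hnZ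
  have hN : memBase k n d = ((k : ℤ) + 5 * d) * n + 1 := by rw [memBase]; push_cast; ring
  rw [← hI] at hw1' hCV
  clear hw1 hw2 hw3 hbound hV
  refine ⟨I, V, hI, ⟨hn, ?_, hV0, hS, ?_, ?_⟩, ?_, ?_⟩
  · linarith
  · linarith
  · rw [hN]; linarith
  · linarith
  · rw [hN]; linarith

theorem lasVegasSolves_solve {k : ℕ} {L : List Level} (hL : numLists L = k)
    {T : ℕ → ℕ} {C : ℕ} (hT : ∀ n, 1 ≤ n → solveTime k n L ≤ T n) (hC : 8 * (k + 2) ≤ C)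
    (hC' : k + 5 * L.length + 1 + (solve k L).numRegs ≤ C) :
    LasVegasSolves k (solve k L) C T (fun n => C * n) := by
  intro n hn S t w hfit
  obtain ⟨I, V, hI, hinst, htV, hNC⟩ := hfit.exists_instance hn hC hC'
  have hw1 : (C : ℤ) * n < 2 ^ w := by exact_mod_cast hfit.1
  have hnw := hinst.n_le
  obtain ⟨s', m, hE, hm, hQ⟩ := solve_spec hinst hL le_rfl htV (s := initialA S t)
    rfl rfl (inputMem_initial S t)
  obtain ⟨b1, b2, b3⟩ := hE.run_bounds hI (by omega) (represents_initial w S t)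
    (by simp only [initial]; push_cast; exact hinst.mem_le.le)
  refine ⟨fun ω m' hm' => ?_, b2.trans (by exact_mod_cast hm.trans (hT n hn)), fun ω m' => ?_⟩
  · have hr := (b1 ω m' hm').reg
    have hext : ∀ (i : Fin k) (j : Fin n), extend S i j = S i j := fun i j => by
      rw [extend, dif_pos ⟨i.2, j.2⟩]
    rcases hQ with ⟨h0, js, hjs, hsum⟩ | ⟨h0, hno⟩
    · left
      refine ⟨by rw [hr, h0]; simp, fun i => ⟨js i, (hjs i i.2).1⟩, ?_, fun i => ?_⟩
      · rw [IsSolution, ← hsum, Finset.sum_range]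
        exact Finset.sum_congr rfl fun i _ => (hext i ⟨js i, (hjs i i.2).1⟩).symm
      · have h1 := hjs i i.2
        have h2 : ((js i : ℕ) : ℤ) < n := by exact_mod_cast h1.1
        rw [hr, h1.2]
        have := toNat_ofInt_of_lt (w := w) (z := (js i : ℤ)) (Int.natCast_nonneg _) (by omega)
        exact_mod_cast this
    · right
      refine ⟨by rw [hr, h0]; simp, fun σ hσ => hno ?_⟩
      have hmem := sum_mem_sums (S := extend S) (n := n) (L := L)
        (js := fun i => if h : i < k then σ ⟨i, h⟩ else 0) (fun i hi => by
          rw [hL] at hi; simp only [dif_pos hi]; exact (σ ⟨i, hi⟩).2)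
      have e : ∑ i ∈ Finset.range (numLists L),
          extend S i (if h : i < k then σ ⟨i, h⟩ else 0) = t := by
        rw [hL, Finset.sum_range, ← hσ]
        refine Finset.sum_congr rfl fun i _ => ?_
        rw [dif_pos i.2]
        exact hext i (σ i)
      rwa [e] at hmem
  · have := (b3 ω m').trans hNC
    exact_mod_cast this

end KSum

theorem mainTheorem5 (k : ℕ) (hk : 1 ≤ k) :
    ∃ (P : KSum.Prog) (C c : ℕ),
      KSum.LasVegasSolves k P C
        (fun n => C * n ^ KSum.f k * (Nat.log 2 n + 1) ^ c)
        (fun n => C * n) := by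
  obtain ⟨L, hL, he⟩ := KSum.exists_levels_f hk
  obtain ⟨K, c, hK⟩ := KSum.polyLog_solveTime k L
  rw [he] at hK
  -- One constant serves three purposes: `K` for the time, `8 * (k + 2)` for the range of the
  -- numbers, and the last summand for the input, five blocks of `n` cells per level, one extra cell
  -- and the registers.
  refine ⟨KSum.solve k L, K + 8 * (k + 2) + (k + 5 * L.length + 1 + (KSum.solve k L).numRegs), c,
    KSum.lasVegasSolves_solve hL (fun n hn => (hK n hn).trans ?_) (by omega) (by omega)⟩
  gcongr
  omega
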